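/- Let $\mathbb S^1=[-\pi,\pi]$ with periodic boundary conditions, $\gamma(s)=(\cos s,\sin s)$, and write $'$ for $\partial_s$. For $T^\star\in(0,\infty]$ we call a function $h=h(s,t)\in C([0,T^\star);C^2(\mathbb S^1))$ a solution of the N-Peskin equation if, for all $0<t<T^\star$ and $s\in\mathbb S^1$, the time derivative $\partial_t h(s,t)$ exists and (omitting $t$) $$ \begin{aligned} \partial_t h(s)+\gamma(s)\cdot \frac{dM}{dt} ={}&-\frac1{8\pi}\int_{-\pi}^{\pi}\log\big(D(s,\alpha)\big)\,\partial_\alpha^2\big[\cos\alpha\,(1+h(s-\alpha))\big]\,d\alpha\\ &+\frac1{4\pi}\int_{-\pi}^{\pi}\frac{[1+h(s)-(1+h(s-\alpha))\cos\alpha]\,[(1+h(s))\cos\alpha-(1+h(s-\alpha))]}{D(s,\alpha)}\,\big(h''(s-\alpha)-1-h(s-\alpha)\big)\,d\alpha\\ &+\frac{1}{2\pi}(1+h(s))\int_{-\pi}^{\pi}\frac{[1+h(s)-(1+h(s-\alpha))\cos\alpha]\sin\alpha}{D(s,\alpha)}\,h'(s-\alpha)\,d\alpha, \end{aligned} $$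 where $$D(s,\alpha)=(1+h(s))^2+(1+h(s-\alpha))^2-2(1+h(s))(1+h(s-\alpha))\cos\alpha,\qquad \frac{dM}{dt}=\frac14\,\frac1{2\pi}\int_{-\pi}^{\pi}h(\sigma,t)\,(\cos\sigma,\sin\sigma)\,d\sigma .$$ Let $|f|_{W^{1,\infty}}=|f|_{L^\infty}+|f'|_{L^\infty}$. **Proposition.** There exist universal constants $c_0>0$ and $\delta>0$ such that the following holds for every $T^\star\in(0,\infty]$ and every solution $h\in C([0,T^\star);C^2(\mathbb S^1))$ of the N-Peskin equation with initial datum $h|_{t=0}=h_0$. If $|h_0|_{W^{1,\infty}}<c_0$, then $t\mapsto|h(t)|_{W^{1,\infty}}$ is non-increasing on $[0,T^\star)$; in particular $$|h(t)|_{W^{1,\infty}}\le|h_0|_{W^{1,\infty}}\qquad\text{for all }0\le t<T^\star .$$ Furthermore, $$|h'(t)|_{L^\infty}\le|h_0'|_{L^\infty}\,e^{-\delta t}\qquad\text{for all }0\le t<T^\star .$$ -/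

import Mathlib

open Set Filter Topology MeasureTheory

noncomputable section

namespace NPeskin

/-! Functions on the circle `𝕊¹ = [-π, π]` (with periodic boundary conditions) are `2π`-periodic
functions `f : ℝ → ℝ`; `deriv f` and `iteratedDeriv 2 f` are `f'` and `f''`.  A time dependent
function is written `h t s`, time first. -/

/-- Supremum norm, which is the `L^∞(𝕊¹)` norm of a continuous `2π`-periodic function. -/
def supNorm (f : ℝ → ℝ) : ℝ := ⨆ s : ℝ, |f s|

/-- `|f|_{W^{1,∞}} = |f|_{L^∞} + |f'|_{L^∞}` for a `C¹` function `f` of period `2π`. -/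
def w1infNorm (f : ℝ → ℝ) : ℝ := supNorm f + supNorm (deriv f)

/-- The squared chord `|(1 + f(s)) γ(s) - (1 + f(s-α)) γ(s-α)|²`, where `γ(s) = (cos s, sin s)`. -/
def chordSq (f : ℝ → ℝ) (s α : ℝ) : ℝ :=
  (1 + f s) ^ 2 + (1 + f (s - α)) ^ 2 - 2 * (1 + f s) * (1 + f (s - α)) * Real.cos α

/-- The logarithmic term of the equation. -/
def J₁ (f : ℝ → ℝ) (s : ℝ) : ℝ :=
  -(1 / (8 * Real.pi)) * ∫ α in (-Real.pi)..Real.pi,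
    Real.log (chordSq f s α) *
      iteratedDeriv 2 (fun β : ℝ => Real.cos β * (1 + f (s - β))) α

/-- The term of the equation that contains `h'' - 1 - h`. -/
def J₂ (f : ℝ → ℝ) (s : ℝ) : ℝ :=
  1 / (4 * Real.pi) * ∫ α in (-Real.pi)..Real.pi,
    ((1 + f s - (1 + f (s - α)) * Real.cos α) * ((1 + f s) * Real.cos α - (1 + f (s - α))))
      / chordSq f s α * (iteratedDeriv 2 f (s - α) - 1 - f (s - α))

/-- The term of the equation that contains `h'`. -/
def J₃ (f : ℝ → ℝ) (s : ℝ) : ℝ :=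
  1 / (2 * Real.pi) * (1 + f s) * ∫ α in (-Real.pi)..Real.pi,
    ((1 + f s - (1 + f (s - α)) * Real.cos α) * Real.sin α)
      / chordSq f s α * deriv f (s - α)

/-- The velocity `dM/dt = (1/4) (1/2π) ∫ f(σ) (cos σ, sin σ) dσ` of the point `M`. -/
def centerVelocity (f : ℝ → ℝ) : ℝ × ℝ :=
  (1 / 4 * (1 / (2 * Real.pi)) * ∫ σ in (-Real.pi)..Real.pi, f σ * Real.cos σ,
   1 / 4 * (1 / (2 * Real.pi)) * ∫ σ in (-Real.pi)..Real.pi, f σ * Real.sin σ)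

/-- `γ(s) · dM/dt`. -/
def centerTerm (f : ℝ → ℝ) (s : ℝ) : ℝ :=
  Real.cos s * (centerVelocity f).1 + Real.sin s * (centerVelocity f).2

/-- The time interval `[0, T)`, where `T` may be `∞`. -/
def timeInterval (T : EReal) : Set ℝ := {t : ℝ | 0 ≤ t ∧ (t : EReal) < T}

/-- `h` belongs to `C([0, T); C²(𝕊¹))`: each `h t` is a `C²` function on the circle, and `h t`,
`(h t)'`, `(h t)''` depend continuously on `t` in the supremum norm. -/
structure IsContinuousC2 (T : EReal) (h : ℝ → ℝ → ℝ) : Prop where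
  periodic : ∀ t ∈ timeInterval T, Function.Periodic (h t) (2 * Real.pi)
  contDiff : ∀ t ∈ timeInterval T, ContDiff ℝ 2 (h t)
  continuous : ∀ k : ℕ, k ≤ 2 → ∀ t₀ ∈ timeInterval T,
    TendstoUniformly (fun t : ℝ => iteratedDeriv k (h t)) (iteratedDeriv k (h t₀))
      (𝓝[timeInterval T] t₀)

/-- `h` is a `C([0, T); C²(𝕊¹))` solution of the N-Peskin equation
`∂ₜ h + γ · dM/dt = J₁ + J₂ + J₃`. -/
structure IsSolution (T : EReal) (h : ℝ → ℝ → ℝ) : Prop where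
  regular : IsContinuousC2 T h
  equation : ∀ t : ℝ, 0 < t → (t : EReal) < T → ∀ s : ℝ,
    HasDerivAt (fun τ : ℝ => h τ s)
      (J₁ (h t) s + J₂ (h t) s + J₃ (h t) s - centerTerm (h t) s) t

end NPeskin

end

/-! Integration by parts in `α` turns the right hand side into a principal value: `4 * π * rhs` is
the limit, as `ε → 0`, of the integral over `ε ≤ |α| ≤ π` of `(-θ + nonlin) / chord`, where `chord α
= 2 sin (α / 2)` and `θ` is the increment of `h` divided by the chord. The term `-θ / chord`
produces minus a quarter of the half Laplacian; the term `γ · dM/dt` cancels the other linear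
contribution. What remains is at least quadratic in `θ` and the slope `w = h'(s - α)`, with
coefficients that are smooth in `(α, θ, 1 + h(s))` on a compact box, so its constants are universal.

At a maximum of `|h|` the half Laplacian has a sign and absorbs every error containing `θ`. Only
`|α| w ^ 2 / |chord|` is left, hence `|h|_∞` grows at most at the rate `C c |h'|_∞`
(`exists_rhs_bound_at_max`).

For the slope, the kernel is differentiated in `s`, and a second integration by parts removes `h''`.
The result is the kernel of the half Laplacian acting on `h'`, with the relative perturbation
`dissCoef = O(c)`, plus `h'(s)` times a term of size `1 / chord`. That term has a null structure:
for `w = θ` it loses its singularity at `α = 0`. The difference `w - θ` is controlled by the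
dissipation through Hardy's inequality in `L¹`. Since `h'` has mean zero, the dissipation at a
maximum of `|h'|` bounds `|h'|_∞`, and exponential decay follows. The equation need not be
differentiable in `s`, so all this is done for difference quotients of step `η` and integrals
truncated at `ε`; the errors depend on a bound `K` of `h''` but vanish with `η`
(`exists_slope_decay`, `exists_deriv_decay`).

With `C c ≤ 1 / 64` the growth of `|h|_∞` is paid for by the decay of `|h'|_∞`, so the sum does not
increase while it is small (`exists_w1infNorm_le`), and a continuity argument shows that it stays
small. -/

noncomputable section

namespace NPeskin

/-! ### The algebra of the kernel -/

/-- Length (with sign) of the chord of the unit circle of angle `α`. -/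
def chord (α : ℝ) : ℝ := 2 * Real.sin (α / 2)

/-- `cos (α / 2)`. -/
def halfCos (α : ℝ) : ℝ := Real.cos (α / 2)

/-! The coefficients of the kernel are functions of `p = (α, θ, x)`, where `x` is the radius at `s`
and `θ` the quotient of the increment of the radius by the chord of the unit circle. -/

/-- The radius at `s - α`. -/
def farRadius (p : ℝ × ℝ × ℝ) : ℝ := p.2.2 - chord p.1 * p.2.1

/-- The quotient of the squared chords of the curve and of the unit circle. -/
def kerDen (p : ℝ × ℝ × ℝ) : ℝ := p.2.1 ^ 2 + p.2.2 * farRadius p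

/-- Coefficient of the square of the slope in the nonlinear kernel. -/
def coefQuad (p : ℝ × ℝ × ℝ) : ℝ :=
  (p.2.1 + farRadius p * chord p.1 / 2) *
    (p.2.2 ^ 2 * (1 - chord p.1 ^ 2 / 2) + p.2.1 * p.2.2 * chord p.1 - p.2.1 ^ 2) / kerDen p ^ 2

/-- Coefficient of the slope in the nonlinear kernel, divided by `θ ^ 2`. -/
def coefLinRed (p : ℝ × ℝ × ℝ) : ℝ :=
  -halfCos p.1 * (4 * p.2.2 * farRadius p + chord p.1 ^ 2 * p.2.1 ^ 2) / kerDen p ^ 2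

/-- Part of the nonlinear kernel that is free of the slope, divided by `θ ^ 2`. -/
def coefConstRed (p : ℝ × ℝ × ℝ) : ℝ :=
  (farRadius p ^ 3 * chord p.1 / 2 + (farRadius p ^ 2 + 2 * p.2.2 * farRadius p) * p.2.1
    + farRadius p * chord p.1 * (1 - chord p.1 ^ 2 / 2) / 2 * p.2.1 ^ 2 + p.2.1 ^ 3) / kerDen p ^ 2

/-- Coefficient of the slope in the nonlinear kernel. -/
def coefLin (p : ℝ × ℝ × ℝ) : ℝ := p.2.1 ^ 2 * coefLinRed p

/-- Part of the nonlinear kernel that is free of the slope. -/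
def coefConst (p : ℝ × ℝ × ℝ) : ℝ := p.2.1 ^ 2 * coefConstRed p

/-- The nonlinear part of the kernel (times the chord). -/
def nonlin (p : ℝ × ℝ × ℝ) (w : ℝ) : ℝ := coefQuad p * w ^ 2 + coefLin p * w + coefConst p

/-- The range of the parameters of the kernel. -/
def kerBox : Set (ℝ × ℝ × ℝ) :=
  Icc (-Real.pi) Real.pi ×ˢ Icc (-(1 / 4)) (1 / 4) ×ˢ Icc (3 / 4) (5 / 4)

/-- The directions of the parameters `α`, `θ` and `x`. -/
def dirAngle : ℝ × ℝ × ℝ := (1, 0, 0)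
/-- See `dirAngle`. -/
def dirQuot : ℝ × ℝ × ℝ := (0, 1, 0)
/-- See `dirAngle`. -/
def dirRad : ℝ × ℝ × ℝ := (0, 0, 1)

/-- Quotient of `nonlin p w - nonlin p m` by `w - m`. -/
def slopeQuot (z : (ℝ × ℝ × ℝ) × ℝ × ℝ) : ℝ :=
  coefQuad z.1 * (z.2.1 + z.2.2) + coefLin z.1

/-- The derivative of `nonlin` in a direction. -/
def nonlinDir (v p : ℝ × ℝ × ℝ) (w : ℝ) : ℝ :=
  fderiv ℝ coefQuad p v * w ^ 2 + fderiv ℝ coefLin p v * w + fderiv ℝ coefConst p v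

/-- Relative perturbation of the kernel of the half Laplacian in the equation for the slope;
here `z = ((α, θ, x), w, m)`. -/
def dissCoef (z : (ℝ × ℝ × ℝ) × ℝ × ℝ) : ℝ :=
  -nonlinDir dirQuot z.1 z.2.1
    + chord z.1.1 * (fderiv ℝ coefQuad z.1 dirAngle * (z.2.1 + z.2.2)
        + fderiv ℝ coefLin z.1 dirAngle)
    + (fderiv ℝ coefQuad z.1 dirQuot * (z.2.1 + z.2.2) + fderiv ℝ coefLin z.1 dirQuot)
        * (z.2.1 - z.1.2.1 * halfCos z.1.1)
    - halfCos z.1.1 * slopeQuot z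

/-! ### Compactness of the parameter ranges and smoothness of the coefficients. -/

theorem isCompact_kerBox : IsCompact kerBox :=
  isCompact_Icc.prod (isCompact_Icc.prod isCompact_Icc)

theorem convex_kerBox : Convex ℝ kerBox :=
  (convex_Icc _ _).prod ((convex_Icc _ _).prod (convex_Icc _ _))

theorem abs_chord_le_two (α : ℝ) : |chord α| ≤ 2 := by
  have := Real.abs_sin_le_one (α / 2)
  rw [chord, abs_mul, abs_two]; linarith

theorem kerDen_pos {p : ℝ × ℝ × ℝ} (hp : p ∈ kerBox) : 0 < kerDen p := by
  obtain ⟨-, ⟨h1, h2⟩, ⟨h3, h4⟩⟩ := hp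
  have hc := abs_le.1 (abs_chord_le_two p.1)
  have ht : |p.2.1| ≤ 1 / 4 := abs_le.2 ⟨h1, h2⟩
  have h5 : |chord p.1 * p.2.1| ≤ 2 * (1 / 4) := by
    rw [abs_mul]
    exact mul_le_mul (abs_chord_le_two _) ht (abs_nonneg _) (by norm_num)
  have h6 := (abs_le.1 h5).2
  have : 0 < farRadius p := by unfold farRadius; linarith
  unfold kerDen
  have := mul_pos (show 0 < p.2.2 by linarith) this
  positivity

theorem contDiff_chord : ContDiff ℝ 5 chord := by unfold chord; fun_prop

theorem contDiff_halfCos : ContDiff ℝ 5 halfCos := by unfold halfCos; fun_prop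

theorem contDiff_farRadius : ContDiff ℝ 5 farRadius := by
  unfold farRadius
  exact (by fun_prop : ContDiff ℝ 5 fun p : ℝ × ℝ × ℝ => p.2.2).sub
    ((contDiff_chord.comp (by fun_prop)).mul (by fun_prop))

theorem contDiff_kerDen : ContDiff ℝ 5 kerDen := by
  unfold kerDen
  have := contDiff_farRadius
  fun_prop

theorem contDiffAt_coefQuad {p : ℝ × ℝ × ℝ} (hp : kerDen p ≠ 0) : ContDiffAt ℝ 5 coefQuad p := by
  have h1 := contDiff_farRadius
  have h2 : ContDiff ℝ 5 fun p : ℝ × ℝ × ℝ => chord p.1 := contDiff_chord.comp (by fun_prop)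
  have h4 := contDiff_kerDen
  unfold coefQuad
  exact ContDiffAt.div (by fun_prop) (by fun_prop) (pow_ne_zero 2 hp)

theorem contDiffAt_coefLinRed {p : ℝ × ℝ × ℝ} (hp : kerDen p ≠ 0) :
    ContDiffAt ℝ 5 coefLinRed p := by
  have h1 := contDiff_farRadius
  have h2 : ContDiff ℝ 5 fun p : ℝ × ℝ × ℝ => chord p.1 := contDiff_chord.comp (by fun_prop)
  have h3 : ContDiff ℝ 5 fun p : ℝ × ℝ × ℝ => halfCos p.1 := contDiff_halfCos.comp (by fun_prop)
  have h4 := contDiff_kerDen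
  unfold coefLinRed
  exact ContDiffAt.div (by fun_prop) (by fun_prop) (pow_ne_zero 2 hp)

theorem contDiffAt_coefConstRed {p : ℝ × ℝ × ℝ} (hp : kerDen p ≠ 0) :
    ContDiffAt ℝ 5 coefConstRed p := by
  have h1 := contDiff_farRadius
  have h2 : ContDiff ℝ 5 fun p : ℝ × ℝ × ℝ => chord p.1 := contDiff_chord.comp (by fun_prop)
  have h4 := contDiff_kerDen
  unfold coefConstRed
  exact ContDiffAt.div (by fun_prop) (by fun_prop) (pow_ne_zero 2 hp)

theorem contDiffAt_coefLin {p : ℝ × ℝ × ℝ} (hp : kerDen p ≠ 0) : ContDiffAt ℝ 5 coefLin p :=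
  ContDiffAt.mul (f := fun p : ℝ × ℝ × ℝ => p.2.1 ^ 2) (by fun_prop) (contDiffAt_coefLinRed hp)

theorem contDiffAt_coefConst {p : ℝ × ℝ × ℝ} (hp : kerDen p ≠ 0) : ContDiffAt ℝ 5 coefConst p :=
  ContDiffAt.mul (f := fun p : ℝ × ℝ × ℝ => p.2.1 ^ 2) (by fun_prop) (contDiffAt_coefConstRed hp)

theorem contDiffAt_fderiv_apply {E : Type*} [NormedAddCommGroup E] [NormedSpace ℝ E] {f : E → ℝ}
    {p : E} (hf : ContDiffAt ℝ 5 f p) (v : E) : ContDiffAt ℝ 4 (fun q => fderiv ℝ f q v) p :=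
  (hf.fderiv_right (m := 4) (by norm_num)).clm_apply contDiffAt_const

/-- A `C¹` function on a compact convex set is Lipschitz there. -/
theorem exists_lipschitz_of_contDiffAt {E : Type*} [NormedAddCommGroup E] [NormedSpace ℝ E]
    {f : E → ℝ} {s : Set E} (hs : IsCompact s) (hc : Convex ℝ s)
    (hf : ∀ p ∈ s, ContDiffAt ℝ 1 f p) :
    ∃ C : ℝ, 0 ≤ C ∧ ∀ p ∈ s, ∀ q ∈ s, |f p - f q| ≤ C * ‖p - q‖ := by
  obtain ⟨K, hK⟩ := ContDiffOn.exists_lipschitzOnWith (n := 1)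
    (fun p hp => (hf p hp).contDiffWithinAt) one_ne_zero hc hs
  refine ⟨K, K.2, fun p hp q hq => ?_⟩
  simpa [Real.norm_eq_abs] using hK.norm_sub_le hp hq

theorem exists_bound_of_contDiffAt {E : Type*} [NormedAddCommGroup E] [NormedSpace ℝ E]
    {f : E → ℝ} {s : Set E} (hs : IsCompact s) (hf : ∀ p ∈ s, ContDiffAt ℝ 1 f p) :
    ∃ C : ℝ, 0 ≤ C ∧ ∀ p ∈ s, |f p| ≤ C := by
  obtain ⟨C, hC⟩ := hs.exists_bound_of_continuousOn
    (fun p hp => (hf p hp).continuousAt.continuousWithinAt)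
  exact ⟨max C 0, le_max_right _ _, fun p hp => (hC p hp).trans (le_max_left _ _)⟩

theorem norm_triple_le (a b c : ℝ) : ‖((a, b, c) : ℝ × ℝ × ℝ)‖ ≤ |a| + |b| + |c| := by
  simp only [Prod.norm_def, Real.norm_eq_abs]
  have := abs_nonneg a; have := abs_nonneg b; have := abs_nonneg c
  refine max_le (by linarith) (max_le (by linarith) (by linarith))

theorem norm_quintuple_le (a b c d e : ℝ) :
    ‖(((a, b, c), d, e) : (ℝ × ℝ × ℝ) × ℝ × ℝ)‖ ≤ |a| + |b| + |c| + |d| + |e| := by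
  simp only [Prod.norm_def, Real.norm_eq_abs]
  have := abs_nonneg a; have := abs_nonneg b; have := abs_nonneg c
  have := abs_nonneg d; have := abs_nonneg e
  refine max_le (max_le (by linarith) (max_le (by linarith) (by linarith)))
    (max_le (by linarith) (by linarith))

/-- The range of the parameters of the kernel together with two slopes. -/
def slopeBox : Set ((ℝ × ℝ × ℝ) × ℝ × ℝ) := kerBox ×ˢ Icc (-1) 1 ×ˢ Icc (-1) 1

theorem isCompact_slopeBox : IsCompact slopeBox :=
  isCompact_kerBox.prod (isCompact_Icc.prod isCompact_Icc)

theorem convex_slopeBox : Convex ℝ slopeBox :=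
  convex_kerBox.prod ((convex_Icc _ _).prod (convex_Icc _ _))

theorem contDiffAt_slopeQuot {z : (ℝ × ℝ × ℝ) × ℝ × ℝ} (hz : z ∈ slopeBox) :
    ContDiffAt ℝ 1 slopeQuot z := by
  have h0 : kerDen z.1 ≠ 0 := (kerDen_pos hz.1).ne'
  have h1 : ContDiffAt ℝ 1 (fun z : (ℝ × ℝ × ℝ) × ℝ × ℝ => coefQuad z.1) z :=
    ((contDiffAt_coefQuad h0).of_le (by norm_num)).comp z contDiffAt_fst
  have h2 : ContDiffAt ℝ 1 (fun z : (ℝ × ℝ × ℝ) × ℝ × ℝ => coefLin z.1) z :=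
    ((contDiffAt_coefLin h0).of_le (by norm_num)).comp z contDiffAt_fst
  unfold slopeQuot
  fun_prop

theorem contDiffAt_dissCoef {z : (ℝ × ℝ × ℝ) × ℝ × ℝ} (hz : z ∈ slopeBox) :
    ContDiffAt ℝ 1 dissCoef z := by
  have h0 : kerDen z.1 ≠ 0 := (kerDen_pos hz.1).ne'
  have h (f : ℝ × ℝ × ℝ → ℝ) (v : ℝ × ℝ × ℝ) (hf : ContDiffAt ℝ 5 f z.1) :
      ContDiffAt ℝ 1 (fun z : (ℝ × ℝ × ℝ) × ℝ × ℝ => fderiv ℝ f z.1 v) z :=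
    ContDiffAt.comp (g := fun q => fderiv ℝ f q v) z
      ((contDiffAt_fderiv_apply hf v).of_le (by norm_num)) contDiffAt_fst
  have h1 := h coefQuad dirQuot (contDiffAt_coefQuad h0)
  have h2 := h coefLin dirQuot (contDiffAt_coefLin h0)
  have h3 := h coefConst dirQuot (contDiffAt_coefConst h0)
  have h4 := h coefQuad dirAngle (contDiffAt_coefQuad h0)
  have h5 := h coefLin dirAngle (contDiffAt_coefLin h0)
  have h6 := contDiffAt_slopeQuot hz
  have h7 : ContDiff ℝ 1 (fun z : (ℝ × ℝ × ℝ) × ℝ × ℝ => chord z.1.1) :=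
    (contDiff_chord.of_le (by norm_num)).comp (by fun_prop)
  have h8 : ContDiff ℝ 1 (fun z : (ℝ × ℝ × ℝ) × ℝ × ℝ => halfCos z.1.1) :=
    (contDiff_halfCos.of_le (by norm_num)).comp (by fun_prop)
  have key : ∀ a₁ a₂ a₃ a₄ a₅ : (ℝ × ℝ × ℝ) × ℝ × ℝ → ℝ, ContDiffAt ℝ 1 a₁ z →
      ContDiffAt ℝ 1 a₂ z → ContDiffAt ℝ 1 a₃ z → ContDiffAt ℝ 1 a₄ z → ContDiffAt ℝ 1 a₅ z →
      ContDiffAt ℝ 1 (fun z => -(a₁ z * z.2.1 ^ 2 + a₂ z * z.2.1 + a₃ z)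
        + chord z.1.1 * (a₄ z * (z.2.1 + z.2.2) + a₅ z)
        + (a₁ z * (z.2.1 + z.2.2) + a₂ z) * (z.2.1 - z.1.2.1 * halfCos z.1.1)
        - halfCos z.1.1 * slopeQuot z) z := by
    intros
    have := h7.contDiffAt (x := z)
    have := h8.contDiffAt (x := z)
    fun_prop
  exact key _ _ _ _ _ h1 h2 h3 h4 h5

/-- A line derivative through `fderiv` in terms of a function of one variable. -/
theorem fderiv_apply_eq_of_hasDerivAt {f : ℝ × ℝ × ℝ → ℝ} {p v : ℝ × ℝ × ℝ} {c : ℝ}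
    (hf : DifferentiableAt ℝ f p) (h : HasDerivAt (fun t : ℝ => f (p + t • v)) c 0) :
    fderiv ℝ f p v = c := by
  have h1 : HasFDerivAt f (fderiv ℝ f p) (p + (0 : ℝ) • v) := by simpa using hf.hasFDerivAt
  have h2 : HasDerivAt (fun t : ℝ => p + t • v) v 0 := by
    simpa using ((hasDerivAt_id (0 : ℝ)).smul_const v).const_add p
  exact (h1.comp_hasDerivAt 0 h2).unique h

theorem fderiv_sq_mul_dirQuot {f : ℝ × ℝ × ℝ → ℝ} {p : ℝ × ℝ × ℝ} (hp : p.2.1 = 0)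
    (hf : DifferentiableAt ℝ f p) :
    fderiv ℝ (fun q : ℝ × ℝ × ℝ => q.2.1 ^ 2 * f q) p = 0 := by
  have h1 : HasFDerivAt (fun q : ℝ × ℝ × ℝ => q.2.1)
      ((ContinuousLinearMap.fst ℝ ℝ ℝ).comp (ContinuousLinearMap.snd ℝ ℝ (ℝ × ℝ))) p :=
    ((ContinuousLinearMap.fst ℝ ℝ ℝ).comp (ContinuousLinearMap.snd ℝ ℝ (ℝ × ℝ))).hasFDerivAt
  have h2 : HasFDerivAt (fun q : ℝ × ℝ × ℝ => q.2.1 ^ 2 * f q) _ p :=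
    (h1.pow 2).mul hf.hasFDerivAt
  rw [h2.fderiv]
  simp [hp]

theorem fderiv_sq_mul_dirRad {f : ℝ × ℝ × ℝ → ℝ} {p : ℝ × ℝ × ℝ}
    (hf : DifferentiableAt ℝ f p) :
    fderiv ℝ (fun q : ℝ × ℝ × ℝ => q.2.1 ^ 2 * f q) p dirRad
      = p.2.1 ^ 2 * fderiv ℝ f p dirRad := by
  have h1 : HasFDerivAt (fun q : ℝ × ℝ × ℝ => q.2.1)
      ((ContinuousLinearMap.fst ℝ ℝ ℝ).comp (ContinuousLinearMap.snd ℝ ℝ (ℝ × ℝ))) p :=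
    ((ContinuousLinearMap.fst ℝ ℝ ℝ).comp (ContinuousLinearMap.snd ℝ ℝ (ℝ × ℝ))).hasFDerivAt
  have h2 : HasFDerivAt (fun q : ℝ × ℝ × ℝ => q.2.1 ^ 2 * f q) _ p :=
    (h1.pow 2).mul hf.hasFDerivAt
  rw [h2.fderiv]
  simp [dirRad]

/-- `coefLin` and `coefConst` carry the factor `θ ^ 2`, so they and their derivatives vanish at `θ =
0`; every term with `coefQuad` carries a slope. Together with the Lipschitz bound this makes the
perturbation of the half Laplacian small for small data. -/
theorem dissCoef_eq_zero {p : ℝ × ℝ × ℝ} (hp : p ∈ kerBox) (h : p.2.1 = 0) :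
    dissCoef (p, 0, 0) = 0 := by
  have h0 : kerDen p ≠ 0 := (kerDen_pos hp).ne'
  have h1 : fderiv ℝ coefLin p = 0 :=
    fderiv_sq_mul_dirQuot h ((contDiffAt_coefLinRed h0).differentiableAt (by norm_num))
  have h2 : fderiv ℝ coefConst p = 0 :=
    fderiv_sq_mul_dirQuot h ((contDiffAt_coefConstRed h0).differentiableAt (by norm_num))
  simp [dissCoef, nonlinDir, slopeQuot, h1, h2, h, coefLin]

/-! ### Universal bounds of the coefficients. -/

theorem exists_dissCoef_lipschitz : ∃ C : ℝ, 0 ≤ C ∧ ∀ α t x w m t' x' w' m' : ℝ,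
    ((α, t, x), w, m) ∈ slopeBox → ((α, t', x'), w', m') ∈ slopeBox →
    |dissCoef ((α, t, x), w, m) - dissCoef ((α, t', x'), w', m')|
      ≤ C * (|t - t'| + |x - x'| + |w - w'| + |m - m'|) := by
  obtain ⟨C, hC, h⟩ := exists_lipschitz_of_contDiffAt isCompact_slopeBox convex_slopeBox
    (fun _ hz => contDiffAt_dissCoef hz)
  refine ⟨C, hC, fun α t x w m t' x' w' m' hz hz' => (h _ hz _ hz').trans ?_⟩
  refine mul_le_mul_of_nonneg_left ?_ hC
  simpa using norm_quintuple_le (α - α) (t - t') (x - x') (w - w') (m - m')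

theorem exists_slopeQuot_lipschitz : ∃ C : ℝ, 0 ≤ C ∧ ∀ α t x w m t' x' w' m' : ℝ,
    ((α, t, x), w, m) ∈ slopeBox → ((α, t', x'), w', m') ∈ slopeBox →
    |slopeQuot ((α, t, x), w, m) - slopeQuot ((α, t', x'), w', m')|
      ≤ C * (|t - t'| + |x - x'| + |w - w'| + |m - m'|) := by
  obtain ⟨C, hC, h⟩ := exists_lipschitz_of_contDiffAt isCompact_slopeBox convex_slopeBox
    (fun _ hz => contDiffAt_slopeQuot hz)
  refine ⟨C, hC, fun α t x w m t' x' w' m' hz hz' => (h _ hz _ hz').trans ?_⟩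
  refine mul_le_mul_of_nonneg_left ?_ hC
  simpa using norm_quintuple_le (α - α) (t - t') (x - x') (w - w') (m - m')

theorem exists_slopeQuot_bound : ∃ C : ℝ, 0 ≤ C ∧ ∀ z ∈ slopeBox, |slopeQuot z| ≤ C :=
  exists_bound_of_contDiffAt isCompact_slopeBox fun _ hz => contDiffAt_slopeQuot hz

theorem exists_dissCoef_bound : ∃ C : ℝ, 0 ≤ C ∧ ∀ α t x w m : ℝ,
    ((α, t, x), w, m) ∈ slopeBox →
    |dissCoef ((α, t, x), w, m)| ≤ C * (|t| + |w| + |m|) := by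
  obtain ⟨C, hC, h⟩ := exists_dissCoef_lipschitz
  refine ⟨C, hC, fun α t x w m hz => ?_⟩
  have hz0 : ((α, (0 : ℝ), x), (0 : ℝ), (0 : ℝ)) ∈ slopeBox := by
    refine ⟨⟨hz.1.1, ⟨?_, ?_⟩, hz.1.2.2⟩, ⟨?_, ?_⟩, ⟨?_, ?_⟩⟩ <;> norm_num
  have h1 := h α t x w m 0 x 0 0 hz hz0
  rw [dissCoef_eq_zero hz0.1 rfl] at h1
  simpa using h1

/-- At `α = 0` the kernel has a null structure: it vanishes when the slope is equal to the
difference quotient. -/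
theorem null_structure (t x : ℝ) :
    coefQuad (0, t, x) + t * coefLinRed (0, t, x) + coefConstRed (0, t, x) = 0 := by
  simp only [coefQuad, coefLinRed, coefConstRed, kerDen, farRadius, chord, halfCos]
  simp
  field_simp
  ring

/-- In the equation for the slope this quantity is divided by the chord and is not multiplied by an
increment of the slope, so a mere bound would leave a divergent integral. The null structure,
differentiated in `x`, supplies a factor `α` or a factor `w - t` in each term. -/
theorem exists_nonlinDir_dirRad_bound : ∃ C : ℝ, 0 ≤ C ∧ ∀ α t x w : ℝ,
    (α, t, x) ∈ kerBox → |nonlinDir dirRad (α, t, x) w|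
      ≤ C * (t ^ 2 * |α| + |w - t| * (|w| + |t|) + |w - t| * t ^ 2) := by
  have hne {p} (hp : p ∈ kerBox) : kerDen p ≠ 0 := (kerDen_pos hp).ne'
  obtain ⟨C₁, hC₁, h1⟩ := exists_bound_of_contDiffAt isCompact_kerBox (fun p hp =>
    (contDiffAt_fderiv_apply (contDiffAt_coefQuad (hne hp)) dirRad).of_le (by norm_num))
  obtain ⟨C₂, hC₂, h2⟩ := exists_bound_of_contDiffAt isCompact_kerBox (fun p hp =>
    (contDiffAt_fderiv_apply (contDiffAt_coefLinRed (hne hp)) dirRad).of_le (by norm_num))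
  -- `t ^ 2 * κ` is the radial derivative of `nonlin` at the slope `w = t`.
  let κ : ℝ × ℝ × ℝ → ℝ := fun p => fderiv ℝ coefQuad p dirRad
    + p.2.1 * fderiv ℝ coefLinRed p dirRad + fderiv ℝ coefConstRed p dirRad
  obtain ⟨C₃, hC₃, h3⟩ := exists_lipschitz_of_contDiffAt (f := κ) isCompact_kerBox convex_kerBox
    (fun p hp => by
      have e1 := contDiffAt_fderiv_apply (contDiffAt_coefQuad (hne hp)) dirRad
      have e2 := contDiffAt_fderiv_apply (contDiffAt_coefLinRed (hne hp)) dirRad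
      have e3 := contDiffAt_fderiv_apply (contDiffAt_coefConstRed (hne hp)) dirRad
      exact ContDiffAt.of_le (n := 4) (by fun_prop) (by norm_num))
  have hκ : ∀ t x, (0, t, x) ∈ kerBox → κ (0, t, x) = 0 := by
    intro t x hp
    have hp' := hne hp
    have e1 := (contDiffAt_coefQuad hp').differentiableAt (by norm_num)
    have e2 := (contDiffAt_coefLinRed hp').differentiableAt (by norm_num)
    have e3 := (contDiffAt_coefConstRed hp').differentiableAt (by norm_num)
    -- The factor `t` may be frozen, because the direction `dirRad` changes only `x`.
    have key : HasFDerivAt (fun p : ℝ × ℝ × ℝ => coefQuad p + t * coefLinRed p + coefConstRed p)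
        (fderiv ℝ coefQuad (0, t, x) + t • fderiv ℝ coefLinRed (0, t, x)
          + fderiv ℝ coefConstRed (0, t, x)) (0, t, x) :=
      (e1.hasFDerivAt.add (e2.hasFDerivAt.const_mul t)).add e3.hasFDerivAt
    have h0 : HasDerivAt (fun r : ℝ => (fun p : ℝ × ℝ × ℝ =>
        coefQuad p + t * coefLinRed p + coefConstRed p) ((0, t, x) + r • dirRad)) 0 0 := by
      refine (hasDerivAt_const (0 : ℝ) (0 : ℝ)).congr_of_eventuallyEq (.of_forall fun r => ?_)
      simpa [dirRad] using null_structure t (x + r)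
    have := fderiv_apply_eq_of_hasDerivAt key.differentiableAt h0
    rw [key.fderiv] at this
    simpa [κ] using this
  refine ⟨C₁ + C₂ + C₃, by positivity, fun α t x w hp => ?_⟩
  have hp0 : ((0 : ℝ), t, x) ∈ kerBox :=
    ⟨⟨by simp [Real.pi_pos.le], Real.pi_pos.le⟩, hp.2⟩
  have e2 : fderiv ℝ coefLin (α, t, x) dirRad = t ^ 2 * fderiv ℝ coefLinRed (α, t, x) dirRad :=
    fderiv_sq_mul_dirRad ((contDiffAt_coefLinRed (hne hp)).differentiableAt (by norm_num))
  have e3 : fderiv ℝ coefConst (α, t, x) dirRad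
      = t ^ 2 * fderiv ℝ coefConstRed (α, t, x) dirRad :=
    fderiv_sq_mul_dirRad ((contDiffAt_coefConstRed (hne hp)).differentiableAt (by norm_num))
  have e4 : nonlinDir dirRad (α, t, x) w = t ^ 2 * κ (α, t, x)
      + (w - t) * (w + t) * fderiv ℝ coefQuad (α, t, x) dirRad
      + (w - t) * t ^ 2 * fderiv ℝ coefLinRed (α, t, x) dirRad := by
    simp only [nonlinDir, e2, e3, κ]; ring
  have b3 : |κ (α, t, x)| ≤ C₃ * |α| := by
    have := h3 _ hp _ hp0
    rw [hκ t x hp0, sub_zero] at this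
    refine this.trans (mul_le_mul_of_nonneg_left ?_ hC₃)
    simp [Prod.norm_def]
  have a1 : |t ^ 2 * κ (α, t, x)| ≤ C₃ * (t ^ 2 * |α|) := by
    rw [abs_mul, abs_of_nonneg (sq_nonneg t)]
    nlinarith [sq_nonneg t]
  have a2 : |(w - t) * (w + t) * fderiv ℝ coefQuad (α, t, x) dirRad|
      ≤ C₁ * (|w - t| * (|w| + |t|)) := by
    rw [abs_mul, abs_mul, mul_comm]
    exact mul_le_mul (h1 _ hp) (mul_le_mul_of_nonneg_left (abs_add_le _ _) (abs_nonneg _))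
      (by positivity) hC₁
  have a3 : |(w - t) * t ^ 2 * fderiv ℝ coefLinRed (α, t, x) dirRad|
      ≤ C₂ * (|w - t| * t ^ 2) := by
    rw [abs_mul, abs_mul, abs_of_nonneg (sq_nonneg t), mul_comm]
    exact mul_le_mul_of_nonneg_right (h2 _ hp) (by positivity)
  rw [e4]
  have p1 : 0 ≤ t ^ 2 * |α| := by positivity
  have p2 : 0 ≤ |w - t| * (|w| + |t|) := by positivity
  have p3 : 0 ≤ |w - t| * t ^ 2 := by positivity
  refine (abs_add_three _ _ _).trans ((add_le_add (add_le_add a1 a2) a3).trans ?_)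
  nlinarith [mul_nonneg hC₁ p1, mul_nonneg hC₂ p1, mul_nonneg hC₁ p3, mul_nonneg hC₂ p2,
    mul_nonneg hC₃ p2, mul_nonneg hC₃ p3]

/-- `coefQuad` vanishes at `α = θ = 0` and the other coefficients carry `θ ^ 2`. The only term
without `θ` has a factor `|α|`, which compensates the division by the chord. -/
theorem exists_nonlin_bound : ∃ C : ℝ, 0 ≤ C ∧ ∀ α t x w : ℝ, (α, t, x) ∈ kerBox → |w| ≤ 1 →
    |nonlin (α, t, x) w| ≤ C * (|α| * w ^ 2 + |t| * w ^ 2 + t ^ 2) := by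
  have hne {p} (hp : p ∈ kerBox) : kerDen p ≠ 0 := (kerDen_pos hp).ne'
  obtain ⟨C₁, hC₁, h1⟩ := exists_lipschitz_of_contDiffAt isCompact_kerBox convex_kerBox
    (fun p hp => (contDiffAt_coefQuad (hne hp)).of_le (by norm_num))
  obtain ⟨C₂, hC₂, h2⟩ := exists_bound_of_contDiffAt isCompact_kerBox (fun p hp =>
    (contDiffAt_coefLinRed (hne hp)).of_le (by norm_num))
  obtain ⟨C₃, hC₃, h3⟩ := exists_bound_of_contDiffAt isCompact_kerBox (fun p hp =>
    (contDiffAt_coefConstRed (hne hp)).of_le (by norm_num))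
  refine ⟨C₁ + C₂ + C₃, by positivity, fun α t x w hp hw => ?_⟩
  have hp0 : ((0 : ℝ), (0 : ℝ), x) ∈ kerBox :=
    ⟨⟨by simp [Real.pi_pos.le], Real.pi_pos.le⟩, ⟨by norm_num, by norm_num⟩, hp.2.2⟩
  have b1 : |coefQuad (α, t, x)| ≤ C₁ * (|α| + |t|) := by
    have := h1 _ hp _ hp0
    rw [show coefQuad ((0 : ℝ), (0 : ℝ), x) = 0 by simp [coefQuad, chord], sub_zero] at this
    refine this.trans (mul_le_mul_of_nonneg_left ?_ hC₁)
    simp [Prod.norm_def]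
  have a1 : |coefQuad (α, t, x) * w ^ 2| ≤ C₁ * (|α| * w ^ 2 + |t| * w ^ 2) := by
    rw [abs_mul, abs_of_nonneg (sq_nonneg w)]
    nlinarith [sq_nonneg w]
  have a2 : |coefLin (α, t, x) * w| ≤ C₂ * t ^ 2 := by
    rw [coefLin, abs_mul, abs_mul, abs_of_nonneg (sq_nonneg _)]
    have : |coefLinRed (α, t, x)| * |w| ≤ C₂ * 1 := mul_le_mul (h2 _ hp) hw (abs_nonneg _) hC₂
    have ht := sq_nonneg t
    calc t ^ 2 * |coefLinRed (α, t, x)| * |w| = t ^ 2 * (|coefLinRed (α, t, x)| * |w|) := by ring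
      _ ≤ t ^ 2 * (C₂ * 1) := mul_le_mul_of_nonneg_left this ht
      _ = C₂ * t ^ 2 := by ring
  have a3 : |coefConst (α, t, x)| ≤ C₃ * t ^ 2 := by
    rw [coefConst, abs_mul, abs_of_nonneg (sq_nonneg _), mul_comm]
    exact mul_le_mul_of_nonneg_right (h3 _ hp) (sq_nonneg t)
  unfold nonlin
  have p1 : 0 ≤ |α| * w ^ 2 + |t| * w ^ 2 := by positivity
  have p2 : 0 ≤ t ^ 2 := by positivity
  refine (abs_add_three _ _ _).trans ((add_le_add (add_le_add a1 a2) a3).trans ?_)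
  nlinarith [mul_nonneg hC₁ p2, mul_nonneg hC₂ p1, mul_nonneg hC₃ p1]

/-! ### The equation as a principal value -/

theorem chord_sq_div_four (α : ℝ) : halfCos α ^ 2 = 1 - chord α ^ 2 / 4 := by
  have := Real.sin_sq_add_cos_sq (α / 2)
  rw [chord, halfCos]; linarith

theorem sin_eq_chord_mul (α : ℝ) : Real.sin α = chord α * halfCos α := by
  rw [chord, halfCos, show α = 2 * (α / 2) by ring, Real.sin_two_mul]; ring_nf

theorem cos_eq_chord (α : ℝ) : Real.cos α = 1 - chord α ^ 2 / 2 := by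
  have := Real.sin_sq_add_cos_sq (α / 2)
  have h := Real.cos_two_mul (α / 2)
  rw [show 2 * (α / 2) = α by ring] at h
  rw [chord]; linarith

theorem chord_neg (α : ℝ) : chord (-α) = -chord α := by
  rw [chord, chord, neg_div, Real.sin_neg]; ring

theorem abs_chord_le (α : ℝ) : |chord α| ≤ |α| := by
  have h : |Real.sin (α / 2)| ≤ |α / 2| := Real.abs_sin_le_abs
  rw [abs_div, abs_two] at h
  rw [chord, abs_mul, abs_two]; linarith

/-- Jordan's inequality `sin x ≥ 2 x / π`, with `π ≤ 4`. -/
theorem le_abs_chord {α : ℝ} (h : |α| ≤ Real.pi) : |α| ≤ 2 * |chord α| := by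
  have key : ∀ β : ℝ, 0 ≤ β → β ≤ Real.pi → β ≤ 2 * |chord β| := by
    intro β h0 h1
    have h2 := Real.mul_le_sin (x := β / 2) (by linarith) (by linarith)
    have h3 : β / 4 ≤ 2 / Real.pi * (β / 2) := by
      rw [div_mul_div_comm, div_le_div_iff₀ (by norm_num) (by positivity)]
      nlinarith [Real.pi_le_four]
    have h4 : β ≤ 2 * chord β := by rw [chord]; linarith
    exact h4.trans (mul_le_mul_of_nonneg_left (le_abs_self _) zero_le_two)
  rcases le_total 0 α with h0 | h0
  · rw [abs_of_nonneg h0] at h ⊢; exact key α h0 h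
  · rw [abs_of_nonpos h0] at h ⊢
    have := key (-α) (by linarith) h
    rwa [chord_neg, abs_neg] at this

theorem chord_ne_zero {α : ℝ} (h : |α| ≤ Real.pi) (h0 : α ≠ 0) : chord α ≠ 0 := by
  intro h1
  have := le_abs_chord h
  rw [h1, abs_zero, mul_zero] at this
  exact h0 (abs_eq_zero.1 (le_antisymm this (abs_nonneg _)))

/-- The difference quotient of `f` with respect to the chord of the unit circle. -/
def diffQuot (f : ℝ → ℝ) (s α : ℝ) : ℝ := (f s - f (s - α)) / chord α

/-- The parameters of the kernel. -/
def kerParam (f : ℝ → ℝ) (s α : ℝ) : ℝ × ℝ × ℝ := (α, diffQuot f s α, 1 + f s)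

/-- The principal value kernel of the equation. -/
def pvKernel (f : ℝ → ℝ) (s α : ℝ) : ℝ :=
  (-diffQuot f s α + nonlin (kerParam f s α) (deriv f (s - α))) / chord α

/-- A small `C²` function on the circle with a bound on the second derivative. -/
structure IsSmall (c K : ℝ) (f : ℝ → ℝ) : Prop where
  periodic : Function.Periodic f (2 * Real.pi)
  contDiff : ContDiff ℝ 2 f
  abs_apply_le : ∀ s, |f s| ≤ c
  abs_deriv_le : ∀ s, |deriv f s| ≤ c
  abs_deriv2_le : ∀ s, |deriv (deriv f) s| ≤ K

/-! ### Elementary estimates for small functions. -/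

namespace IsSmall

variable {c K : ℝ} {f : ℝ → ℝ}

theorem nonneg (hf : IsSmall c K f) : 0 ≤ c := (abs_nonneg _).trans (hf.abs_apply_le 0)

theorem nonneg' (hf : IsSmall c K f) : 0 ≤ K := (abs_nonneg _).trans (hf.abs_deriv2_le 0)

theorem hasDerivAt (hf : IsSmall c K f) (s : ℝ) : HasDerivAt f (deriv f s) s :=
  (hf.contDiff.differentiable (by norm_num) s).hasDerivAt

theorem contDiff_deriv (hf : IsSmall c K f) : ContDiff ℝ 1 (deriv f) :=
  hf.contDiff.iterate_deriv' 1 1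

theorem hasDerivAt_deriv (hf : IsSmall c K f) (s : ℝ) :
    HasDerivAt (deriv f) (deriv (deriv f) s) s :=
  (hf.contDiff_deriv.differentiable (by norm_num) s).hasDerivAt

theorem continuous (hf : IsSmall c K f) : Continuous f := hf.contDiff.continuous

theorem continuous_deriv (hf : IsSmall c K f) : Continuous (deriv f) :=
  hf.contDiff_deriv.continuous

theorem continuous_deriv2 (hf : IsSmall c K f) : Continuous (deriv (deriv f)) :=
  hf.contDiff_deriv.continuous_deriv (by norm_num)

theorem periodic_deriv (hf : IsSmall c K f) : Function.Periodic (deriv f) (2 * Real.pi) := by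
  intro s
  have : (fun t => f (t + 2 * Real.pi)) = f := funext hf.periodic
  rw [← deriv_comp_add_const, this]

theorem abs_sub_le (hf : IsSmall c K f) (a b : ℝ) : |f a - f b| ≤ c * |a - b| := by
  have := Convex.norm_image_sub_le_of_norm_hasDerivWithin_le (f := f) (f' := deriv f)
    (s := univ) (C := c) (x := b) (y := a) (fun x _ => (hf.hasDerivAt x).hasDerivWithinAt)
    (fun x _ => hf.abs_deriv_le x) convex_univ (mem_univ _) (mem_univ _)
  simpa using this

theorem abs_deriv_sub_le (hf : IsSmall c K f) (a b : ℝ) :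
    |deriv f a - deriv f b| ≤ K * |a - b| := by
  have := Convex.norm_image_sub_le_of_norm_hasDerivWithin_le (f := deriv f)
    (f' := deriv (deriv f)) (s := univ) (C := K) (x := b) (y := a)
    (fun x _ => (hf.hasDerivAt_deriv x).hasDerivWithinAt)
    (fun x _ => hf.abs_deriv2_le x) convex_univ (mem_univ _) (mem_univ _)
  simpa using this

theorem abs_diffQuot_le (hf : IsSmall c K f) {α : ℝ} (h : |α| ≤ Real.pi) (s : ℝ) :
    |diffQuot f s α| ≤ 2 * c := by
  rw [diffQuot, abs_div]
  have h1 := hf.abs_sub_le s (s - α)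
  rw [sub_sub_cancel] at h1
  have h2 := le_abs_chord h
  have h3 := hf.nonneg
  refine div_le_of_le_mul₀ (abs_nonneg _) (by positivity) (h1.trans ?_)
  nlinarith

/-- The threshold `1 / 8` comes from here: the difference quotient is at most `2 * c`, which must
not exceed `1 / 4`. -/
theorem kerParam_mem (hf : IsSmall c K f) (hc : c ≤ 1 / 8) {α : ℝ} (h : |α| ≤ Real.pi) (s : ℝ) :
    kerParam f s α ∈ kerBox := by
  have h1 := abs_le.1 (hf.abs_diffQuot_le h s)
  have h2 := abs_le.1 (hf.abs_apply_le s)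
  have h3 := abs_le.1 h
  exact ⟨h3, ⟨by simp only [kerParam]; linarith, by simp only [kerParam]; linarith⟩,
    ⟨by simp only [kerParam]; linarith, by simp only [kerParam]; linarith⟩⟩

end IsSmall

/-! ### The algebraic form of the kernel. -/

theorem farRadius_kerParam (f : ℝ → ℝ) (s : ℝ) {α : ℝ} (h : chord α ≠ 0) :
    farRadius (kerParam f s α) = 1 + f (s - α) := by
  simp only [farRadius, kerParam, diffQuot]
  field_simp
  ring

theorem chordSq_eq (f : ℝ → ℝ) (s : ℝ) {α : ℝ} (h : chord α ≠ 0) :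
    chordSq f s α = chord α ^ 2 * kerDen (kerParam f s α) := by
  rw [kerDen, farRadius_kerParam f s h, chordSq, cos_eq_chord]
  simp only [kerParam, diffQuot]
  field_simp
  ring

/-- The left side is what remains of `fullIntegrand` after the derivative of `primitive` is
subtracted; neither a logarithm nor `f''` is left. In half-angle form the identity is rational in
the chord, `θ`, the radius, the slope and `halfCos`. -/
theorem kernel_algebra (f : ℝ → ℝ) (s w : ℝ) {α : ℝ} (h : chord α ≠ 0)
    (hB : kerDen (kerParam f s α) ≠ 0) :
    (1 + f s - (1 + f (s - α)) * Real.cos α) * (w ^ 2 + (1 + f (s - α)) ^ 2) / chordSq f s α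
      - 2 * (1 + f s - (1 + f (s - α)) * Real.cos α)
        * ((1 + f s) * (1 + f (s - α)) * Real.sin α
          + w * ((1 + f s) * Real.cos α - (1 + f (s - α)))) ^ 2 / chordSq f s α ^ 2
      + Real.cos α * (1 + f (s - α)) / 2 - Real.sin α * w
    = (-diffQuot f s α + nonlin (kerParam f s α) w) / chord α := by
  have hy := farRadius_kerParam f s h
  rw [chordSq_eq f s h, cos_eq_chord, sin_eq_chord_mul, ← hy]
  have hC := chord_sq_div_four α
  have hx : 1 + f s = (kerParam f s α).2.2 := rfl
  have ht : diffQuot f s α = (kerParam f s α).2.1 := rfl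
  have ha : chord α = chord (kerParam f s α).1 := rfl
  have ha' : halfCos α = halfCos (kerParam f s α).1 := rfl
  rw [hx, ht]
  rw [ha] at h ⊢
  rw [ha, ha'] at hC
  rw [ha']
  generalize kerParam f s α = p at *
  simp only [nonlin, coefQuad, coefLin, coefConst, coefLinRed, coefConstRed]
  have hB' : kerDen p = p.2.1 ^ 2 + p.2.2 * (p.2.2 - chord p.1 * p.2.1) := rfl
  have hF : farRadius p = p.2.2 - chord p.1 * p.2.1 := rfl
  rw [hF]
  generalize hSS : chord p.1 = S at *
  generalize halfCos p.1 = C at *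
  generalize hXX : p.2.2 = x at *
  generalize hTT : p.2.1 = t at *
  generalize kerDen p = B at *
  -- The cosine of the half angle enters quadratically only through this square. Once `C ^ 2 = 1 - S
  -- ^ 2 / 4` is used here, the identity holds with `C` as a free variable.
  have hT : ∀ a b : ℝ, (a * (S * C) + b) ^ 2
      = a ^ 2 * S ^ 2 * (1 - S ^ 2 / 4) + 2 * a * S * C * b + b ^ 2 := by
    intro a b
    linear_combination a ^ 2 * S ^ 2 * hC
  rw [hT]
  field_simp
  rw [hB']
  ring

/-- The right hand side of the equation. -/
def rhs (f : ℝ → ℝ) (s : ℝ) : ℝ := J₁ f s + J₂ f s + J₃ f s - centerTerm f s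

/-- The sum of the integrands in the equation. -/
def fullIntegrand (f : ℝ → ℝ) (s α : ℝ) : ℝ :=
  -(1 / 2) * (Real.log (chordSq f s α) *
      iteratedDeriv 2 (fun β : ℝ => Real.cos β * (1 + f (s - β))) α)
    + ((1 + f s - (1 + f (s - α)) * Real.cos α) * ((1 + f s) * Real.cos α - (1 + f (s - α))))
      / chordSq f s α * (iteratedDeriv 2 f (s - α) - 1 - f (s - α))
    + 2 * (1 + f s) * (((1 + f s - (1 + f (s - α)) * Real.cos α) * Real.sin α)
      / chordSq f s α * deriv f (s - α))
    - 1 / 2 * (f (s - α) * Real.cos α)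

theorem farRadius_bounds {p : ℝ × ℝ × ℝ} (hp : p ∈ kerBox) :
    1 / 4 ≤ farRadius p ∧ farRadius p ≤ 7 / 4 := by
  obtain ⟨-, ⟨h1, h2⟩, ⟨h3, h4⟩⟩ := hp
  have h5 : |chord p.1 * p.2.1| ≤ 2 * (1 / 4) := by
    rw [abs_mul]
    exact mul_le_mul (abs_chord_le_two _) (abs_le.2 ⟨h1, h2⟩) (abs_nonneg _) (by norm_num)
  have h6 := abs_le.1 h5
  unfold farRadius
  constructor <;> linarith

theorem kerDen_bounds {p : ℝ × ℝ × ℝ} (hp : p ∈ kerBox) : 3 / 16 ≤ kerDen p ∧ kerDen p ≤ 3 := by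
  obtain ⟨a1, a2⟩ := farRadius_bounds hp
  obtain ⟨-, ⟨h1, h2⟩, ⟨h3, h4⟩⟩ := hp
  unfold kerDen
  constructor <;> nlinarith

theorem abs_log_kerDen_le {p : ℝ × ℝ × ℝ} (hp : p ∈ kerBox) : |Real.log (kerDen p)| ≤ 5 := by
  obtain ⟨a1, a2⟩ := kerDen_bounds hp
  have h0 : 0 < kerDen p := by linarith
  rw [abs_le]
  constructor
  · have := Real.one_sub_inv_le_log_of_pos h0
    have h : (kerDen p)⁻¹ ≤ (3 / 16)⁻¹ := inv_anti₀ (by norm_num) a1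
    norm_num at h
    linarith
  · have := Real.log_le_sub_one_of_pos h0
    linarith

/-! ### Logarithmic bounds of the integrands. -/

section bounds

variable {c K : ℝ} {f : ℝ → ℝ} {α : ℝ}

theorem IsSmall.abs_log_chordSq_le (hf : IsSmall c K f) (hc : c ≤ 1 / 8) (h : |α| ≤ Real.pi)
    (h0 : α ≠ 0) (s : ℝ) : |Real.log (chordSq f s α)| ≤ 2 * |Real.log α| + 7 := by
  have hS := chord_ne_zero h h0
  have hp := hf.kerParam_mem hc h s
  have hB := kerDen_pos hp
  rw [chordSq_eq f s hS, Real.log_mul (by positivity) hB.ne', Real.log_pow]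
  have h1 := abs_log_kerDen_le hp
  have ha : 0 < |α| := abs_pos.2 h0
  have hSa : 0 < |chord α| := abs_pos.2 hS
  have h2 : Real.log |chord α| ≤ Real.log |α| := Real.log_le_log hSa (abs_chord_le α)
  have h3 : Real.log |α| ≤ Real.log 2 + Real.log |chord α| := by
    rw [← Real.log_mul two_ne_zero hSa.ne']
    exact Real.log_le_log ha (le_abs_chord h)
  have h4 : Real.log 2 ≤ 1 := by have := Real.log_le_sub_one_of_pos two_pos; linarith
  rw [Real.log_abs] at h2 h3
  rw [Real.log_abs] at h2 h3
  have h5 := abs_le.1 (le_refl |Real.log α|)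
  have h6 := abs_le.1 h1
  push_cast
  rw [abs_le]
  constructor <;> linarith

theorem IsSmall.far_eq (s : ℝ) (h : chord α ≠ 0) :
    1 + f s - (1 + f (s - α)) * Real.cos α
      = chord α * (diffQuot f s α + farRadius (kerParam f s α) * chord α / 2) ∧
    (1 + f s) * Real.cos α - (1 + f (s - α))
      = chord α * (diffQuot f s α - (1 + f s) * chord α / 2) := by
  rw [farRadius_kerParam f s h, cos_eq_chord, diffQuot]
  constructor <;> · field_simp; ring

theorem IsSmall.abs_normal_le (hf : IsSmall c K f) (hc : c ≤ 1 / 8) (h : |α| ≤ Real.pi)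
    (h0 : α ≠ 0) (s : ℝ) :
    |1 + f s - (1 + f (s - α)) * Real.cos α| ≤ 2 * |chord α| ∧
    |(1 + f s) * Real.cos α - (1 + f (s - α))| ≤ 2 * |chord α| := by
  have hS := chord_ne_zero h h0
  obtain ⟨e1, e2⟩ := IsSmall.far_eq (f := f) s hS
  have hp := hf.kerParam_mem hc h s
  obtain ⟨b1, b2⟩ := farRadius_bounds hp
  have h1 := hf.abs_diffQuot_le h s
  have h2 := abs_chord_le_two α
  have h3 := abs_le.1 (hf.abs_apply_le s)
  rw [e1, e2, abs_mul, abs_mul, mul_comm 2]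
  constructor
  · refine mul_le_mul_of_nonneg_left ?_ (abs_nonneg _)
    refine (abs_add_le _ _).trans ?_
    rw [abs_div, abs_mul, abs_two, abs_of_nonneg (show 0 ≤ farRadius (kerParam f s α) by linarith)]
    nlinarith [abs_nonneg (chord α)]
  · refine mul_le_mul_of_nonneg_left ?_ (abs_nonneg _)
    refine (abs_sub _ _).trans ?_
    rw [abs_div, abs_mul, abs_two, abs_of_nonneg (show 0 ≤ 1 + f s by linarith)]
    nlinarith [abs_nonneg (chord α)]

theorem IsSmall.chordSq_lower (hf : IsSmall c K f) (hc : c ≤ 1 / 8) (h : |α| ≤ Real.pi)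
    (h0 : α ≠ 0) (s : ℝ) : 3 / 16 * |chord α| ^ 2 ≤ chordSq f s α := by
  rw [chordSq_eq f s (chord_ne_zero h h0), sq_abs]
  have := (kerDen_bounds (hf.kerParam_mem hc h s)).1
  nlinarith [sq_nonneg (chord α)]

theorem IsSmall.chordSq_pos (hf : IsSmall c K f) (hc : c ≤ 1 / 8) (h : |α| ≤ Real.pi)
    (h0 : α ≠ 0) (s : ℝ) : 0 < chordSq f s α := by
  have := abs_pos.2 (chord_ne_zero h h0)
  exact lt_of_lt_of_le (by positivity) (hf.chordSq_lower hc h h0 s)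

theorem iteratedDeriv_two_eq (f : ℝ → ℝ) (s : ℝ) :
    iteratedDeriv 2 f s = deriv (deriv f) s := by
  rw [iteratedDeriv_succ, iteratedDeriv_one]

theorem IsSmall.hasDerivAt_far (hf : IsSmall c K f) (s α : ℝ) :
    HasDerivAt (fun β => f (s - β)) (-deriv f (s - α)) α :=
  (hf.hasDerivAt (s - α)).comp_const_sub s α

theorem IsSmall.hasDerivAt_deriv_far (hf : IsSmall c K f) (s α : ℝ) :
    HasDerivAt (fun β => deriv f (s - β)) (-deriv (deriv f) (s - α)) α :=
  (hf.hasDerivAt_deriv (s - α)).comp_const_sub s α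

theorem IsSmall.iteratedDeriv_cos_mul (hf : IsSmall c K f) (s α : ℝ) :
    iteratedDeriv 2 (fun β : ℝ => Real.cos β * (1 + f (s - β))) α
      = -Real.cos α * (1 + f (s - α)) + 2 * Real.sin α * deriv f (s - α)
        + Real.cos α * deriv (deriv f) (s - α) := by
  have h1 : deriv (fun β : ℝ => Real.cos β * (1 + f (s - β)))
      = fun β => -Real.sin β * (1 + f (s - β)) + Real.cos β * -deriv f (s - β) :=
    funext fun β => ((Real.hasDerivAt_cos β).mul ((hf.hasDerivAt_far s β).const_add 1)).deriv
  rw [iteratedDeriv_succ, iteratedDeriv_one, h1]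
  have h2 := (((Real.hasDerivAt_sin α).neg.mul ((hf.hasDerivAt_far s α).const_add 1)).add
    ((Real.hasDerivAt_cos α).mul (hf.hasDerivAt_deriv_far s α).neg)).deriv
  refine Eq.trans h2 ?_
  simp only [Pi.neg_apply]
  ring

theorem IsSmall.abs_iteratedDeriv_cos_mul_le (hf : IsSmall c K f) (hc : c ≤ 1 / 8) (s α : ℝ) :
    |iteratedDeriv 2 (fun β : ℝ => Real.cos β * (1 + f (s - β))) α| ≤ K + 2 := by
  rw [hf.iteratedDeriv_cos_mul]
  have h1 := Real.abs_cos_le_one α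
  have h2 := Real.abs_sin_le_one α
  have h3 := hf.abs_apply_le (s - α)
  have h4 := hf.abs_deriv_le (s - α)
  have h5 := hf.abs_deriv2_le (s - α)
  have e1 : |-Real.cos α * (1 + f (s - α))| ≤ 1 * (1 + 1 / 8) := by
    rw [abs_mul, abs_neg]
    refine mul_le_mul h1 ((abs_add_le _ _).trans ?_) (abs_nonneg _) zero_le_one
    rw [abs_one]; linarith
  have e2 : |2 * Real.sin α * deriv f (s - α)| ≤ 2 * 1 * (1 / 8) := by
    rw [abs_mul, abs_mul, abs_two]
    exact mul_le_mul (by linarith) (by linarith) (abs_nonneg _) (by norm_num)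
  have e3 : |Real.cos α * deriv (deriv f) (s - α)| ≤ 1 * K := by
    rw [abs_mul]
    exact mul_le_mul h1 h5 (abs_nonneg _) zero_le_one
  refine (abs_add_three _ _ _).trans ?_
  linarith

/-- A bound of a function that is allowed to have a logarithmic singularity at `0`. -/
theorem intervalIntegrable_of_log_bound {φ : ℝ → ℝ} {a b C : ℝ} (hφ : Measurable φ)
    (ha : |a| ≤ Real.pi) (hb : |b| ≤ Real.pi)
    (h : ∀ α, |α| ≤ Real.pi → α ≠ 0 → |φ α| ≤ C * (1 + |Real.log α|)) :
    IntervalIntegrable φ volume a b := by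
  have h1 : IntervalIntegrable (fun α => C * (1 + |Real.log α|)) volume a b :=
    (intervalIntegrable_const.add intervalIntegral.intervalIntegrable_log'.abs).const_mul C
  refine h1.mono_fun hφ.aestronglyMeasurable ?_
  have h0 : ∀ᵐ α : ℝ ∂(volume.restrict (uIoc a b)), α ≠ 0 :=
    ae_restrict_of_ae (by simp [ae_iff])
  filter_upwards [h0, ae_restrict_mem measurableSet_uIoc] with α hα hm
  have hm' : |α| ≤ Real.pi := by
    have h2 := uIoc_subset_uIcc hm
    rw [abs_le] at *
    rcases mem_uIcc.1 h2 with h3 | h3 <;> constructor <;> linarith [h3.1, h3.2]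
  exact (h α hm' hα).trans (le_abs_self _)

theorem continuous_chordSq (hf : IsSmall c K f) (s : ℝ) : Continuous (chordSq f s) := by
  have := hf.continuous
  unfold chordSq
  fun_prop

theorem IsSmall.bound_log_term (hf : IsSmall c K f) (hc : c ≤ 1 / 8) (h : |α| ≤ Real.pi)
    (h0 : α ≠ 0) (s : ℝ) :
    |Real.log (chordSq f s α) * iteratedDeriv 2 (fun β : ℝ => Real.cos β * (1 + f (s - β))) α|
      ≤ 14 * (K + 2) * (1 + |Real.log α|) := by
  rw [abs_mul]
  have h1 := hf.abs_log_chordSq_le hc h h0 s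
  have h2 := hf.abs_iteratedDeriv_cos_mul_le hc s α
  have h3 := hf.nonneg'
  have h4 := abs_nonneg (Real.log α)
  refine (mul_le_mul h1 h2 (abs_nonneg _) (by positivity)).trans ?_
  nlinarith [mul_nonneg h3 h4]

theorem IsSmall.bound_normal_term (hf : IsSmall c K f) (hc : c ≤ 1 / 8) (h : |α| ≤ Real.pi)
    (h0 : α ≠ 0) (s : ℝ) :
    |((1 + f s - (1 + f (s - α)) * Real.cos α) * ((1 + f s) * Real.cos α - (1 + f (s - α))))
      / chordSq f s α * (iteratedDeriv 2 f (s - α) - 1 - f (s - α))|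
      ≤ 22 * (K + 2) * (1 + |Real.log α|) := by
  have hD := hf.chordSq_pos hc h h0 s
  obtain ⟨h1, h2⟩ := hf.abs_normal_le hc h h0 s
  have h3 := hf.chordSq_lower hc h h0 s
  have hK := hf.nonneg'
  have e1 : |((1 + f s - (1 + f (s - α)) * Real.cos α)
      * ((1 + f s) * Real.cos α - (1 + f (s - α)))) / chordSq f s α| ≤ 22 := by
    rw [abs_div, abs_mul, abs_of_pos hD, div_le_iff₀ hD]
    refine (mul_le_mul h1 h2 (abs_nonneg _) (by positivity)).trans ?_
    nlinarith [sq_nonneg |chord α|]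
  have e2 : |iteratedDeriv 2 f (s - α) - 1 - f (s - α)| ≤ K + 2 := by
    rw [iteratedDeriv_two_eq]
    have h4 := abs_le.1 (hf.abs_deriv2_le (s - α))
    have h5 := abs_le.1 (hf.abs_apply_le (s - α))
    rw [abs_le]; constructor <;> linarith
  rw [abs_mul]
  refine (mul_le_mul e1 e2 (abs_nonneg _) (by norm_num)).trans ?_
  have := abs_nonneg (Real.log α)
  nlinarith

theorem IsSmall.bound_tangent_term (hf : IsSmall c K f) (hc : c ≤ 1 / 8) (h : |α| ≤ Real.pi)
    (h0 : α ≠ 0) (s : ℝ) :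
    |((1 + f s - (1 + f (s - α)) * Real.cos α) * Real.sin α) / chordSq f s α * deriv f (s - α)|
      ≤ 2 * (1 + |Real.log α|) := by
  have hD := hf.chordSq_pos hc h h0 s
  obtain ⟨h1, -⟩ := hf.abs_normal_le hc h h0 s
  have h3 := hf.chordSq_lower hc h h0 s
  have hs : |Real.sin α| ≤ |chord α| := by
    rw [sin_eq_chord_mul, abs_mul]
    exact mul_le_of_le_one_right (abs_nonneg _) (Real.abs_cos_le_one _)
  have e1 : |((1 + f s - (1 + f (s - α)) * Real.cos α) * Real.sin α) / chordSq f s α| ≤ 11 := by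
    rw [abs_div, abs_mul, abs_of_pos hD, div_le_iff₀ hD]
    refine (mul_le_mul h1 hs (abs_nonneg _) (by positivity)).trans ?_
    nlinarith [sq_nonneg |chord α|]
  rw [abs_mul]
  refine (mul_le_mul e1 ((hf.abs_deriv_le _).trans hc) (abs_nonneg _) (by norm_num)).trans ?_
  have := abs_nonneg (Real.log α)
  nlinarith

end bounds

/-! ### Integrability and the integration by parts in the angle. -/

section integral

variable {c K : ℝ} {f : ℝ → ℝ}

theorem IsSmall.continuous_iteratedDeriv_cos_mul (hf : IsSmall c K f) (s : ℝ) :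
    Continuous (iteratedDeriv 2 (fun β : ℝ => Real.cos β * (1 + f (s - β)))) := by
  have h1 := hf.continuous
  have h2 := hf.continuous_deriv
  have h3 := hf.continuous_deriv2
  refine Continuous.congr ?_ fun α => (hf.iteratedDeriv_cos_mul s α).symm
  fun_prop

theorem IsSmall.continuous_iteratedDeriv_two (hf : IsSmall c K f) :
    Continuous (iteratedDeriv 2 f) :=
  hf.continuous_deriv2.congr fun s => (iteratedDeriv_two_eq f s).symm

theorem IsSmall.integrable_log_term (hf : IsSmall c K f) (hc : c ≤ 1 / 8) (s : ℝ) {a b : ℝ}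
    (ha : |a| ≤ Real.pi) (hb : |b| ≤ Real.pi) :
    IntervalIntegrable (fun α => Real.log (chordSq f s α) *
      iteratedDeriv 2 (fun β : ℝ => Real.cos β * (1 + f (s - β))) α) volume a b :=
  intervalIntegrable_of_log_bound
    ((Real.measurable_log.comp (continuous_chordSq hf s).measurable).mul
      (hf.continuous_iteratedDeriv_cos_mul s).measurable) ha hb
    fun _ h h0 => hf.bound_log_term hc h h0 s

theorem IsSmall.integrable_normal_term (hf : IsSmall c K f) (hc : c ≤ 1 / 8) (s : ℝ) {a b : ℝ}
    (ha : |a| ≤ Real.pi) (hb : |b| ≤ Real.pi) :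
    IntervalIntegrable (fun α => ((1 + f s - (1 + f (s - α)) * Real.cos α)
      * ((1 + f s) * Real.cos α - (1 + f (s - α)))) / chordSq f s α
      * (iteratedDeriv 2 f (s - α) - 1 - f (s - α))) volume a b := by
  have h1 := hf.continuous
  have h2 := hf.continuous_iteratedDeriv_two
  have h3 := (continuous_chordSq hf s).measurable
  refine intervalIntegrable_of_log_bound (Measurable.mul (Measurable.div ?_ h3) ?_) ha hb
    fun _ h h0 => hf.bound_normal_term hc h h0 s
  · exact Continuous.measurable (by fun_prop)
  · exact Continuous.measurable (by fun_prop)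

theorem IsSmall.integrable_tangent_term (hf : IsSmall c K f) (hc : c ≤ 1 / 8) (s : ℝ) {a b : ℝ}
    (ha : |a| ≤ Real.pi) (hb : |b| ≤ Real.pi) :
    IntervalIntegrable (fun α => ((1 + f s - (1 + f (s - α)) * Real.cos α) * Real.sin α)
      / chordSq f s α * deriv f (s - α)) volume a b := by
  have h1 := hf.continuous
  have h2 := hf.continuous_deriv
  have h3 := (continuous_chordSq hf s).measurable
  refine intervalIntegrable_of_log_bound (Measurable.mul (Measurable.div ?_ h3) ?_) ha hb
    fun _ h h0 => hf.bound_tangent_term hc h h0 s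
  · exact Continuous.measurable (by fun_prop)
  · exact Continuous.measurable (by fun_prop)

theorem IsSmall.integrable_center (hf : IsSmall c K f) (s : ℝ) {a b : ℝ} :
    IntervalIntegrable (fun α => f (s - α) * Real.cos α) volume a b := by
  have h1 := hf.continuous
  exact Continuous.intervalIntegrable (by fun_prop) _ _

theorem IsSmall.integrable_fullIntegrand (hf : IsSmall c K f) (hc : c ≤ 1 / 8) (s : ℝ) {a b : ℝ}
    (ha : |a| ≤ Real.pi) (hb : |b| ≤ Real.pi) :
    IntervalIntegrable (fullIntegrand f s) volume a b :=
  ((((hf.integrable_log_term hc s ha hb).const_mul _).add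
    (hf.integrable_normal_term hc s ha hb)).add
    ((hf.integrable_tangent_term hc s ha hb).const_mul _)).sub
    ((hf.integrable_center s).const_mul _)

/-- By periodicity and the addition formula, `γ · dM/dt` is a convolution with the cosine and so can
join the other integrands. -/
theorem IsSmall.centerTerm_eq (hf : IsSmall c K f) (s : ℝ) :
    8 * Real.pi * centerTerm f s
      = ∫ α in (-Real.pi)..Real.pi, f (s - α) * Real.cos α := by
  have hc := hf.continuous
  have h1 : ∫ α in (-Real.pi)..Real.pi, f (s - α) * Real.cos α
      = ∫ σ in (-Real.pi)..Real.pi, f σ * Real.cos (s - σ) := by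
    have e1 := intervalIntegral.integral_comp_sub_left (a := -Real.pi) (b := Real.pi)
      (fun σ => f σ * Real.cos (s - σ)) s
    simp only [sub_sub_cancel] at e1
    have hper : Function.Periodic (fun σ => f σ * Real.cos (s - σ)) (2 * Real.pi) := by
      intro σ
      simp only [hf.periodic σ]
      rw [← sub_sub, Real.cos_sub_two_pi]
    have e2 := hper.intervalIntegral_add_eq (s - Real.pi) (-Real.pi)
    rw [show s - Real.pi + 2 * Real.pi = s - -Real.pi by ring,
      show -Real.pi + 2 * Real.pi = Real.pi by ring] at e2
    rw [e1, e2]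
  have h2 : ∫ σ in (-Real.pi)..Real.pi, f σ * Real.cos (s - σ)
      = Real.cos s * (∫ σ in (-Real.pi)..Real.pi, f σ * Real.cos σ)
        + Real.sin s * (∫ σ in (-Real.pi)..Real.pi, f σ * Real.sin σ) := by
    rw [← intervalIntegral.integral_const_mul, ← intervalIntegral.integral_const_mul,
      ← intervalIntegral.integral_add]
    · congr 1; ext σ; rw [Real.cos_sub]; ring
    · exact Continuous.intervalIntegrable (by fun_prop) _ _
    · exact Continuous.intervalIntegrable (by fun_prop) _ _
  rw [h1, h2, centerTerm, centerVelocity]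
  have := Real.pi_pos.ne'
  field_simp
  ring

theorem IsSmall.four_pi_mul_rhs (hf : IsSmall c K f) (hc : c ≤ 1 / 8) (s : ℝ) :
    4 * Real.pi * rhs f s = ∫ α in (-Real.pi)..Real.pi, fullIntegrand f s α := by
  have ha : |(-Real.pi)| ≤ Real.pi := by rw [abs_neg, abs_of_pos Real.pi_pos]
  have hb : |Real.pi| ≤ Real.pi := by rw [abs_of_pos Real.pi_pos]
  have i1 := (hf.integrable_log_term hc s ha hb).const_mul (-(1 / 2))
  have i2 := hf.integrable_normal_term hc s ha hb
  have i3 := (hf.integrable_tangent_term hc s ha hb).const_mul (2 * (1 + f s))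
  have i4 := (hf.integrable_center s (a := -Real.pi) (b := Real.pi)).const_mul (1 / 2)
  unfold fullIntegrand
  rw [intervalIntegral.integral_sub ((i1.add i2).add i3) i4,
    intervalIntegral.integral_add (i1.add i2) i3, intervalIntegral.integral_add i1 i2,
    intervalIntegral.integral_const_mul, intervalIntegral.integral_const_mul,
    intervalIntegral.integral_const_mul, ← hf.centerTerm_eq, rhs, J₁, J₂, J₃]
  have := Real.pi_pos.ne'
  field_simp
  ring

/-- The part of the integrand that is a derivative. -/
def primitive (f : ℝ → ℝ) (s α : ℝ) : ℝ :=
  1 / 2 * Real.log (chordSq f s α) * ((1 + f (s - α)) * Real.sin α + deriv f (s - α) * Real.cos α)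
    - (1 + f s - (1 + f (s - α)) * Real.cos α)
      * ((1 + f s) * (1 + f (s - α)) * Real.sin α
        + deriv f (s - α) * ((1 + f s) * Real.cos α - (1 + f (s - α)))) / chordSq f s α
    - Real.sin α * (1 + f (s - α)) + 1 / 2 * Real.sin α

/-- The first term of `primitive` integrates the logarithmic term by parts, as `(1 + f(s - α)) sin α
+ f'(s - α) cos α` is minus the first derivative of `cos α (1 + f(s - α))`. The second term removes
`f''` from the integrand of `J₂`; the factor multiplying `1 + f s - (1 + f (s - α)) cos α` in its
numerator is half the derivative of `chordSq`. -/
theorem IsSmall.hasDerivAt_primitive (hf : IsSmall c K f) (hc : c ≤ 1 / 8) (s : ℝ) {α : ℝ}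
    (h : |α| ≤ Real.pi) (h0 : α ≠ 0) :
    HasDerivAt (primitive f s) (fullIntegrand f s α - pvKernel f s α) α := by
  have hD := hf.chordSq_pos hc h h0 s
  have hB := (kerDen_pos (hf.kerParam_mem hc h s)).ne'
  have dy := (hf.hasDerivAt_far s α).const_add 1
  have dw := hf.hasDerivAt_deriv_far s α
  have dc := Real.hasDerivAt_cos α
  have ds := Real.hasDerivAt_sin α
  have dD : HasDerivAt (chordSq f s)
      (2 * ((1 + f s) * (1 + f (s - α)) * Real.sin α
        + deriv f (s - α) * ((1 + f s) * Real.cos α - (1 + f (s - α))))) α := by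
    refine (((dy.pow 2).const_add ((1 + f s) ^ 2)).sub
      ((dy.const_mul (2 * (1 + f s))).mul dc)).congr_deriv ?_
    simp
    ring
  have dlog := (dD.log hD.ne').const_mul (1 / 2)
  have dP := (dy.mul ds).add (dw.mul dc)
  have dp := (dy.mul dc).const_sub (1 + f s)
  have dT := ((dy.const_mul (1 + f s)).mul ds).add (dw.mul ((dc.const_mul (1 + f s)).sub dy))
  have key := (((dlog.mul dP).sub ((dp.mul dT).div dD hD.ne')).sub (ds.mul dy)).add
    (ds.const_mul (1 / 2))
  refine key.congr_deriv ?_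
  have halg := kernel_algebra f s (deriv f (s - α)) (chord_ne_zero h h0) hB
  rw [pvKernel, ← halg, fullIntegrand, hf.iteratedDeriv_cos_mul, iteratedDeriv_two_eq]
  have hD' := hD.ne'
  simp
  field_simp
  ring

end integral

/-! ### Integrals away from the singularity -/

/-- The circle without a neighbourhood of `0`. -/
def cutSet (ε : ℝ) : Set ℝ := Icc (-Real.pi) (-ε) ∪ Icc ε Real.pi

theorem isCompact_cutSet (ε : ℝ) : IsCompact (cutSet ε) := isCompact_Icc.union isCompact_Icc

theorem measurableSet_cutSet (ε : ℝ) : MeasurableSet (cutSet ε) :=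
  measurableSet_Icc.union measurableSet_Icc

theorem abs_of_mem_cutSet {ε α : ℝ} (hε : 0 < ε) (h : α ∈ cutSet ε) :
    ε ≤ |α| ∧ |α| ≤ Real.pi := by
  rcases h with ⟨h1, h2⟩ | ⟨h1, h2⟩
  · rw [abs_of_nonpos (by linarith)]; constructor <;> linarith
  · rw [abs_of_nonneg (by linarith)]; exact ⟨h1, h2⟩

theorem ne_zero_of_mem_cutSet {ε α : ℝ} (hε : 0 < ε) (h : α ∈ cutSet ε) : α ≠ 0 := by
  have := (abs_of_mem_cutSet hε h).1
  intro h0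
  rw [h0, abs_zero] at this
  linarith

theorem setIntegral_cutSet {ε : ℝ} (hε : 0 < ε) (hε' : ε ≤ Real.pi) {φ : ℝ → ℝ}
    (hφ : IntegrableOn φ (cutSet ε)) :
    ∫ α in cutSet ε, φ α
      = (∫ α in (-Real.pi)..(-ε), φ α) + ∫ α in ε..Real.pi, φ α := by
  have hd : Disjoint (Icc (-Real.pi) (-ε)) (Icc ε Real.pi) := by
    rw [Set.disjoint_left]
    rintro x ⟨-, h1⟩ ⟨h2, -⟩
    linarith
  rw [cutSet, setIntegral_union hd measurableSet_Icc (hφ.mono_set subset_union_left)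
    (hφ.mono_set subset_union_right), intervalIntegral.integral_of_le (by linarith),
    intervalIntegral.integral_of_le hε', integral_Icc_eq_integral_Ioc,
    integral_Icc_eq_integral_Ioc]

theorem intervalIntegrable_of_cutSet {ε : ℝ} (hε' : ε ≤ Real.pi) {φ : ℝ → ℝ}
    (hφ : IntegrableOn φ (cutSet ε)) :
    IntervalIntegrable φ volume (-Real.pi) (-ε) ∧ IntervalIntegrable φ volume ε Real.pi := by
  constructor
  · rw [intervalIntegrable_iff_integrableOn_Icc_of_le (by linarith)]
    exact hφ.mono_set subset_union_left
  · rw [intervalIntegrable_iff_integrableOn_Icc_of_le hε']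
    exact hφ.mono_set subset_union_right

theorem integrableOn_cutSet {ε : ℝ} (hε' : ε ≤ Real.pi) {φ : ℝ → ℝ}
    (h1 : IntervalIntegrable φ volume (-Real.pi) (-ε))
    (h2 : IntervalIntegrable φ volume ε Real.pi) : IntegrableOn φ (cutSet ε) := by
  rw [intervalIntegrable_iff_integrableOn_Icc_of_le (by linarith)] at h1
  rw [intervalIntegrable_iff_integrableOn_Icc_of_le hε'] at h2
  exact h1.union h2

/-- The fundamental theorem of calculus on the two components of `cutSet`. -/
theorem setIntegral_cutSet_of_hasDerivAt {ε : ℝ} (hε : 0 < ε) (hε' : ε ≤ Real.pi)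
    {φ φ' : ℝ → ℝ} (h : ∀ α ∈ cutSet ε, HasDerivAt φ (φ' α) α)
    (hi : IntegrableOn φ' (cutSet ε)) :
    ∫ α in cutSet ε, φ' α = φ (-ε) - φ (-Real.pi) + (φ Real.pi - φ ε) := by
  obtain ⟨i1, i2⟩ := intervalIntegrable_of_cutSet hε' hi
  rw [setIntegral_cutSet hε hε' hi, intervalIntegral.integral_eq_sub_of_hasDerivAt _ i1,
    intervalIntegral.integral_eq_sub_of_hasDerivAt _ i2]
  · intro α hα
    rw [uIcc_of_le hε'] at hα
    exact h α (Or.inr hα)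
  · intro α hα
    rw [uIcc_of_le (by linarith)] at hα
    exact h α (Or.inl hα)

/-! ### The truncation error of the principal value. -/

section small

variable {c K : ℝ} {f : ℝ → ℝ}

theorem IsSmall.continuousAt_diffQuot (hf : IsSmall c K f) (s : ℝ) {α : ℝ} (h : chord α ≠ 0) :
    ContinuousAt (diffQuot f s) α := by
  have h1 := hf.continuous
  exact ContinuousAt.div (by fun_prop) contDiff_chord.continuous.continuousAt h

theorem IsSmall.continuousAt_kerParam (hf : IsSmall c K f) (s : ℝ) {α : ℝ} (h : chord α ≠ 0) :
    ContinuousAt (kerParam f s) α :=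
  continuousAt_id.prodMk ((hf.continuousAt_diffQuot s h).prodMk continuousAt_const)

theorem continuousAt_nonlin {p : ℝ × ℝ × ℝ} (hp : kerDen p ≠ 0) (w : ℝ) :
    ContinuousAt (fun z : (ℝ × ℝ × ℝ) × ℝ => nonlin z.1 z.2) (p, w) := by
  have h (g : ℝ × ℝ × ℝ → ℝ) (hg : ContDiffAt ℝ 5 g p) :
      ContinuousAt (fun z : (ℝ × ℝ × ℝ) × ℝ => g z.1) (p, w) :=
    ContinuousAt.comp (g := g) hg.continuousAt continuousAt_fst
  have h1 := h _ (contDiffAt_coefQuad hp)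
  have h2 := h _ (contDiffAt_coefLin hp)
  have h3 := h _ (contDiffAt_coefConst hp)
  unfold nonlin
  fun_prop

theorem IsSmall.continuousAt_pvKernel (hf : IsSmall c K f) (hc : c ≤ 1 / 8) (s : ℝ) {α : ℝ}
    (h : |α| ≤ Real.pi) (h0 : α ≠ 0) : ContinuousAt (pvKernel f s) α := by
  have hS := chord_ne_zero h h0
  have hB := (kerDen_pos (hf.kerParam_mem hc h s)).ne'
  have h1 := hf.continuous_deriv
  have h2 : ContinuousAt (fun β => nonlin (kerParam f s β) (deriv f (s - β))) α :=
    ContinuousAt.comp (f := fun β => (kerParam f s β, deriv f (s - β)))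
      (g := fun z : (ℝ × ℝ × ℝ) × ℝ => nonlin z.1 z.2) (continuousAt_nonlin hB _)
      ((hf.continuousAt_kerParam s hS).prodMk (by fun_prop))
  exact ((hf.continuousAt_diffQuot s hS).neg.add h2).div
    contDiff_chord.continuous.continuousAt hS

theorem integrableOn_cutSet_of_continuousAt {ε : ℝ} (hε : 0 < ε) {φ : ℝ → ℝ}
    (h : ∀ α, |α| ≤ Real.pi → α ≠ 0 → ContinuousAt φ α) : IntegrableOn φ (cutSet ε) :=
  ContinuousOn.integrableOn_compact (isCompact_cutSet ε) fun α hα =>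
    (h α (abs_of_mem_cutSet hε hα).2 (ne_zero_of_mem_cutSet hε hα)).continuousWithinAt

theorem IsSmall.four_pi_mul_rhs_sub (hf : IsSmall c K f) (hc : c ≤ 1 / 8) (s : ℝ) {ε : ℝ}
    (hε : 0 < ε) (hε' : ε ≤ Real.pi) :
    4 * Real.pi * rhs f s - ∫ α in cutSet ε, pvKernel f s α
      = (∫ α in (-ε)..ε, fullIntegrand f s α) + (primitive f s (-ε) - primitive f s ε) := by
  have aπ : |Real.pi| ≤ Real.pi := by rw [abs_of_pos Real.pi_pos]
  have aπ' : |(-Real.pi)| ≤ Real.pi := by rwa [abs_neg]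
  have aε : |ε| ≤ Real.pi := by rwa [abs_of_pos hε]
  have aε' : |(-ε)| ≤ Real.pi := by rwa [abs_neg]
  have i1 := hf.integrable_fullIntegrand hc s aπ' aε'
  have i2 := hf.integrable_fullIntegrand hc s aε' aε
  have i3 := hf.integrable_fullIntegrand hc s aε aπ
  have ii := integrableOn_cutSet hε' i1 i3
  have ik : IntegrableOn (pvKernel f s) (cutSet ε) :=
    integrableOn_cutSet_of_continuousAt hε fun α h h0 => hf.continuousAt_pvKernel hc s h h0
  have e1 : ∫ α in cutSet ε, (fullIntegrand f s α - pvKernel f s α) = _ :=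
    setIntegral_cutSet_of_hasDerivAt hε hε' (fun α hα =>
      hf.hasDerivAt_primitive hc s (abs_of_mem_cutSet hε hα).2 (ne_zero_of_mem_cutSet hε hα))
      (ii.sub ik)
  rw [integral_sub ii ik, setIntegral_cutSet hε hε' ii] at e1
  -- Periodicity cancels the boundary terms at `±π`; only those at `±ε` survive.
  have e2 : primitive f s (-Real.pi) = primitive f s Real.pi := by
    have p1 : f (s - -Real.pi) = f (s - Real.pi) := by
      rw [← hf.periodic (s - Real.pi)]; ring_nf
    have p2 : deriv f (s - -Real.pi) = deriv f (s - Real.pi) := by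
      rw [← hf.periodic_deriv (s - Real.pi)]; ring_nf
    simp only [primitive, chordSq, p1, p2, Real.cos_neg, Real.sin_neg, Real.sin_pi, neg_zero]
  rw [hf.four_pi_mul_rhs hc, ← intervalIntegral.integral_add_adjacent_intervals i1 (i2.trans i3),
    ← intervalIntegral.integral_add_adjacent_intervals i2 i3]
  rw [e2] at e1
  linarith

theorem IsSmall.abs_taylor_le (hf : IsSmall c K f) (s α : ℝ) :
    |f (s - α) - f s + α * deriv f s| ≤ K * α ^ 2 := by
  have := Convex.norm_image_sub_le_of_norm_hasDerivWithin_le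
    (f := fun β => f (s - β) + β * deriv f s) (f' := fun β => -deriv f (s - β) + deriv f s)
    (s := uIcc 0 α) (C := K * |α|) (x := 0) (y := α)
    (fun β _ => by
      have h1 : HasDerivAt (fun β => f (s - β) + β * deriv f s) _ β :=
        (hf.hasDerivAt_far s β).add ((hasDerivAt_id' β).mul_const (deriv f s))
      rw [one_mul] at h1
      exact h1.hasDerivWithinAt)
    (fun β hβ => by
      have h1 := hf.abs_deriv_sub_le s (s - β)
      rw [sub_sub_cancel] at h1
      rw [Real.norm_eq_abs, neg_add_eq_sub]
      refine h1.trans (mul_le_mul_of_nonneg_left ?_ hf.nonneg')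
      simpa using abs_sub_left_of_mem_uIcc hβ)
    (convex_uIcc 0 α) left_mem_uIcc right_mem_uIcc
  simp only [sub_zero, zero_mul, add_zero, Real.norm_eq_abs] at this
  calc _ = |f (s - α) + α * deriv f s - f s| := by ring_nf
    _ ≤ K * |α| * |α| := this
    _ = K * α ^ 2 := by rw [mul_assoc, abs_mul_abs_self, sq]

/-- The chord is odd, so the first-order Taylor terms of the two quotients coincide and cancel. -/
theorem IsSmall.abs_diffQuot_sub_neg_le (hf : IsSmall c K f) (s : ℝ) {ε : ℝ} (hε : 0 < ε)
    (hε' : ε ≤ Real.pi) : |diffQuot f s ε - diffQuot f s (-ε)| ≤ 4 * K * ε := by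
  have h1 := hf.abs_taylor_le s ε
  have h2 := hf.abs_taylor_le s (-ε)
  have aε : |ε| ≤ Real.pi := by rwa [abs_of_pos hε]
  have hS := abs_pos.2 (chord_ne_zero aε hε.ne')
  have hS' := le_abs_chord aε
  rw [abs_of_pos hε] at hS'
  rw [diffQuot, diffQuot, chord_neg, div_neg, sub_neg_eq_add, ← add_div, abs_div,
    div_le_iff₀ hS]
  have h3 : |f s - f (s - ε) + (f s - f (s - -ε))| ≤ K * ε ^ 2 + K * ε ^ 2 := by
    rw [abs_le] at *
    constructor <;> nlinarith
  refine h3.trans ?_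
  nlinarith [mul_nonneg hf.nonneg' hε.le]

/-- The bounded term of `primitive` as a function of the parameters. -/
def boundaryTerm (z : (ℝ × ℝ × ℝ) × ℝ × ℝ) : ℝ :=
  (z.1.2.1 + farRadius z.1 * chord z.1.1 / 2)
    * (z.1.2.2 * farRadius z.1 * halfCos z.1.1 + z.2.1 * (z.1.2.1 - z.1.2.2 * chord z.1.1 / 2))
    / kerDen z.1

theorem exists_boundaryTerm_lipschitz : ∃ C : ℝ, 0 ≤ C ∧ ∀ z ∈ slopeBox, ∀ z' ∈ slopeBox,
    |boundaryTerm z - boundaryTerm z'| ≤ C * ‖z - z'‖ := by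
  refine exists_lipschitz_of_contDiffAt isCompact_slopeBox convex_slopeBox fun z hz => ?_
  have h0 : kerDen z.1 ≠ 0 := (kerDen_pos hz.1).ne'
  have h7 : ContDiff ℝ 1 (fun z : (ℝ × ℝ × ℝ) × ℝ × ℝ => chord z.1.1) :=
    (contDiff_chord.of_le (by norm_num)).comp (by fun_prop)
  have h8 : ContDiff ℝ 1 (fun z : (ℝ × ℝ × ℝ) × ℝ × ℝ => halfCos z.1.1) :=
    (contDiff_halfCos.of_le (by norm_num)).comp (by fun_prop)
  have h9 : ContDiff ℝ 1 (fun z : (ℝ × ℝ × ℝ) × ℝ × ℝ => farRadius z.1) :=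
    (contDiff_farRadius.of_le (by norm_num)).comp (by fun_prop)
  have h10 : ContDiff ℝ 1 (fun z : (ℝ × ℝ × ℝ) × ℝ × ℝ => kerDen z.1) :=
    (contDiff_kerDen.of_le (by norm_num)).comp (by fun_prop)
  unfold boundaryTerm
  exact ContDiffAt.div (by fun_prop) h10.contDiffAt h0

theorem exists_log_kerDen_lipschitz : ∃ C : ℝ, 0 ≤ C ∧ ∀ p ∈ kerBox, ∀ p' ∈ kerBox,
    |Real.log (kerDen p) - Real.log (kerDen p')| ≤ C * ‖p - p'‖ :=
  exists_lipschitz_of_contDiffAt isCompact_kerBox convex_kerBox fun _ hp =>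
    (contDiff_kerDen.contDiffAt.of_le (by norm_num)).log (kerDen_pos hp).ne'

theorem IsSmall.primitive_eq (hf : IsSmall c K f) (hc : c ≤ 1 / 8) (s : ℝ) {α : ℝ}
    (h : |α| ≤ Real.pi) (h0 : α ≠ 0) :
    primitive f s α = 1 / 2 * Real.log (chordSq f s α)
        * ((1 + f (s - α)) * Real.sin α + deriv f (s - α) * Real.cos α)
      - boundaryTerm (kerParam f s α, deriv f (s - α), 0)
      - Real.sin α * (1 / 2 + f (s - α)) := by
  have hS := chord_ne_zero h h0
  have hB := (kerDen_pos (hf.kerParam_mem hc h s)).ne'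
  obtain ⟨e1, e2⟩ := IsSmall.far_eq (f := f) s hS
  have e3 := farRadius_kerParam f s hS
  rw [primitive, e1, e2, boundaryTerm, e3]
  simp only
  rw [show Real.sin α = chord α * halfCos α from sin_eq_chord_mul α, chordSq_eq f s hS]
  have ht : (kerParam f s α).2.1 = diffQuot f s α := rfl
  have ha : (kerParam f s α).1 = α := rfl
  have hx : (kerParam f s α).2.2 = 1 + f s := rfl
  rw [ht, ha, hx]
  generalize Real.log (chord α ^ 2 * kerDen (kerParam f s α)) = L
  field_simp
  ring

theorem IsSmall.mem_slopeBox (hf : IsSmall c K f) (hc : c ≤ 1 / 8) {α : ℝ} (h : |α| ≤ Real.pi)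
    (s a b : ℝ) : (kerParam f s α, deriv f a, deriv f b) ∈ slopeBox := by
  have h1 := abs_le.1 (hf.abs_deriv_le a)
  have h2 := abs_le.1 (hf.abs_deriv_le b)
  exact ⟨hf.kerParam_mem hc h s, ⟨by linarith, by linarith⟩, ⟨by linarith, by linarith⟩⟩

/-- A single value of `primitive` contains the slope times a logarithm of size `|log ε|`, which need
not tend to zero. In the difference the squared chord, being even, drops out of the logarithms, and
the slopes at `s - ε` and `s + ε` differ by at most `2 * K * ε`. -/
theorem exists_primitive_bound : ∃ C : ℝ, 0 ≤ C ∧ ∀ (K : ℝ) (f : ℝ → ℝ), IsSmall (1 / 8) K f →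
    ∀ s ε : ℝ, 0 < ε → ε ≤ 1 →
      |primitive f s (-ε) - primitive f s ε| ≤ C * (1 + K) * (ε * (1 + |Real.log ε|)) := by
  obtain ⟨C₁, hC₁, h1⟩ := exists_boundaryTerm_lipschitz
  obtain ⟨C₂, hC₂, h2⟩ := exists_log_kerDen_lipschitz
  refine ⟨10 * C₁ + 10 * C₂ + 50, by positivity, fun K f hf s ε hε hε1 => ?_⟩
  have hc : (1 / 8 : ℝ) ≤ 1 / 8 := le_rfl
  have hε' : ε ≤ Real.pi := hε1.trans (by linarith [Real.pi_gt_three])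
  have aε : |ε| ≤ Real.pi := by rwa [abs_of_pos hε]
  have aε' : |(-ε)| ≤ Real.pi := by rwa [abs_neg]
  have hK := hf.nonneg'
  have hw : |deriv f (s - -ε) - deriv f (s - ε)| ≤ K * (2 * ε) := by
    refine (hf.abs_deriv_sub_le _ _).trans_eq ?_
    rw [show s - -ε - (s - ε) = 2 * ε by ring, abs_of_pos (by linarith)]
  have ht := hf.abs_diffQuot_sub_neg_le s hε hε'
  rw [abs_sub_comm] at ht
  have b1 : |boundaryTerm (kerParam f s (-ε), deriv f (s - -ε), 0)
      - boundaryTerm (kerParam f s ε, deriv f (s - ε), 0)| ≤ C₁ * (6 * (1 + K) * ε) := by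
    have hz : ∀ α, |α| ≤ Real.pi → (kerParam f s α, deriv f (s - α), (0 : ℝ)) ∈ slopeBox := by
      intro α hα
      have := hf.mem_slopeBox hc hα s (s - α) 0
      exact ⟨this.1, this.2.1, ⟨by norm_num, by norm_num⟩⟩
    refine (h1 _ (hz _ aε') _ (hz _ aε)).trans (mul_le_mul_of_nonneg_left ?_ hC₁)
    refine (norm_quintuple_le (-ε - ε) (diffQuot f s (-ε) - diffQuot f s ε)
      (1 + f s - (1 + f s)) (deriv f (s - -ε) - deriv f (s - ε)) (0 - 0)).trans ?_
    rw [show -ε - ε = -(2 * ε) by ring, abs_neg, abs_of_pos (show 0 < 2 * ε by linarith),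
      sub_self, sub_self, abs_zero]
    nlinarith
  have b2 : |Real.log (chordSq f s (-ε)) - Real.log (chordSq f s ε)|
      ≤ C₂ * (4 * (1 + K) * ε) := by
    have hS := chord_ne_zero aε hε.ne'
    have hS' := chord_ne_zero aε' (neg_ne_zero.2 hε.ne')
    have hp := hf.kerParam_mem hc aε s
    have hp' := hf.kerParam_mem hc aε' s
    rw [chordSq_eq f s hS, chordSq_eq f s hS', Real.log_mul (by positivity) (kerDen_pos hp).ne',
      Real.log_mul (by positivity) (kerDen_pos hp').ne', chord_neg, neg_sq,
      add_sub_add_left_eq_sub]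
    refine (h2 _ hp' _ hp).trans (mul_le_mul_of_nonneg_left ?_ hC₂)
    refine (norm_triple_le (-ε - ε) (diffQuot f s (-ε) - diffQuot f s ε)
      (1 + f s - (1 + f s))).trans ?_
    rw [show -ε - ε = -(2 * ε) by ring, abs_neg, abs_of_pos (show 0 < 2 * ε by linarith),
      sub_self, abs_zero]
    nlinarith
  have hsin : |Real.sin ε| ≤ ε := by
    have : |Real.sin ε| ≤ |ε| := Real.abs_sin_le_abs
    rwa [abs_of_pos hε] at this
  have hf1 := hf.abs_apply_le (s - ε)
  have hf2 := hf.abs_apply_le (s - -ε)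
  have hw1 := hf.abs_deriv_le (s - ε)
  have hcos := Real.abs_cos_le_one ε
  have hlog := hf.abs_log_chordSq_le hc aε' (neg_ne_zero.2 hε.ne') s
  rw [Real.log_neg_eq_log] at hlog
  rw [hf.primitive_eq hc s aε' (neg_ne_zero.2 hε.ne'), hf.primitive_eq hc s aε hε.ne',
    Real.cos_neg, Real.sin_neg]
  set L := Real.log (chordSq f s ε)
  set L' := Real.log (chordSq f s (-ε))
  set w := deriv f (s - ε)
  set w' := deriv f (s - -ε)
  set B := boundaryTerm (kerParam f s ε, w, 0)
  set B' := boundaryTerm (kerParam f s (-ε), w', 0)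
  have split : 1 / 2 * L' * ((1 + f (s - -ε)) * -Real.sin ε + w' * Real.cos ε) - B'
        - -Real.sin ε * (1 / 2 + f (s - -ε))
      - (1 / 2 * L * ((1 + f (s - ε)) * Real.sin ε + w * Real.cos ε) - B
        - Real.sin ε * (1 / 2 + f (s - ε)))
    = 1 / 2 * (L' * ((w' - w) * Real.cos ε - Real.sin ε * (2 + f (s - ε) + f (s - -ε))))
      + 1 / 2 * ((L' - L) * ((1 + f (s - ε)) * Real.sin ε + w * Real.cos ε))
      - (B' - B) + Real.sin ε * (1 + f (s - ε) + f (s - -ε)) := by ring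
  rw [split]
  have c1 : |(w' - w) * Real.cos ε - Real.sin ε * (2 + f (s - ε) + f (s - -ε))|
      ≤ 3 * (1 + K) * ε := by
    refine (abs_sub _ _).trans ?_
    rw [abs_mul, abs_mul]
    have d1 : |2 + f (s - ε) + f (s - -ε)| ≤ 3 := by
      rw [abs_le] at *; constructor <;> linarith
    have d2 := mul_le_mul hw hcos (abs_nonneg _) (by positivity)
    have d3 := mul_le_mul hsin d1 (abs_nonneg _) hε.le
    nlinarith
  have c2 : |(1 + f (s - ε)) * Real.sin ε + w * Real.cos ε| ≤ 2 := by
    refine (abs_add_le _ _).trans ?_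
    rw [abs_mul, abs_mul]
    have d1 : |1 + f (s - ε)| ≤ 9 / 8 := by
      rw [abs_le] at *; constructor <;> linarith
    have d2 := mul_le_mul d1 (hsin.trans hε1) (abs_nonneg _) (by norm_num)
    have d3 := mul_le_mul hw1 hcos (abs_nonneg _) (by norm_num)
    linarith
  have c3 : |Real.sin ε * (1 + f (s - ε) + f (s - -ε))| ≤ 2 * ε := by
    rw [abs_mul, mul_comm]
    have d1 : |1 + f (s - ε) + f (s - -ε)| ≤ 2 := by
      rw [abs_le] at *; constructor <;> linarith
    exact mul_le_mul d1 hsin (abs_nonneg _) (by norm_num)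
  have m1 : |L' * ((w' - w) * Real.cos ε - Real.sin ε * (2 + f (s - ε) + f (s - -ε)))|
      ≤ (2 * |Real.log ε| + 7) * (3 * (1 + K) * ε) := by
    rw [abs_mul]
    exact mul_le_mul hlog c1 (abs_nonneg _) (by positivity)
  have m2 : |(L' - L) * ((1 + f (s - ε)) * Real.sin ε + w * Real.cos ε)|
      ≤ C₂ * (4 * (1 + K) * ε) * 2 := by
    rw [abs_mul]
    exact mul_le_mul b2 c2 (abs_nonneg _) (by positivity)
  have total : ∀ a b c d A B C D : ℝ, |a| ≤ A → |b| ≤ B → |c| ≤ C → |d| ≤ D →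
      |1 / 2 * a + 1 / 2 * b - c + d| ≤ A + B + C + D := by
    intro a b c d A B C D ha hb hc hd
    have := (abs_nonneg a).trans ha
    have := (abs_nonneg b).trans hb
    rw [abs_le] at *
    constructor <;> linarith
  refine (total _ _ _ _ _ _ _ _ m1 m2 b1 c3).trans ?_
  have hl := abs_nonneg (Real.log ε)
  have q1 : 0 ≤ (1 + K) * ε := by positivity
  have q2 : 0 ≤ (1 + K) * ε * |Real.log ε| := by positivity
  have q3 := mul_nonneg hC₁ q1
  have q4 := mul_nonneg hC₂ q1
  have q5 := mul_nonneg hC₁ q2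
  have q6 := mul_nonneg hC₂ q2
  have q7 : 0 ≤ K * ε := by positivity
  nlinarith

theorem exists_inner_bound {K : ℝ} {f : ℝ → ℝ} (hf : IsSmall (1 / 8) K f) (s : ℝ) {ε : ℝ}
    (hε : 0 < ε) (hε1 : ε ≤ 1) :
    |∫ α in (-ε)..ε, fullIntegrand f s α| ≤ 50 * (K + 2) * (ε * (4 + 2 * |Real.log ε|)) := by
  have hc : (1 / 8 : ℝ) ≤ 1 / 8 := le_rfl
  have hK := hf.nonneg'
  -- For `|α| ≤ 1` the logarithm is not positive, so `1 + |log α| = 1 - log α`, whose integral is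
  -- explicit.
  have hi : IntervalIntegrable (fun α => 50 * (K + 2) * (1 - Real.log α)) volume (-ε) ε :=
    (intervalIntegrable_const.sub intervalIntegral.intervalIntegrable_log').const_mul _
  have h1 : ∀ᵐ α : ℝ, α ∈ Ioc (-ε) ε →
      ‖fullIntegrand f s α‖ ≤ 50 * (K + 2) * (1 - Real.log α) := by
    have h0 : ∀ᵐ α : ℝ, α ≠ 0 := by simp [ae_iff]
    filter_upwards [h0] with α h0 hα
    have ha1 : |α| ≤ 1 := abs_le.2 ⟨by linarith [hα.1], by linarith [hα.2]⟩
    have ha : |α| ≤ Real.pi := ha1.trans (by linarith [Real.pi_gt_three])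
    have hl : |Real.log α| = -Real.log α := by
      rw [← Real.log_abs]
      exact abs_of_nonpos (Real.log_nonpos (abs_nonneg _) ha1)
    have t1 := hf.bound_log_term hc ha h0 s
    have t2 := hf.bound_normal_term hc ha h0 s
    have t3 := hf.bound_tangent_term hc ha h0 s
    have t4 : |f (s - α) * Real.cos α| ≤ 1 / 8 * 1 := by
      rw [abs_mul]
      exact mul_le_mul (hf.abs_apply_le _) (Real.abs_cos_le_one _) (abs_nonneg _) (by norm_num)
    have hfs := abs_le.1 (hf.abs_apply_le s)
    rw [Real.norm_eq_abs, fullIntegrand]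
    set X := Real.log (chordSq f s α)
      * iteratedDeriv 2 (fun β : ℝ => Real.cos β * (1 + f (s - β))) α
    set Y := ((1 + f s - (1 + f (s - α)) * Real.cos α)
      * ((1 + f s) * Real.cos α - (1 + f (s - α)))) / chordSq f s α
      * (iteratedDeriv 2 f (s - α) - 1 - f (s - α))
    set Z := ((1 + f s - (1 + f (s - α)) * Real.cos α) * Real.sin α)
      / chordSq f s α * deriv f (s - α)
    have t3' : |2 * (1 + f s) * Z| ≤ 5 / 2 * (2 * (1 + |Real.log α|)) := by
      rw [abs_mul]
      refine mul_le_mul ?_ t3 (abs_nonneg _) (by norm_num)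
      rw [abs_le]; constructor <;> linarith
    have hl0 : 0 ≤ |Real.log α| := abs_nonneg _
    have hm : 0 ≤ K * |Real.log α| := by positivity
    rw [show 1 - Real.log α = 1 + |Real.log α| by rw [hl, sub_eq_add_neg]]
    rw [abs_le] at t1 t2 t3' t4 ⊢
    constructor <;> nlinarith
  have h2 := intervalIntegral.norm_integral_le_of_norm_le (by linarith) h1 hi
  rw [Real.norm_eq_abs, intervalIntegral.integral_const_mul, intervalIntegral.integral_sub
    intervalIntegrable_const intervalIntegral.intervalIntegrable_log', integral_log,
    Real.log_neg_eq_log] at h2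
  refine h2.trans (mul_le_mul_of_nonneg_left ?_ (by positivity))
  have hl : |Real.log ε| = -Real.log ε := abs_of_nonpos (Real.log_nonpos hε.le hε1)
  rw [hl]
  simp
  linarith

theorem mul_one_add_abs_log_le {ε : ℝ} (hε : 0 < ε) (hε1 : ε ≤ 1) :
    ε * (1 + |Real.log ε|) ≤ 3 * √ε := by
  have hs : 0 < √ε := Real.sqrt_pos.2 hε
  have h1 : |Real.log ε| = 2 * Real.log (√ε)⁻¹ := by
    rw [abs_of_nonpos (Real.log_nonpos hε.le hε1), Real.log_inv, Real.log_sqrt hε.le]; ring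
  have h2 : Real.log (√ε)⁻¹ ≤ (√ε)⁻¹ - 1 := Real.log_le_sub_one_of_pos (by positivity)
  have h3 : √ε * √ε = ε := Real.mul_self_sqrt hε.le
  have h4 : √ε ≤ 1 := Real.sqrt_le_one.2 hε1
  rw [h1]
  calc ε * (1 + 2 * Real.log (√ε)⁻¹) ≤ ε * (1 + 2 * (√ε)⁻¹) := by
        refine mul_le_mul_of_nonneg_left ?_ hε.le; linarith
    _ = √ε * √ε + 2 * √ε := by nth_rw 1 [← h3]; field_simp
    _ ≤ 3 * √ε := by nlinarith

/-- The right hand side is a principal value, with a rate of convergence. -/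
theorem exists_rhs_sub_pv_bound : ∃ C : ℝ, 0 ≤ C ∧ ∀ (K : ℝ) (f : ℝ → ℝ),
    IsSmall (1 / 8) K f → ∀ s ε : ℝ, 0 < ε → ε ≤ 1 →
      |4 * Real.pi * rhs f s - ∫ α in cutSet ε, pvKernel f s α| ≤ C * (1 + K) * √ε := by
  obtain ⟨C, hC, h⟩ := exists_primitive_bound
  refine ⟨3 * (C + 400), by positivity, fun K f hf s ε hε hε1 => ?_⟩
  have hK := hf.nonneg'
  rw [hf.four_pi_mul_rhs_sub le_rfl s hε (hε1.trans (by linarith [Real.pi_gt_three]))]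
  have h1 := h K f hf s ε hε hε1
  have h2 := exists_inner_bound hf s hε hε1
  have h3 := mul_one_add_abs_log_le hε hε1
  have hl := abs_nonneg (Real.log ε)
  refine (abs_add_le _ _).trans ((add_le_add h2 h1).trans ?_)
  have q : 0 ≤ ε * (1 + |Real.log ε|) := by positivity
  calc _ ≤ (C + 400) * (1 + K) * (ε * (1 + |Real.log ε|)) := by
        nlinarith [mul_nonneg hK q, mul_nonneg hε.le hl, mul_nonneg hK (mul_nonneg hε.le hl),
          mul_nonneg hK hε.le]
    _ ≤ (C + 400) * (1 + K) * (3 * √ε) := mul_le_mul_of_nonneg_left h3 (by positivity)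
    _ = _ := by ring

end small

/-! ### The equation at a maximum of the modulus of the solution -/

theorem IsSmall.mono {c c' K : ℝ} {f : ℝ → ℝ} (hf : IsSmall c K f) (h : c ≤ c') :
    IsSmall c' K f :=
  ⟨hf.periodic, hf.contDiff, fun s => (hf.abs_apply_le s).trans h,
    fun s => (hf.abs_deriv_le s).trans h, hf.abs_deriv2_le⟩

theorem abs_le_of_sign {ς a b : ℝ} (hς : ς = 1 ∨ ς = -1) (h : |a| ≤ b) : ς * a ≤ b := by
  have := abs_le.1 h
  rcases hς with rfl | rfl <;> linarith

theorem volume_real_cutSet_le {ε : ℝ} (hε : 0 < ε) (hε' : ε ≤ Real.pi) :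
    ∫ _ in cutSet ε, (1 : ℝ) ≤ 2 * Real.pi := by
  rw [setIntegral_cutSet hε hε'
    (integrableOn_cutSet hε' intervalIntegrable_const intervalIntegrable_const)]
  simp
  linarith

/-- The bound is linear in a bound `M` of the slope, kept apart from `c`: later `M` decays
exponentially, while `c` supplies the small factor. The bound `K` of the second derivative does not
occur in the result, as it affects only the truncation error. -/
theorem exists_rhs_bound_at_max : ∃ C : ℝ, 0 ≤ C ∧ ∀ (c K M : ℝ) (f : ℝ → ℝ), IsSmall c K f →
    c ≤ 1 / 8 → C * c ≤ 1 → M ≤ c → (∀ σ, |deriv f σ| ≤ M) → ∀ ς s : ℝ, (ς = 1 ∨ ς = -1) →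
      (∀ σ, |f σ| ≤ ς * f s) → ς * rhs f s ≤ C * c * M := by
  obtain ⟨C, hC, hN⟩ := exists_nonlin_bound
  obtain ⟨C', hC', hpv⟩ := exists_rhs_sub_pv_bound
  -- With the factor `3` the hypothesis reads `3 * C * c ≤ 1`, which is what absorbs the terms
  -- containing `θ`.
  refine ⟨3 * C, by positivity, fun c K M f hf hc hCc hMc hM ς s hς hmax => ?_⟩
  have hc0 := hf.nonneg
  have hM0 : 0 ≤ M := (abs_nonneg _).trans (hM 0)
  have pointwise : ∀ α, |α| ≤ Real.pi → α ≠ 0 → ς * pvKernel f s α ≤ 2 * C * c * M := by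
    intro α hα h0
    have hS := chord_ne_zero hα h0
    have hSp := abs_pos.2 hS
    set θ := diffQuot f s α with hθ
    set w := deriv f (s - α)
    have hw := hM (s - α)
    have b1 := hN α θ (1 + f s) w (hf.kerParam_mem hc hα s) (by linarith)
    -- At a maximum of the modulus the increment has the sign `ς`, so the linear part is a full
    -- dissipative term.
    have hX : ς * θ / chord α = |θ| / |chord α| := by
      have hX0 : 0 ≤ ς * (f s - f (s - α)) := by
        have := abs_le_of_sign hς (hmax (s - α))
        linarith
      have e1 : |θ| = ς * (f s - f (s - α)) / |chord α| := by
        rw [hθ, diffQuot, abs_div, ← abs_of_nonneg hX0, abs_mul]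
        rcases hς with rfl | rfl <;> simp
      rw [e1, hθ, diffQuot, div_div, abs_mul_abs_self]
      field_simp
    have e2 : ς * pvKernel f s α
        = -(ς * θ / chord α) + ς * (nonlin (kerParam f s α) w / chord α) := by
      rw [pvKernel]; ring
    have b2 : ς * (nonlin (kerParam f s α) w / chord α)
        ≤ C * (|α| * w ^ 2 + |θ| * w ^ 2 + θ ^ 2) / |chord α| := by
      refine abs_le_of_sign hς ?_
      rw [abs_div]
      exact div_le_div_of_nonneg_right b1 hSp.le
    rw [e2, hX]
    have hw2 : w ^ 2 ≤ c * M := by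
      rw [← sq_abs]
      nlinarith [abs_nonneg w]
    have hθ2 := hf.abs_diffQuot_le hα s
    have b3 : |α| * w ^ 2 + |θ| * w ^ 2 + θ ^ 2 ≤ 2 * |chord α| * (c * M) + 3 * c * |θ| := by
      have d1 : |α| * w ^ 2 ≤ 2 * |chord α| * (c * M) :=
        mul_le_mul (le_abs_chord hα) hw2 (sq_nonneg _) (by positivity)
      have d2 : |θ| * w ^ 2 ≤ |θ| * c := by
        refine mul_le_mul_of_nonneg_left (hw2.trans ?_) (abs_nonneg _)
        nlinarith
      have d3 : θ ^ 2 ≤ 2 * c * |θ| := by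
        rw [← sq_abs, sq]
        exact mul_le_mul_of_nonneg_right hθ2 (abs_nonneg _)
      linarith
    have b4 : C * (|α| * w ^ 2 + |θ| * w ^ 2 + θ ^ 2) / |chord α|
        ≤ 2 * C * c * M + 3 * C * c * (|θ| / |chord α|) := by
      rw [div_le_iff₀ hSp]
      calc _ ≤ C * (2 * |chord α| * (c * M) + 3 * c * |θ|) := mul_le_mul_of_nonneg_left b3 hC
        _ = _ := by field_simp
    have hq : 0 ≤ |θ| / |chord α| := by positivity
    nlinarith
  have hlim : ∀ ε : ℝ, 0 < ε → ε ≤ 1 →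
      4 * Real.pi * (ς * rhs f s) ≤ 4 * Real.pi * (C * c * M) + C' * (1 + K) * √ε := by
    intro ε hε hε1
    have hεπ : ε ≤ Real.pi := hε1.trans (by linarith [Real.pi_gt_three])
    have h1 := abs_le_of_sign hς (hpv K f (hf.mono hc) s ε hε hε1)
    have hi : IntegrableOn (pvKernel f s) (cutSet ε) :=
      integrableOn_cutSet_of_continuousAt hε fun α h h0 => hf.continuousAt_pvKernel hc s h h0
    have h2 : ς * ∫ α in cutSet ε, pvKernel f s α ≤ 4 * Real.pi * (C * c * M) := by
      rw [← integral_const_mul]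
      have h3 : ∫ α in cutSet ε, ς * pvKernel f s α
          ≤ ∫ _ in cutSet ε, 2 * C * c * M * (1 : ℝ) := by
        refine setIntegral_mono_on (hi.const_mul ς) ?_ (measurableSet_cutSet ε) fun α hα => ?_
        · exact integrableOn_cutSet hεπ intervalIntegrable_const intervalIntegrable_const
        · rw [mul_one]
          exact pointwise α (abs_of_mem_cutSet hε hα).2 (ne_zero_of_mem_cutSet hε hα)
      have h5 : ∫ _ in cutSet ε, 2 * C * c * M * (1 : ℝ)
          = 2 * C * c * M * ∫ _ in cutSet ε, (1 : ℝ) := integral_const_mul _ _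
      have h4 := mul_le_mul_of_nonneg_left (volume_real_cutSet_le hε hεπ)
        (show 0 ≤ 2 * C * c * M by positivity)
      linarith
    linarith
  have ht : Tendsto (fun ε : ℝ => 4 * Real.pi * (C * c * M) + C' * (1 + K) * √ε) (𝓝[>] 0)
      (𝓝 (4 * Real.pi * (C * c * M) + C' * (1 + K) * √0)) :=
    ((continuous_const.add (continuous_const.mul Real.continuous_sqrt)).tendsto
      (0 : ℝ)).mono_left nhdsWithin_le_nhds
  have h5 : 4 * Real.pi * (ς * rhs f s) ≤ 4 * Real.pi * (C * c * M) + C' * (1 + K) * √0 := by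
    refine ge_of_tendsto ht ?_
    filter_upwards [Ioc_mem_nhdsGT (zero_lt_one' ℝ)] with ε hε
    exact hlim ε hε.1 hε.2
  rw [Real.sqrt_zero, mul_zero, add_zero] at h5
  have h6 := le_of_mul_le_mul_left h5 (by positivity)
  have h7 : 0 ≤ C * c * M := by positivity
  linarith

/-! ### Differentiation of the kernel -/

section derivative

variable {c K : ℝ} {f : ℝ → ℝ}

/-- The derivative of `pvKernel f σ α` with respect to `σ`. -/
def pvKernelDeriv (f : ℝ → ℝ) (σ α : ℝ) : ℝ :=
  (-((deriv f σ - deriv f (σ - α)) / chord α)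
    + (nonlinDir dirQuot (kerParam f σ α) (deriv f (σ - α))
        * ((deriv f σ - deriv f (σ - α)) / chord α)
      + nonlinDir dirRad (kerParam f σ α) (deriv f (σ - α)) * deriv f σ
      + (2 * coefQuad (kerParam f σ α) * deriv f (σ - α) + coefLin (kerParam f σ α))
        * deriv (deriv f) (σ - α))) / chord α

/-- The form that the derivative of the kernel takes after an integration by parts. -/
def slopeKernel (f : ℝ → ℝ) (σ α : ℝ) : ℝ :=
  (deriv f (σ - α) - deriv f σ) / chord α ^ 2
      * (1 + dissCoef (kerParam f σ α, deriv f (σ - α), deriv f σ))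
    + deriv f σ * (nonlinDir dirRad (kerParam f σ α) (deriv f (σ - α)) / chord α)

/-- The boundary term of the integration by parts. -/
def slopeBoundary (f : ℝ → ℝ) (σ α : ℝ) : ℝ :=
  (deriv f (σ - α) - deriv f σ)
    * slopeQuot (kerParam f σ α, deriv f (σ - α), deriv f σ) / chord α

theorem triple_decomp (a b d : ℝ) :
    ((a, b, d) : ℝ × ℝ × ℝ) = a • dirAngle + b • dirQuot + d • dirRad := by
  simp [dirAngle, dirQuot, dirRad]

theorem hasDerivAt_coef_comp {g : ℝ × ℝ × ℝ → ℝ} {a b d : ℝ → ℝ} {a' b' d' t : ℝ}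
    (hg : ContDiffAt ℝ 5 g (a t, b t, d t)) (ha : HasDerivAt a a' t) (hb : HasDerivAt b b' t)
    (hd : HasDerivAt d d' t) :
    HasDerivAt (fun r => g (a r, b r, d r))
      (a' * fderiv ℝ g (a t, b t, d t) dirAngle + b' * fderiv ℝ g (a t, b t, d t) dirQuot
        + d' * fderiv ℝ g (a t, b t, d t) dirRad) t := by
  have h1 := (hg.differentiableAt (by norm_num)).hasFDerivAt.comp_hasDerivAt (f := fun r =>
    (a r, b r, d r)) t (ha.prodMk (hb.prodMk hd))
  refine h1.congr_deriv ?_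
  rw [triple_decomp a' b' d', map_add, map_add, map_smul, map_smul, map_smul]
  rfl

theorem hasDerivAt_chord (α : ℝ) : HasDerivAt chord (halfCos α) α := by
  have := ((Real.hasDerivAt_sin (α / 2)).comp α ((hasDerivAt_id α).div_const 2)).const_mul 2
  refine this.congr_deriv ?_
  rw [halfCos]; ring

theorem IsSmall.hasDerivAt_diffQuot_left (hf : IsSmall c K f) (σ α : ℝ) :
    HasDerivAt (fun τ => diffQuot f τ α) ((deriv f σ - deriv f (σ - α)) / chord α) σ :=
  ((hf.hasDerivAt σ).sub ((hf.hasDerivAt (σ - α)).comp_sub_const σ α)).div_const _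

theorem IsSmall.hasDerivAt_diffQuot_right (hf : IsSmall c K f) (σ : ℝ) {α : ℝ}
    (h : chord α ≠ 0) :
    HasDerivAt (diffQuot f σ) ((deriv f (σ - α) - diffQuot f σ α * halfCos α) / chord α) α := by
  refine (((hf.hasDerivAt_far σ α).const_sub (f σ)).div (hasDerivAt_chord α) h).congr_deriv ?_
  rw [diffQuot]
  field_simp

theorem IsSmall.hasDerivAt_pvKernel (hf : IsSmall c K f) (hc : c ≤ 1 / 8) (σ : ℝ) {α : ℝ}
    (h : |α| ≤ Real.pi) :
    HasDerivAt (fun τ => pvKernel f τ α) (pvKernelDeriv f σ α) σ := by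
  have hB := (kerDen_pos (hf.kerParam_mem hc h σ)).ne'
  have dw := (hf.hasDerivAt_deriv (σ - α)).comp_sub_const σ α
  have dq := hf.hasDerivAt_diffQuot_left σ α
  have dx := (hf.hasDerivAt σ).const_add 1
  have dg {g : ℝ × ℝ × ℝ → ℝ} (hg : ContDiffAt ℝ 5 g (kerParam f σ α)) :=
    hasDerivAt_coef_comp (a := fun _ => α) (b := fun τ => diffQuot f τ α)
      (d := fun τ => 1 + f τ) hg (hasDerivAt_const σ α) dq dx
  have d2 := dg (contDiffAt_coefQuad hB)
  have d1 := dg (contDiffAt_coefLin hB)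
  have d0 := dg (contDiffAt_coefConst hB)
  have key := (dq.neg.add (((d2.mul (dw.pow 2)).add (d1.mul dw)).add d0)).div_const (chord α)
  refine key.congr_deriv ?_
  simp only [pvKernelDeriv, nonlinDir, kerParam, Pi.pow_apply]
  push_cast
  ring

/-- Since `(w - m) * slopeQuot = nonlin p w - nonlin p m`, the `α`-derivative reproduces the term
with `f''(σ - α)`. Subtracting the value at `m = f'(σ)` keeps the boundary term bounded near `α =
0`. -/
theorem IsSmall.hasDerivAt_slopeBoundary (hf : IsSmall c K f) (hc : c ≤ 1 / 8) (σ : ℝ) {α : ℝ}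
    (h : |α| ≤ Real.pi) (h0 : α ≠ 0) :
    HasDerivAt (slopeBoundary f σ) (slopeKernel f σ α - pvKernelDeriv f σ α) α := by
  have hB := (kerDen_pos (hf.kerParam_mem hc h σ)).ne'
  have hS := chord_ne_zero h h0
  have dw := hf.hasDerivAt_deriv_far σ α
  have dq := hf.hasDerivAt_diffQuot_right σ hS
  have dg {g : ℝ × ℝ × ℝ → ℝ} (hg : ContDiffAt ℝ 5 g (kerParam f σ α)) :=
    hasDerivAt_coef_comp (a := fun β => β) (b := diffQuot f σ)
      (d := fun _ => 1 + f σ) hg (hasDerivAt_id' α) dq (hasDerivAt_const α (1 + f σ))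
  have d2 := dg (contDiffAt_coefQuad hB)
  have d1 := dg (contDiffAt_coefLin hB)
  have key := ((dw.sub_const (deriv f σ)).mul ((d2.mul (dw.add_const (deriv f σ))).add d1)).div
    (hasDerivAt_chord α) hS
  refine key.congr_deriv ?_
  simp only [pvKernelDeriv, slopeKernel, dissCoef, slopeQuot, nonlinDir, kerParam]
  simp
  field_simp
  ring

theorem coefQuad_neg (a t x : ℝ) : coefQuad (-a, -t, x) = -coefQuad (a, t, x) := by
  simp only [coefQuad, kerDen, farRadius, chord_neg]
  ring

/-- At `α = ±π` the linear coefficient vanishes with `cos (α / 2)`; the quadratic one changes sign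
together with the chord by which it is divided. -/
theorem IsSmall.slopeBoundary_neg_pi (hf : IsSmall c K f) (σ : ℝ) :
    slopeBoundary f σ (-Real.pi) = slopeBoundary f σ Real.pi := by
  have p1 : f (σ - -Real.pi) = f (σ - Real.pi) := by
    rw [← hf.periodic (σ - Real.pi)]; ring_nf
  have p2 : deriv f (σ - -Real.pi) = deriv f (σ - Real.pi) := by
    rw [← hf.periodic_deriv (σ - Real.pi)]; ring_nf
  have hC : halfCos Real.pi = 0 := by rw [halfCos, Real.cos_pi_div_two]
  have hC' : halfCos (-Real.pi) = 0 := by rw [halfCos, neg_div, Real.cos_neg, Real.cos_pi_div_two]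
  have hp : kerParam f σ (-Real.pi) = (-Real.pi, -diffQuot f σ Real.pi, 1 + f σ) := by
    rw [kerParam, diffQuot, diffQuot, p1, chord_neg, div_neg]
  have l1 : ∀ t x, coefLin (Real.pi, t, x) = 0 := fun t x => by simp [coefLin, coefLinRed, hC]
  have l2 : ∀ t x, coefLin (-Real.pi, t, x) = 0 := fun t x => by simp [coefLin, coefLinRed, hC']
  rw [slopeBoundary, slopeBoundary, slopeQuot, slopeQuot, hp, p2, chord_neg, kerParam]
  simp only [coefQuad_neg, l1, l2, add_zero]
  rw [neg_mul, mul_neg, neg_div_neg_eq]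

/-- Differentiation under the integral sign over a compact set. -/
theorem hasDerivAt_setIntegral_of_continuousOn {A : Set ℝ} (hA : IsCompact A) {F F' : ℝ → ℝ → ℝ}
    (hF : ∀ σ, ContinuousOn (F σ) A) (hF' : ContinuousOn (Function.uncurry F') (univ ×ˢ A))
    (h : ∀ σ, ∀ α ∈ A, HasDerivAt (fun τ => F τ α) (F' σ α) σ) (σ : ℝ) :
    HasDerivAt (fun τ => ∫ α in A, F τ α) (∫ α in A, F' σ α) σ := by
  obtain ⟨C, hC⟩ := ((isCompact_Icc (a := σ - 1) (b := σ + 1)).prod hA).exists_bound_of_continuousOn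
    (hF'.mono (prod_mono (subset_univ _) subset_rfl))
  have hm := hA.measurableSet
  have hc' : ContinuousOn (F' σ) A :=
    hF'.comp (f := fun α => (σ, α)) (by fun_prop) fun α hα => ⟨mem_univ _, hα⟩
  refine (hasDerivAt_integral_of_dominated_loc_of_deriv_le (bound := fun _ => C)
    (Icc_mem_nhds (show σ - 1 < σ by linarith) (show σ < σ + 1 by linarith)) ?_ ?_ ?_ ?_ ?_ ?_).2
  · exact .of_forall fun τ => (hF τ).aestronglyMeasurable hm
  · exact (hF σ).integrableOn_compact hA
  · exact hc'.aestronglyMeasurable hm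
  · exact ae_restrict_of_forall_mem hm fun α hα τ hτ => hC (τ, α) ⟨hτ, hα⟩
  · exact (continuousOn_const (c := C)).integrableOn_compact hA
  · exact ae_restrict_of_forall_mem hm fun α hα τ _ => h τ α hα

theorem IsSmall.continuousAt_kerParam_uncurry (hf : IsSmall c K f) {z : ℝ × ℝ}
    (h : chord z.2 ≠ 0) : ContinuousAt (fun z : ℝ × ℝ => kerParam f z.1 z.2) z := by
  have h1 := hf.continuous
  have h2 := contDiff_chord.continuous
  have h3 : ContinuousAt (fun z : ℝ × ℝ => (f z.1 - f (z.1 - z.2)) / chord z.2) z :=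
    ContinuousAt.div (by fun_prop) (by fun_prop) h
  exact continuousAt_snd.prodMk (h3.prodMk (by fun_prop))

theorem IsSmall.continuousAt_pvKernelDeriv (hf : IsSmall c K f) (hc : c ≤ 1 / 8) {z : ℝ × ℝ}
    (h : |z.2| ≤ Real.pi) (h0 : z.2 ≠ 0) :
    ContinuousAt (Function.uncurry (pvKernelDeriv f)) z := by
  have hB := (kerDen_pos (hf.kerParam_mem hc h z.1)).ne'
  have hS := chord_ne_zero h h0
  have hp := hf.continuousAt_kerParam_uncurry hS
  have hg {g : ℝ × ℝ × ℝ → ℝ} (hg : ContinuousAt g (kerParam f z.1 z.2)) :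
      ContinuousAt (fun z : ℝ × ℝ => g (kerParam f z.1 z.2)) z :=
    ContinuousAt.comp (f := fun z : ℝ × ℝ => kerParam f z.1 z.2) hg hp
  have hd {g : ℝ × ℝ × ℝ → ℝ} (h5 : ContDiffAt ℝ 5 g (kerParam f z.1 z.2)) (v : ℝ × ℝ × ℝ) :=
    hg (contDiffAt_fderiv_apply h5 v).continuousAt
  have a1 := hg (contDiffAt_coefQuad hB).continuousAt
  have a2 := hg (contDiffAt_coefLin hB).continuousAt
  have a3 := hd (contDiffAt_coefQuad hB) dirQuot
  have a4 := hd (contDiffAt_coefLin hB) dirQuot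
  have a5 := hd (contDiffAt_coefConst hB) dirQuot
  have a6 := hd (contDiffAt_coefQuad hB) dirRad
  have a7 := hd (contDiffAt_coefLin hB) dirRad
  have a8 := hd (contDiffAt_coefConst hB) dirRad
  have c1 : ContinuousAt (fun z : ℝ × ℝ => deriv f z.1) z := by
    have := hf.continuous_deriv; fun_prop
  have c2 : ContinuousAt (fun z : ℝ × ℝ => deriv f (z.1 - z.2)) z := by
    have := hf.continuous_deriv; fun_prop
  have c3 : ContinuousAt (fun z : ℝ × ℝ => deriv (deriv f) (z.1 - z.2)) z := by
    have := hf.continuous_deriv2; fun_prop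
  have c4 : ContinuousAt (fun z : ℝ × ℝ => chord z.2) z := by
    have := contDiff_chord.continuous; fun_prop
  have c5 := (c1.sub c2).div c4 hS
  have n1 := ((a3.mul (c2.pow 2)).add (a4.mul c2)).add a5
  have n2 := ((a6.mul (c2.pow 2)).add (a7.mul c2)).add a8
  exact (c5.neg.add (((n1.mul c5).add (n2.mul c1)).add
    ((((continuousAt_const (y := (2 : ℝ))).mul a1).mul c2 |>.add a2).mul c3))).div c4 hS

theorem IsSmall.hasDerivAt_setIntegral_pvKernel (hf : IsSmall c K f) (hc : c ≤ 1 / 8) (σ : ℝ)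
    {ε : ℝ} (hε : 0 < ε) :
    HasDerivAt (fun τ => ∫ α in cutSet ε, pvKernel f τ α)
      (∫ α in cutSet ε, pvKernelDeriv f σ α) σ :=
  hasDerivAt_setIntegral_of_continuousOn (isCompact_cutSet ε)
    (fun τ _ hα => (hf.continuousAt_pvKernel hc τ (abs_of_mem_cutSet hε hα).2
      (ne_zero_of_mem_cutSet hε hα)).continuousWithinAt)
    (fun _ hz => (hf.continuousAt_pvKernelDeriv hc (abs_of_mem_cutSet hε hz.2).2
      (ne_zero_of_mem_cutSet hε hz.2)).continuousWithinAt)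
    (fun τ _ hα => hf.hasDerivAt_pvKernel hc τ (abs_of_mem_cutSet hε hα).2) σ

end derivative

/-! ### Integral inequalities -/

theorem setIntegral_cutSet_abs_inv {ε : ℝ} (hε : 0 < ε) (hε' : ε ≤ Real.pi) :
    ∫ α in cutSet ε, |α|⁻¹ = 2 * Real.log (Real.pi / ε) := by
  have hi : IntegrableOn (fun α : ℝ => |α|⁻¹) (cutSet ε) :=
    integrableOn_cutSet_of_continuousAt hε fun α _ h0 =>
      continuous_abs.continuousAt.inv₀ (abs_ne_zero.2 h0)
  have h1 : ∫ α in ε..Real.pi, |α|⁻¹ = Real.log (Real.pi / ε) := by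
    rw [← integral_inv_of_pos hε Real.pi_pos]
    refine intervalIntegral.integral_congr fun α hα => ?_
    rw [uIcc_of_le hε'] at hα
    rw [abs_of_pos (by linarith [hα.1])]
  have h2 : ∫ α in (-Real.pi)..(-ε), |α|⁻¹ = ∫ α in ε..Real.pi, |α|⁻¹ := by
    rw [← intervalIntegral.integral_comp_neg]
    simp
  rw [setIntegral_cutSet hε hε' hi, h2, h1]
  ring

/-- Hardy's inequality in `L¹`, on an interval away from the origin. -/
theorem hardy_interval {d : ℝ → ℝ} (hd : Continuous d) (h0 : ∀ α, 0 ≤ d α) {ε b : ℝ}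
    (hε : 0 < ε) (hb : ε ≤ b) :
    ∫ α in ε..b, (∫ β in (0)..α, d β) / α ^ 2
      ≤ (∫ β in (0)..ε, d β) / ε + ∫ α in ε..b, d α / α := by
  have hΨ : ∀ α, HasDerivAt (fun α => ∫ β in (0)..α, d β) (d α) α := fun α =>
    intervalIntegral.integral_hasDerivAt_right (hd.intervalIntegrable _ _)
      (hd.stronglyMeasurableAtFilter _ _) hd.continuousAt
  have hΨc : Continuous fun α => ∫ β in (0)..α, d β :=
    continuous_iff_continuousAt.2 fun α => (hΨ α).continuousAt
  have hne : ∀ α ∈ uIcc ε b, α ≠ 0 := fun α hα => by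
    rw [uIcc_of_le hb] at hα; linarith [hα.1]
  have i1 : IntervalIntegrable (fun α => (∫ β in (0)..α, d β) / α ^ 2) volume ε b :=
    (ContinuousOn.div hΨc.continuousOn (by fun_prop)
      fun α hα => pow_ne_zero 2 (hne α hα)).intervalIntegrable
  have i2 : IntervalIntegrable (fun α => d α / α) volume ε b :=
    (ContinuousOn.div hd.continuousOn (by fun_prop) hne).intervalIntegrable
  -- The function `-(∫ d) / α` has the derivative `(∫ d) / α ^ 2 - d / α`; its boundary value at `b`
  -- has a favourable sign and is dropped.
  have h1 := intervalIntegral.integral_eq_sub_of_hasDerivAt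
    (f := fun α => -((∫ β in (0)..α, d β) / α))
    (f' := fun α => (∫ β in (0)..α, d β) / α ^ 2 - d α / α) (a := ε) (b := b)
    (fun α hα => by
      refine ((hΨ α).div (hasDerivAt_id' α) (hne α hα)).neg.congr_deriv ?_
      have := hne α hα
      field_simp
      ring) (i1.sub i2)
  rw [intervalIntegral.integral_sub i1 i2] at h1
  have h2 : 0 ≤ (∫ β in (0)..b, d β) / b :=
    div_nonneg (intervalIntegral.integral_nonneg (by linarith) fun α _ => h0 α) (by linarith)
  linarith

theorem continuous_primitive_of_continuous {d : ℝ → ℝ} (hd : Continuous d) :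
    Continuous fun α => ∫ β in (0)..α, d β :=
  intervalIntegral.continuous_primitive (fun _ _ => hd.intervalIntegrable _ _) 0

theorem hardy_cutSet {d : ℝ → ℝ} (hd : Continuous d) (h0 : ∀ α, 0 ≤ d α) {ε : ℝ}
    (hε : 0 < ε) (hε' : ε ≤ Real.pi) :
    ∫ α in cutSet ε, |∫ β in (0)..α, d β| / α ^ 2
      ≤ (∫ β in (-ε)..ε, d β) / ε + ∫ α in cutSet ε, d α / |α| := by
  have hi1 : IntegrableOn (fun α => |∫ β in (0)..α, d β| / α ^ 2) (cutSet ε) :=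
    integrableOn_cutSet_of_continuousAt hε fun α _ h =>
      ((continuous_primitive_of_continuous hd).abs.continuousAt).div (by fun_prop)
        (pow_ne_zero 2 h)
  have hi2 : IntegrableOn (fun α => d α / |α|) (cutSet ε) :=
    integrableOn_cutSet_of_continuousAt hε fun α _ h =>
      hd.continuousAt.div (by fun_prop) (abs_ne_zero.2 h)
  have hd' : Continuous fun α => d (-α) := by fun_prop
  have p1 := hardy_interval hd h0 hε hε'
  have p2 := hardy_interval hd' (fun α => h0 (-α)) hε hε'
  have e1 : ∫ α in ε..Real.pi, |∫ β in (0)..α, d β| / α ^ 2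
      = ∫ α in ε..Real.pi, (∫ β in (0)..α, d β) / α ^ 2 := by
    refine intervalIntegral.integral_congr fun α hα => ?_
    rw [uIcc_of_le hε'] at hα
    rw [abs_of_nonneg (intervalIntegral.integral_nonneg (by linarith [hα.1]) fun β _ => h0 β)]
  have e2 : ∫ α in ε..Real.pi, d α / |α| = ∫ α in ε..Real.pi, d α / α := by
    refine intervalIntegral.integral_congr fun α hα => ?_
    rw [uIcc_of_le hε'] at hα
    rw [abs_of_nonneg (by linarith [hα.1])]
  have e3 : ∫ α in (-Real.pi)..(-ε), |∫ β in (0)..α, d β| / α ^ 2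
      = ∫ α in ε..Real.pi, (∫ β in (0)..α, d (-β)) / α ^ 2 := by
    rw [← intervalIntegral.integral_comp_neg]
    refine intervalIntegral.integral_congr fun α hα => ?_
    rw [uIcc_of_le hε'] at hα
    rw [intervalIntegral.integral_comp_neg, neg_zero, intervalIntegral.integral_symm, abs_neg,
      abs_of_nonneg (intervalIntegral.integral_nonneg (by linarith [hα.1]) fun β _ => h0 β),
      neg_sq]
  have e4 : ∫ α in (-Real.pi)..(-ε), d α / |α| = ∫ α in ε..Real.pi, d (-α) / α := by
    rw [← intervalIntegral.integral_comp_neg]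
    refine intervalIntegral.integral_congr fun α hα => ?_
    rw [uIcc_of_le hε'] at hα
    rw [abs_neg, abs_of_nonneg (by linarith [hα.1])]
  have e5 : ∫ β in (-ε)..ε, d β = (∫ β in (0)..ε, d (-β)) + ∫ β in (0)..ε, d β := by
    rw [intervalIntegral.integral_comp_neg, neg_zero,
      intervalIntegral.integral_add_adjacent_intervals (hd.intervalIntegrable _ _)
        (hd.intervalIntegrable _ _)]
  rw [setIntegral_cutSet hε hε' hi1, setIntegral_cutSet hε hε' hi2, e1, e2, e3, e4, e5, add_div]
  linarith

/-! ### Finite differences -/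

/-- The forward difference quotient of step `η`. -/
def fwdQuot (f : ℝ → ℝ) (η r : ℝ) : ℝ := (f (r + η) - f r) / η

/-- The modulus of the increments of the forward difference quotient. -/
def quotGap (f : ℝ → ℝ) (η s α : ℝ) : ℝ := |fwdQuot f η (s - α) - fwdQuot f η s|

section slope

variable {c K : ℝ} {f : ℝ → ℝ}

theorem IsSmall.continuous_fwdQuot (hf : IsSmall c K f) (η : ℝ) : Continuous (fwdQuot f η) := by
  have := hf.continuous
  unfold fwdQuot
  fun_prop

theorem IsSmall.continuous_quotGap (hf : IsSmall c K f) (η s : ℝ) :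
    Continuous (quotGap f η s) := by
  have := hf.continuous_fwdQuot η
  unfold quotGap
  fun_prop

theorem quotGap_nonneg (f : ℝ → ℝ) (η s α : ℝ) : 0 ≤ quotGap f η s α := abs_nonneg _

theorem IsSmall.hasDerivAt_fwdQuot (hf : IsSmall c K f) (η r : ℝ) :
    HasDerivAt (fwdQuot f η) ((deriv f (r + η) - deriv f r) / η) r :=
  (((hf.hasDerivAt (r + η)).comp_add_const r η).sub (hf.hasDerivAt r)).div_const η

theorem IsSmall.abs_deriv_sub_fwdQuot_le (hf : IsSmall c K f) {η r ρ : ℝ} (hη : 0 < η)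
    (hρ : ρ ∈ Icc r (r + η)) : |deriv f ρ - fwdQuot f η r| ≤ K * η := by
  obtain ⟨ξ, hξ, h⟩ := exists_hasDerivAt_eq_slope f (deriv f) (show r < r + η by linarith)
    hf.continuous.continuousOn fun x _ => hf.hasDerivAt x
  rw [add_sub_cancel_left] at h
  rw [fwdQuot, ← h]
  refine (hf.abs_deriv_sub_le ρ ξ).trans (mul_le_mul_of_nonneg_left ?_ hf.nonneg')
  rw [abs_le]
  constructor <;> linarith [hρ.1, hρ.2, hξ.1, hξ.2]

theorem IsSmall.abs_fwdQuot_sub_le (hf : IsSmall c K f) {η : ℝ} (hη : 0 < η) (a b : ℝ) :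
    |fwdQuot f η a - fwdQuot f η b| ≤ K * |a - b| := by
  have := Convex.norm_image_sub_le_of_norm_hasDerivWithin_le (f := fwdQuot f η)
    (s := univ) (C := K) (x := b) (y := a)
    (fun x _ => (hf.hasDerivAt_fwdQuot η x).hasDerivWithinAt)
    (fun x _ => by
      rw [Real.norm_eq_abs, abs_div, abs_of_pos hη, div_le_iff₀ hη]
      have := hf.abs_deriv_sub_le (x + η) x
      rwa [add_sub_cancel_left, abs_of_pos hη] at this) convex_univ (mem_univ _) (mem_univ _)
  simpa using this

theorem IsSmall.quotGap_le (hf : IsSmall c K f) {η : ℝ} (hη : 0 < η) (s α : ℝ) :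
    quotGap f η s α ≤ K * |α| := by
  have := hf.abs_fwdQuot_sub_le hη (s - α) s
  rwa [sub_sub_cancel_left, abs_neg] at this

theorem IsSmall.abs_slope_sub_le (hf : IsSmall c K f) {η s σ : ℝ} (hη : 0 < η)
    (hσ : σ ∈ Icc s (s + η)) (α : ℝ) :
    |deriv f (σ - α) - deriv f σ| ≤ quotGap f η s α + 2 * K * η := by
  have h1 := hf.abs_deriv_sub_fwdQuot_le hη hσ
  have h2 := hf.abs_deriv_sub_fwdQuot_le (r := s - α) (ρ := σ - α) hη
    ⟨by linarith [hσ.1], by linarith [hσ.2]⟩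
  rw [quotGap]
  have h3 := abs_sub_abs_le_abs_sub (fwdQuot f η (s - α)) (fwdQuot f η s)
  calc |deriv f (σ - α) - deriv f σ|
      = |(deriv f (σ - α) - fwdQuot f η (s - α)) - (deriv f σ - fwdQuot f η s)
          + (fwdQuot f η (s - α) - fwdQuot f η s)| := by ring_nf
    _ ≤ _ := abs_add_le _ _
    _ ≤ _ := by
        have := abs_sub (deriv f (σ - α) - fwdQuot f η (s - α)) (deriv f σ - fwdQuot f η s)
        linarith

theorem IsSmall.abs_diffQuot_sub_le (hf : IsSmall c K f) {α : ℝ} (h : |α| ≤ Real.pi) (h0 : α ≠ 0)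
    (σ s : ℝ) : |diffQuot f σ α - diffQuot f s α| ≤ 2 * K * |σ - s| := by
  have hS := abs_pos.2 (chord_ne_zero h h0)
  have := Convex.norm_image_sub_le_of_norm_hasDerivWithin_le (f := fun τ => diffQuot f τ α)
    (s := univ) (C := 2 * K) (x := s) (y := σ)
    (fun x _ => (hf.hasDerivAt_diffQuot_left x α).hasDerivWithinAt)
    (fun x _ => by
      rw [Real.norm_eq_abs, abs_div, div_le_iff₀ hS]
      have h1 := hf.abs_deriv_sub_le x (x - α)
      rw [sub_sub_cancel] at h1
      have h2 := le_abs_chord h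
      nlinarith [hf.nonneg']) convex_univ (mem_univ _) (mem_univ _)
  simpa using this

theorem abs_sub_chord_le {α : ℝ} : |α - chord α| ≤ α ^ 2 / 2 := by
  have key : ∀ x : ℝ, 0 ≤ x → |x - Real.sin x| ≤ x ^ 2 := by
    intro x hx
    rw [abs_of_nonneg (by linarith [Real.sin_le hx])]
    rcases hx.eq_or_lt with rfl | hx
    · simp
    · have h3 := Real.sin_gt_sub_cube hx
      rcases le_total x 6 with h1 | h1
      · have : x ^ 3 = x * x ^ 2 := by ring
        nlinarith [sq_nonneg x]
      · nlinarith [Real.neg_one_le_sin x]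
  have e : α - chord α = 2 * (α / 2 - Real.sin (α / 2)) := by rw [chord]; ring
  rw [e, abs_mul, abs_two]
  rcases le_total 0 α with h | h
  · have := key (α / 2) (by linarith)
    linarith [show (α / 2) ^ 2 = α ^ 2 / 4 by ring]
  · have := key (-(α / 2)) (by linarith)
    rw [Real.sin_neg, neg_sub_neg, abs_sub_comm, neg_sq] at this
    linarith [show (α / 2) ^ 2 = α ^ 2 / 4 by ring]

/-- The left side is the integral of `f'(σ - β) - f'(σ)`, and slopes are replaced by forward
quotients at a cost of order `K * η`. The primitive of the gap that appears is the input of Hardy's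
inequality. -/
theorem IsSmall.abs_increment_sub_le (hf : IsSmall c K f) {η s σ : ℝ} (hη : 0 < η)
    (hσ : σ ∈ Icc s (s + η)) (α : ℝ) :
    |f σ - f (σ - α) - α * deriv f σ| ≤ |∫ β in (0)..α, quotGap f η s β| + 2 * K * η * |α| := by
  have hc := hf.continuous_quotGap η s
  have hc1 := hf.continuous_deriv
  have e1 : f σ - f (σ - α) - α * deriv f σ
      = ∫ β in (0)..α, (deriv f (σ - β) - deriv f σ) := by
    rw [intervalIntegral.integral_sub (Continuous.intervalIntegrable (by fun_prop) _ _)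
      intervalIntegrable_const, intervalIntegral.integral_comp_sub_left (deriv f),
      intervalIntegral.integral_deriv_eq_sub (fun x _ => (hf.hasDerivAt x).differentiableAt)
      (hc1.intervalIntegrable _ _)]
    simp
  have e2 : (∫ β in (0)..α, (quotGap f η s β + 2 * K * η))
      = (∫ β in (0)..α, quotGap f η s β) + 2 * K * η * α := by
    rw [intervalIntegral.integral_add (hc.intervalIntegrable _ _) intervalIntegrable_const]
    simp
    ring
  rw [e1]
  have h := intervalIntegral.norm_integral_le_abs_of_norm_le (a := 0) (b := α)
    (f := fun β => deriv f (σ - β) - deriv f σ) (g := fun β => quotGap f η s β + 2 * K * η)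
    (μ := volume) (.of_forall fun β => hf.abs_slope_sub_le hη hσ β)
    ((hc.add continuous_const).intervalIntegrable _ _)
  rw [e2, Real.norm_eq_abs] at h
  refine h.trans ((abs_add_le _ _).trans ?_)
  rw [abs_mul, abs_of_nonneg (show 0 ≤ 2 * K * η from by have := hf.nonneg'; positivity)]

/-- The slope and the difference quotient are close. -/
theorem IsSmall.abs_slope_sub_diffQuot_le (hf : IsSmall c K f) {η s σ α : ℝ} (hη : 0 < η)
    (hσ : σ ∈ Icc s (s + η)) (h : |α| ≤ Real.pi) (h0 : α ≠ 0) :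
    |deriv f (σ - α) - diffQuot f σ α| / |chord α|
      ≤ 2 * (quotGap f η s α / chord α ^ 2) + 12 * K * η * |α|⁻¹
        + 4 * (|∫ β in (0)..α, quotGap f η s β| / α ^ 2) + 2 * c := by
  have hS := chord_ne_zero h h0
  have hSp := abs_pos.2 hS
  have hap := abs_pos.2 h0
  have h1 := hf.abs_slope_sub_le hη hσ α
  have h2 := hf.abs_increment_sub_le hη hσ α
  have h3 := hf.abs_deriv_le σ
  have h4 := abs_sub_chord_le (α := α)
  have h5 := le_abs_chord h
  have h6 := abs_chord_le_two α
  have hK := hf.nonneg'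
  have hc := hf.nonneg
  have hd := quotGap_nonneg f η s α
  set d := quotGap f η s α
  set Ψ := |∫ β in (0)..α, quotGap f η s β|
  have hΨ : 0 ≤ Ψ := abs_nonneg _
  -- Replacing `α` by the chord costs `c * α ^ 2 / 2`; divided by the squared chord this is the
  -- bounded term `2 * c`.
  have e1 : |deriv f σ - diffQuot f σ α| * |chord α| ≤ Ψ + 2 * K * η * |α| + c * (α ^ 2 / 2) := by
    rw [← abs_mul, sub_mul, diffQuot, div_mul_cancel₀ _ hS]
    calc |deriv f σ * chord α - (f σ - f (σ - α))|
        = |(f σ - f (σ - α) - α * deriv f σ) + deriv f σ * (α - chord α)| := by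
          rw [← abs_neg]; ring_nf
      _ ≤ _ := abs_add_le _ _
      _ ≤ _ := by
          rw [abs_mul]
          exact add_le_add h2 (mul_le_mul h3 h4 (abs_nonneg _) hc)
  have e2 : |deriv f (σ - α) - diffQuot f σ α|
      ≤ d + 2 * K * η + (Ψ + 2 * K * η * |α| + c * (α ^ 2 / 2)) / |chord α| := by
    rw [← le_div_iff₀ hSp] at e1
    calc _ = |(deriv f (σ - α) - deriv f σ) + (deriv f σ - diffQuot f σ α)| := by ring_nf
      _ ≤ _ := (abs_add_le _ _).trans (add_le_add h1 e1)
  have hS2 : chord α ^ 2 = |chord α| ^ 2 := (sq_abs _).symm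
  have ha2 : α ^ 2 = |α| ^ 2 := (sq_abs _).symm
  have q1 : d / |chord α| ≤ 2 * (d / chord α ^ 2) := by
    rw [hS2, div_le_iff₀ hSp]
    have : 2 * (d / |chord α| ^ 2) * |chord α| = d * (2 / |chord α|) := by field_simp
    rw [this]
    exact le_mul_of_one_le_right hd ((one_le_div hSp).2 h6)
  have q2 : |chord α|⁻¹ ≤ 2 * |α|⁻¹ := by
    rw [← div_eq_mul_inv, inv_le_comm₀ hSp (by positivity), inv_div]
    linarith
  have q3 : (chord α ^ 2)⁻¹ ≤ 4 * (α ^ 2)⁻¹ := by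
    rw [hS2, ha2, ← inv_pow, ← inv_pow]
    calc |chord α|⁻¹ ^ 2 ≤ (2 * |α|⁻¹) ^ 2 := pow_le_pow_left₀ (by positivity) q2 2
      _ = _ := by ring
  have hKη : 0 ≤ K * η := by positivity
  calc |deriv f (σ - α) - diffQuot f σ α| / |chord α|
      ≤ (d + 2 * K * η + (Ψ + 2 * K * η * |α| + c * (α ^ 2 / 2)) / |chord α|) / |chord α| :=
        div_le_div_of_nonneg_right e2 hSp.le
    _ = d / |chord α| + 2 * (K * η) * |chord α|⁻¹
        + (Ψ + 2 * K * η * |α| + c * (α ^ 2 / 2)) * (chord α ^ 2)⁻¹ := by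
        rw [hS2]; field_simp
    _ ≤ 2 * (d / chord α ^ 2) + 2 * (K * η) * (2 * |α|⁻¹)
        + (Ψ + 2 * K * η * |α| + c * (α ^ 2 / 2)) * (4 * (α ^ 2)⁻¹) := by
        have p1 : 0 ≤ Ψ + 2 * K * η * |α| + c * (α ^ 2 / 2) := by positivity
        gcongr
    _ = _ := by
        rw [ha2]; field_simp; ring

end slope

/-! ### The equation for the slope at a maximum of the finite difference -/

section slope

variable {c K : ℝ} {f : ℝ → ℝ}

/-- The kernel of the linear part of the equation for the slope near `s`. -/
def frozenKernel (f : ℝ → ℝ) (s α : ℝ) : ℝ :=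
  (1 + dissCoef (kerParam f s α, deriv f (s - α), deriv f s)) / chord α ^ 2

/-- The weight of the boundary term in the equation for the slope near `s`. -/
def frozenBoundary (f : ℝ → ℝ) (s α : ℝ) : ℝ :=
  slopeQuot (kerParam f s α, deriv f (s - α), deriv f s) / chord α

theorem IsSmall.continuousAt_slopeParam (hf : IsSmall c K f) (s : ℝ) {α : ℝ} (h : chord α ≠ 0) :
    ContinuousAt (fun β => (kerParam f s β, deriv f (s - β), deriv f s)) α := by
  have := hf.continuous_deriv
  exact (hf.continuousAt_kerParam s h).prodMk (by fun_prop)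

theorem IsSmall.continuousAt_frozenKernel (hf : IsSmall c K f) (hc : c ≤ 1 / 8) (s : ℝ) {α : ℝ}
    (h : |α| ≤ Real.pi) (h0 : α ≠ 0) : ContinuousAt (frozenKernel f s) α := by
  have hS := chord_ne_zero h h0
  have h1 : ContinuousAt
      (fun β => dissCoef (kerParam f s β, deriv f (s - β), deriv f s)) α :=
    ContinuousAt.comp (f := fun β => (kerParam f s β, deriv f (s - β), deriv f s))
      (contDiffAt_dissCoef (hf.mem_slopeBox hc h s (s - α) s)).continuousAt
      (hf.continuousAt_slopeParam s hS)
  exact (continuousAt_const.add h1).div (contDiff_chord.continuous.continuousAt.pow 2)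
    (pow_ne_zero 2 hS)

theorem IsSmall.continuousAt_slopeKernel (hf : IsSmall c K f) (hc : c ≤ 1 / 8) (s : ℝ) {α : ℝ}
    (h : |α| ≤ Real.pi) (h0 : α ≠ 0) : ContinuousAt (slopeKernel f s) α := by
  have hS := chord_ne_zero h h0
  have hB := (kerDen_pos (hf.kerParam_mem hc h s)).ne'
  have h1 := hf.continuousAt_frozenKernel hc s h h0
  have hw : ContinuousAt (fun β => deriv f (s - β)) α := by
    have := hf.continuous_deriv; fun_prop
  have hg {g : ℝ × ℝ × ℝ → ℝ} (h5 : ContDiffAt ℝ 5 g (kerParam f s α)) :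
      ContinuousAt (fun β => fderiv ℝ g (kerParam f s β) dirRad) α :=
    ContinuousAt.comp (g := fun p => fderiv ℝ g p dirRad) (f := kerParam f s)
      (contDiffAt_fderiv_apply h5 dirRad).continuousAt (hf.continuousAt_kerParam s hS)
  have h2 := (((hg (contDiffAt_coefQuad hB)).mul (hw.pow 2)).add
    ((hg (contDiffAt_coefLin hB)).mul hw)).add (hg (contDiffAt_coefConst hB))
  have h3 := ((hw.sub (continuousAt_const (y := deriv f s))).mul h1).add
    ((continuousAt_const (y := deriv f s)).mul
      (h2.div contDiff_chord.continuous.continuousAt hS))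
  refine h3.congr (.of_forall fun β => ?_)
  simp only [slopeKernel, frozenKernel, nonlinDir, Pi.add_apply, Pi.mul_apply, Pi.sub_apply,
    Pi.div_apply, Pi.pow_apply]
  ring

/-- The price of freezing the coefficients at `s`; the angle is not moved. -/
theorem IsSmall.param_variation (hf : IsSmall c K f) (hc : c ≤ 1 / 8) {η s σ α : ℝ}
    (hσ : σ ∈ Icc s (s + η)) (h : |α| ≤ Real.pi) (h0 : α ≠ 0) :
    |diffQuot f σ α - diffQuot f s α| + |(1 + f σ) - (1 + f s)|
      + |deriv f (σ - α) - deriv f (s - α)| + |deriv f σ - deriv f s| ≤ 4 * (1 + K) * η := by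
  have h1 : |σ - s| ≤ η := by rw [abs_le]; constructor <;> linarith [hσ.1, hσ.2]
  have hK := hf.nonneg'
  have a1 := hf.abs_diffQuot_sub_le h h0 σ s
  have a2 := hf.abs_sub_le σ s
  have a3 := hf.abs_deriv_sub_le (σ - α) (s - α)
  have a4 := hf.abs_deriv_sub_le σ s
  rw [sub_sub_sub_cancel_right] at a3
  rw [add_sub_add_left_eq_sub]
  nlinarith [abs_nonneg (σ - s), mul_le_mul_of_nonneg_left h1 hK]

/-- There are two errors. Freezing `dissCoef` at `s` costs `η` times the
integrable-up-to-a-logarithm weight `|α|⁻¹`. The null term, multiplied by the slope, is bounded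
through `w - θ` by the gap and its primitive, with the small factor `c ^ 2` that the dissipation can
absorb. -/
theorem exists_slopeKernel_sub_bound : ∃ C : ℝ, 0 ≤ C ∧ ∀ (c K : ℝ) (f : ℝ → ℝ),
    IsSmall c K f → c ≤ 1 / 8 → ∀ η s σ α : ℝ, 0 < η → σ ∈ Icc s (s + η) →
      |α| ≤ Real.pi → α ≠ 0 →
      |slopeKernel f σ α - frozenKernel f s α * (deriv f (σ - α) - deriv f σ)|
        ≤ C * (1 + K) ^ 2 * η * |α|⁻¹ + C * (c ^ 2 * |fwdQuot f η s| + K * η)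
          + C * c ^ 2 * (quotGap f η s α / chord α ^ 2)
          + C * c ^ 2 * (|∫ β in (0)..α, quotGap f η s β| / α ^ 2) := by
  obtain ⟨L, hL, hdiss⟩ := exists_dissCoef_lipschitz
  obtain ⟨C, hC, hrad⟩ := exists_nonlinDir_dirRad_bound
  refine ⟨16 * L + 48 * C, by positivity, fun c K f hf hc η s σ α hη hσ h h0 => ?_⟩
  have hS := chord_ne_zero h h0
  have hSp := abs_pos.2 hS
  have hap := abs_pos.2 h0
  have hK := hf.nonneg'
  have hc0 := hf.nonneg
  set w := deriv f (σ - α) with hw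
  set m := deriv f σ with hm
  set θ := diffQuot f σ α with hθ
  set d := quotGap f η s α
  set Ψ := |∫ β in (0)..α, quotGap f η s β|
  set G := |fwdQuot f η s|
  have hd : 0 ≤ d := quotGap_nonneg f η s α
  have hΨ : 0 ≤ Ψ := abs_nonneg _
  have hG : 0 ≤ G := abs_nonneg _
  have e1 : slopeKernel f σ α - frozenKernel f s α * (w - m)
      = (w - m) / chord α ^ 2 * (dissCoef (kerParam f σ α, w, m)
          - dissCoef (kerParam f s α, deriv f (s - α), deriv f s))
        + m * (nonlinDir dirRad (kerParam f σ α) w / chord α) := by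
    rw [slopeKernel, frozenKernel]; ring
  have b1 : |dissCoef (kerParam f σ α, w, m)
      - dissCoef (kerParam f s α, deriv f (s - α), deriv f s)| ≤ L * (4 * (1 + K) * η) :=
    (hdiss _ _ _ _ _ _ _ _ _ (hf.mem_slopeBox hc h σ (σ - α) σ)
      (hf.mem_slopeBox hc h s (s - α) s)).trans
      (mul_le_mul_of_nonneg_left (hf.param_variation hc hσ h h0) hL)
  have b2 : |w - m| ≤ K * |α| := by
    have := hf.abs_deriv_sub_le (σ - α) σ
    rwa [sub_sub_cancel_left, abs_neg] at this
  have hSa := le_abs_chord h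
  have hS2 : chord α ^ 2 = |chord α| ^ 2 := (sq_abs _).symm
  have b3 : |w - m| / chord α ^ 2 ≤ 4 * K * |α|⁻¹ := by
    rw [hS2, div_le_iff₀ (by positivity)]
    calc |w - m| ≤ K * |α| := b2
      _ = K * |α|⁻¹ * |α| ^ 2 := by field_simp
      _ ≤ K * |α|⁻¹ * (2 * |chord α|) ^ 2 := by gcongr
      _ = _ := by ring
  have t1 : |(w - m) / chord α ^ 2 * (dissCoef (kerParam f σ α, w, m)
      - dissCoef (kerParam f s α, deriv f (s - α), deriv f s))|
      ≤ 16 * L * (1 + K) ^ 2 * η * |α|⁻¹ := by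
    rw [abs_mul, abs_div, abs_of_nonneg (sq_nonneg (chord α))]
    refine (mul_le_mul b3 b1 (abs_nonneg _) (by positivity)).trans ?_
    have : 0 ≤ L * (1 + K) * η * |α|⁻¹ := by positivity
    nlinarith only [this]
  have hwb := hf.abs_deriv_le (σ - α)
  have hθb := hf.abs_diffQuot_le h σ
  have b4 : |nonlinDir dirRad (kerParam f σ α) w| / |chord α|
      ≤ C * (8 * c ^ 2 + 4 * c * (|w - θ| / |chord α|)) := by
    rw [div_le_iff₀ hSp]
    refine (hrad α θ (1 + f σ) w (hf.kerParam_mem hc h σ)).trans ?_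
    rw [mul_assoc]
    refine mul_le_mul_of_nonneg_left ?_ hC
    have hθ2 : θ ^ 2 ≤ 4 * c ^ 2 := by
      rw [← sq_abs]
      calc |θ| ^ 2 ≤ (2 * c) ^ 2 := pow_le_pow_left₀ (abs_nonneg _) hθb 2
        _ = _ := by ring
    have p1 : θ ^ 2 * |α| ≤ 8 * c ^ 2 * |chord α| := by
      calc θ ^ 2 * |α| ≤ 4 * c ^ 2 * (2 * |chord α|) :=
            mul_le_mul hθ2 hSa (abs_nonneg _) (by positivity)
        _ = _ := by ring
    have p2 : |w - θ| * (|w| + |θ|) + |w - θ| * θ ^ 2 ≤ 4 * c * |w - θ| := by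
      rw [← mul_add, mul_comm]
      refine mul_le_mul_of_nonneg_right ?_ (abs_nonneg _)
      nlinarith only [hwb, hθb, hθ2, hc, hc0]
    have p3 : |w - θ| / |chord α| * |chord α| = |w - θ| := div_mul_cancel₀ _ hSp.ne'
    calc _ = θ ^ 2 * |α| + (|w - θ| * (|w| + |θ|) + |w - θ| * θ ^ 2) := by ring
      _ ≤ 8 * c ^ 2 * |chord α| + 4 * c * |w - θ| := add_le_add p1 p2
      _ = _ := by rw [add_mul, mul_assoc (4 * c), p3]
  have b5 := hf.abs_slope_sub_diffQuot_le hη hσ h h0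
  have hm1 : |m| ≤ c := hf.abs_deriv_le σ
  -- Two bounds of `m` are needed: this one for the constant part, which has to be proportional to
  -- the maximum `G`, and `|m| ≤ c` for the parts that already contain the gap.
  have hm2 : |m| ≤ G + K * η := by
    have h1 := hf.abs_deriv_sub_fwdQuot_le hη hσ
    have h2 := abs_sub_abs_le_abs_sub (deriv f σ) (fwdQuot f η s)
    linarith
  set X := d / chord α ^ 2
  set Y := Ψ / α ^ 2
  have hX : 0 ≤ X := by positivity
  have hY : 0 ≤ Y := by positivity
  have hI : 0 ≤ K * η * |α|⁻¹ := by positivity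
  have t2 : |m * (nonlinDir dirRad (kerParam f σ α) w / chord α)|
      ≤ 16 * C * (c ^ 2 * G + K * η) + C * (8 * c ^ 2 * X + 48 * (K * η * |α|⁻¹)
        + 16 * c ^ 2 * Y) := by
    rw [abs_mul, abs_div]
    have hm0 := abs_nonneg m
    calc |m| * (|nonlinDir dirRad (kerParam f σ α) w| / |chord α|)
        ≤ |m| * (C * (8 * c ^ 2 + 4 * c * (2 * X + 12 * K * η * |α|⁻¹ + 4 * Y + 2 * c))) := by
          refine mul_le_mul_of_nonneg_left (b4.trans ?_) hm0
          refine mul_le_mul_of_nonneg_left ?_ hC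
          have := mul_le_mul_of_nonneg_left b5 (show 0 ≤ 4 * c by positivity)
          linarith
      _ = C * (16 * c ^ 2 * |m| + |m| * (4 * c * (2 * X + 12 * (K * η * |α|⁻¹) + 4 * Y))) := by
          ring
      _ ≤ C * (16 * c ^ 2 * (G + K * η)
            + c * (4 * c * (2 * X + 12 * (K * η * |α|⁻¹) + 4 * Y))) := by gcongr
      _ ≤ _ := by
          have q1 : c ^ 2 ≤ 1 := by nlinarith only [hc, hc0]
          have q2 : 0 ≤ C * (K * η) := by positivity
          have q3 : 0 ≤ C * (K * η * |α|⁻¹) := by positivity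
          have q4 := mul_le_mul_of_nonneg_right q1 q2
          have q5 := mul_le_mul_of_nonneg_right q1 q3
          linarith only [q2, q3, q4, q5]
  rw [e1]
  refine (abs_add_le _ _).trans ((add_le_add t1 t2).trans ?_)
  have r1 : K * η * |α|⁻¹ ≤ (1 + K) ^ 2 * η * |α|⁻¹ := by
    have : K ≤ (1 + K) ^ 2 := by nlinarith only [hK]
    gcongr
  have r2 : 0 ≤ L * (c ^ 2 * G + K * η) := by positivity
  have r3 : 0 ≤ C * (c ^ 2 * G + K * η) := by positivity
  have r4 : 0 ≤ L * (c ^ 2 * X) := by positivity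
  have r5 : 0 ≤ C * (c ^ 2 * X) := by positivity
  have r6 : 0 ≤ L * (c ^ 2 * Y) := by positivity
  have r7 : 0 ≤ C * (c ^ 2 * Y) := by positivity
  have r8 := mul_le_mul_of_nonneg_left r1 hC
  linarith only [r2, r3, r4, r5, r6, r7, r8]

/-- The dissipation of the finite difference. -/
def dissipation (f : ℝ → ℝ) (ε η s : ℝ) : ℝ :=
  ∫ α in cutSet ε, quotGap f η s α / chord α ^ 2

theorem IsSmall.integrableOn_dissipation (hf : IsSmall c K f) {ε : ℝ} (hε : 0 < ε) (η s : ℝ) :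
    IntegrableOn (fun α => quotGap f η s α / chord α ^ 2) (cutSet ε) :=
  integrableOn_cutSet_of_continuousAt hε fun _ h h0 =>
    (hf.continuous_quotGap η s).continuousAt.div (contDiff_chord.continuous.continuousAt.pow 2)
      (pow_ne_zero 2 (chord_ne_zero h h0))

theorem IsSmall.integral_quotGap_le (hf : IsSmall c K f) {ε η : ℝ} (hε : 0 < ε) (hη : 0 < η)
    (s : ℝ) : ∫ β in (-ε)..ε, quotGap f η s β ≤ 2 * K * ε ^ 2 := by
  have h : ∫ β in (-ε)..ε, quotGap f η s β ≤ ∫ _ in (-ε)..ε, K * ε := by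
    refine intervalIntegral.integral_mono_on (by linarith)
      ((hf.continuous_quotGap η s).intervalIntegrable _ _) intervalIntegrable_const fun α hα => ?_
    refine (hf.quotGap_le hη s α).trans (mul_le_mul_of_nonneg_left ?_ hf.nonneg')
    exact abs_le.2 hα
  refine h.trans_eq ?_
  simp
  ring

theorem IsSmall.integral_hardy_le (hf : IsSmall c K f) {ε η : ℝ} (hε : 0 < ε)
    (hε' : ε ≤ Real.pi) (hη : 0 < η) (s : ℝ) :
    ∫ α in cutSet ε, |∫ β in (0)..α, quotGap f η s β| / α ^ 2
      ≤ 2 * K * ε + 4 * dissipation f ε η s := by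
  have hd := hf.continuous_quotGap η s
  have h1 := hardy_cutSet hd (quotGap_nonneg f η s) hε hε'
  have h2 := hf.integral_quotGap_le hε hη s
  have h3 : ∫ α in cutSet ε, quotGap f η s α / |α| ≤ 4 * dissipation f ε η s := by
    rw [dissipation, ← integral_const_mul]
    refine setIntegral_mono_on (integrableOn_cutSet_of_continuousAt hε fun α _ h =>
      hd.continuousAt.div (by fun_prop) (abs_ne_zero.2 h))
      ((hf.integrableOn_dissipation hε η s).const_mul 4) (measurableSet_cutSet ε) fun α hα => ?_
    obtain ⟨-, ha⟩ := abs_of_mem_cutSet hε hα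
    have h0 := ne_zero_of_mem_cutSet hε hα
    have hap := abs_pos.2 h0
    have hSp := abs_pos.2 (chord_ne_zero ha h0)
    have hle := abs_chord_le α
    rw [mul_div_assoc', ← sq_abs (chord α), div_le_div_iff₀ hap (by positivity)]
    have : |chord α| ^ 2 ≤ 4 * |α| := by nlinarith [Real.pi_le_four]
    nlinarith [quotGap_nonneg f η s α]
  have h4 : (∫ β in (-ε)..ε, quotGap f η s β) / ε ≤ 2 * K * ε := by
    rw [div_le_iff₀ hε]
    linarith
  linarith

/-- The weight `|α|⁻¹` integrates to the logarithm, and Hardy's inequality converts the primitive of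
the gap into dissipation. -/
theorem exists_integral_slopeKernel_sub_bound : ∃ C : ℝ, 0 ≤ C ∧ ∀ (c K : ℝ) (f : ℝ → ℝ),
    IsSmall c K f → c ≤ 1 / 8 → ∀ ε η s σ : ℝ, 0 < ε → ε ≤ Real.pi → 0 < η →
      σ ∈ Icc s (s + η) →
      |∫ α in cutSet ε,
          (slopeKernel f σ α - frozenKernel f s α * (deriv f (σ - α) - deriv f σ))|
        ≤ C * (1 + K) ^ 2 * η * Real.log (Real.pi / ε)
          + C * (c ^ 2 * |fwdQuot f η s| + K * η + K * ε) + C * c ^ 2 * dissipation f ε η s := by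
  obtain ⟨C, hC, h⟩ := exists_slopeKernel_sub_bound
  refine ⟨8 * C, by positivity, fun c K f hf hc ε η s σ hε hε' hη hσ => ?_⟩
  have hK := hf.nonneg'
  have hc0 := hf.nonneg
  set A₁ := C * (1 + K) ^ 2 * η with hA₁
  set A₂ := C * (c ^ 2 * |fwdQuot f η s| + K * η) with hA₂
  set A₃ := C * c ^ 2 with hA₃
  have hd := hf.continuous_quotGap η s
  have i1 : IntegrableOn (fun α : ℝ => A₁ * |α|⁻¹) (cutSet ε) :=
    (integrableOn_cutSet_of_continuousAt hε fun α _ h0 =>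
      continuous_abs.continuousAt.inv₀ (abs_ne_zero.2 h0)).const_mul A₁
  have i2 : IntegrableOn (fun _ : ℝ => A₂ * 1) (cutSet ε) :=
    integrableOn_cutSet hε' intervalIntegrable_const intervalIntegrable_const
  have i3 : IntegrableOn (fun α => A₃ * (quotGap f η s α / chord α ^ 2)) (cutSet ε) :=
    (hf.integrableOn_dissipation hε η s).const_mul A₃
  have i4 : IntegrableOn (fun α => A₃ * (|∫ β in (0)..α, quotGap f η s β| / α ^ 2)) (cutSet ε) :=
    (integrableOn_cutSet_of_continuousAt hε fun α _ h0 =>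
      (continuous_primitive_of_continuous hd).abs.continuousAt.div (by fun_prop)
        (pow_ne_zero 2 h0)).const_mul A₃
  have h1 := norm_integral_le_of_norm_le (μ := volume.restrict (cutSet ε))
    (f := fun α => slopeKernel f σ α - frozenKernel f s α * (deriv f (σ - α) - deriv f σ))
    (((i1.add i2).add i3).add i4)
    (ae_restrict_of_forall_mem (measurableSet_cutSet ε) fun α hα => by
      have := h c K f hf hc η s σ α hη hσ (abs_of_mem_cutSet hε hα).2
        (ne_zero_of_mem_cutSet hε hα)
      simpa using this)
  have e : ∫ α in cutSet ε, (((fun α : ℝ => A₁ * |α|⁻¹) + (fun _ : ℝ => A₂ * 1)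
      + (fun α => A₃ * (quotGap f η s α / chord α ^ 2)))
      + fun α => A₃ * (|∫ β in (0)..α, quotGap f η s β| / α ^ 2)) α
      = A₁ * (2 * Real.log (Real.pi / ε)) + A₂ * (∫ _ in cutSet ε, (1 : ℝ))
        + A₃ * dissipation f ε η s
        + A₃ * ∫ α in cutSet ε, |∫ β in (0)..α, quotGap f η s β| / α ^ 2 := by
    rw [integral_add' ((i1.add i2).add i3) i4, integral_add' (i1.add i2) i3, integral_add' i1 i2,
      integral_const_mul, integral_const_mul, integral_const_mul, integral_const_mul,
      setIntegral_cutSet_abs_inv hε hε', dissipation]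
  rw [e] at h1
  refine h1.trans ?_
  have q1 := volume_real_cutSet_le hε hε'
  have q2 := hf.integral_hardy_le hε hε' hη s
  have q3 : 0 ≤ A₁ * Real.log (Real.pi / ε) :=
    mul_nonneg (by positivity) (Real.log_nonneg ((one_le_div hε).2 hε'))
  have q4 : 0 ≤ A₂ := by positivity
  have q5 : 0 ≤ A₃ := by positivity
  have q6 := mul_le_mul_of_nonneg_left (q1.trans (show 2 * Real.pi ≤ 8 by
    linarith [Real.pi_le_four])) q4
  have q7 := mul_le_mul_of_nonneg_left q2 q5
  have q8 : A₃ * (2 * K * ε) ≤ 8 * C * (K * ε) := by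
    have : c ^ 2 ≤ 1 := by nlinarith
    have : 0 ≤ C * (K * ε) := by positivity
    rw [hA₃]
    nlinarith
  have q9 : 0 ≤ A₃ * dissipation f ε η s :=
    mul_nonneg q5 (setIntegral_nonneg (measurableSet_cutSet ε) fun α _ =>
      div_nonneg (quotGap_nonneg f η s α) (sq_nonneg _))
  have e1 : 8 * C * (1 + K) ^ 2 * η * Real.log (Real.pi / ε)
      = 8 * (A₁ * Real.log (Real.pi / ε)) := by rw [hA₁]; ring
  have e2 : 8 * C * (c ^ 2 * |fwdQuot f η s| + K * η + K * ε) = 8 * A₂ + 8 * C * (K * ε) := by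
    rw [hA₂]; ring
  have e3 : 8 * C * c ^ 2 * dissipation f ε η s = 8 * (A₃ * dissipation f ε η s) := by
    rw [hA₃]; ring
  rw [e1, e2, e3]
  linarith

/-- The truncated right hand side, minus its linear part near `s`. -/
def corrected (f : ℝ → ℝ) (ε s σ : ℝ) : ℝ :=
  (∫ α in cutSet ε, pvKernel f σ α)
    - (∫ α in cutSet ε, frozenKernel f s α * (f (σ - α) - f σ))
    - (frozenBoundary f s ε * (f (σ - ε) - f σ) - frozenBoundary f s (-ε) * (f (σ - -ε) - f σ))

theorem IsSmall.integral_pvKernelDeriv (hf : IsSmall c K f) (hc : c ≤ 1 / 8) {ε : ℝ}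
    (hε : 0 < ε) (hε' : ε ≤ Real.pi) (σ : ℝ) :
    ∫ α in cutSet ε, pvKernelDeriv f σ α
      = (∫ α in cutSet ε, slopeKernel f σ α) + slopeBoundary f σ ε - slopeBoundary f σ (-ε) := by
  have i1 : IntegrableOn (slopeKernel f σ) (cutSet ε) :=
    integrableOn_cutSet_of_continuousAt hε fun α h h0 => hf.continuousAt_slopeKernel hc σ h h0
  have i2 : IntegrableOn (pvKernelDeriv f σ) (cutSet ε) :=
    integrableOn_cutSet_of_continuousAt hε fun α h h0 =>
      ContinuousAt.comp (f := fun β => (σ, β)) (g := Function.uncurry (pvKernelDeriv f))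
        (hf.continuousAt_pvKernelDeriv (z := (σ, α)) hc h h0) (by fun_prop)
  have h1 := setIntegral_cutSet_of_hasDerivAt hε hε' (fun α hα =>
    hf.hasDerivAt_slopeBoundary hc σ (abs_of_mem_cutSet hε hα).2 (ne_zero_of_mem_cutSet hε hα))
    (i1.sub i2)
  rw [integral_sub i1 i2, hf.slopeBoundary_neg_pi] at h1
  linarith

theorem IsSmall.hasDerivAt_corrected (hf : IsSmall c K f) (hc : c ≤ 1 / 8) {ε : ℝ}
    (hε : 0 < ε) (hε' : ε ≤ Real.pi) (s σ : ℝ) :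
    HasDerivAt (corrected f ε s)
      ((∫ α in cutSet ε,
          (slopeKernel f σ α - frozenKernel f s α * (deriv f (σ - α) - deriv f σ)))
        + (slopeBoundary f σ ε - frozenBoundary f s ε * (deriv f (σ - ε) - deriv f σ))
        - (slopeBoundary f σ (-ε)
          - frozenBoundary f s (-ε) * (deriv f (σ - -ε) - deriv f σ))) σ := by
  have hfc := hf.continuous
  have hfc' := hf.continuous_deriv
  have hk : ContinuousOn (frozenKernel f s) (cutSet ε) := fun α hα =>
    (hf.continuousAt_frozenKernel hc s (abs_of_mem_cutSet hε hα).2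
      (ne_zero_of_mem_cutSet hε hα)).continuousWithinAt
  have hd (α : ℝ) (τ : ℝ) : HasDerivAt (fun τ => f (τ - α) - f τ)
      (deriv f (τ - α) - deriv f τ) τ :=
    ((hf.hasDerivAt (τ - α)).comp_sub_const τ α).sub (hf.hasDerivAt τ)
  have d1 := hf.hasDerivAt_setIntegral_pvKernel hc σ hε
  have d2 : HasDerivAt (fun τ => ∫ α in cutSet ε, frozenKernel f s α * (f (τ - α) - f τ))
      (∫ α in cutSet ε, frozenKernel f s α * (deriv f (σ - α) - deriv f σ)) σ := by
    refine hasDerivAt_setIntegral_of_continuousOn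
      (F := fun τ α => frozenKernel f s α * (f (τ - α) - f τ))
      (F' := fun τ α => frozenKernel f s α * (deriv f (τ - α) - deriv f τ)) (isCompact_cutSet ε)
      (fun τ => hk.mul (by fun_prop)) ?_ (fun τ α _ => (hd α τ).const_mul _) σ
    exact (hk.comp continuousOn_snd fun z hz => hz.2).mul (by fun_prop)
  have i1 : IntegrableOn (slopeKernel f σ) (cutSet ε) :=
    integrableOn_cutSet_of_continuousAt hε fun α h h0 => hf.continuousAt_slopeKernel hc σ h h0
  have i2 : IntegrableOn (fun α => frozenKernel f s α * (deriv f (σ - α) - deriv f σ))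
      (cutSet ε) :=
    (hk.mul (by fun_prop)).integrableOn_compact (isCompact_cutSet ε)
  refine ((d1.sub d2).sub (((hd ε σ).const_mul _).sub ((hd (-ε) σ).const_mul _))).congr_deriv ?_
  rw [integral_sub i1 i2, hf.integral_pvKernelDeriv hc hε hε']
  ring

/-- The mean value inequality on `[s, s + η]`. The frozen linear part has been removed because it
must keep its sign: the maximum is one of the forward quotient, not of the slopes at the
intermediate points `σ`. -/
theorem exists_corrected_deriv_bound : ∃ C : ℝ, 0 ≤ C ∧ ∀ (c K : ℝ) (f : ℝ → ℝ),
    IsSmall c K f → c ≤ 1 / 8 → ∀ ε η s : ℝ, 0 < ε → ε ≤ Real.pi → 0 < η →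
      |corrected f ε s (s + η) - corrected f ε s s|
        ≤ (C * (1 + K) ^ 2 * η * (1 + Real.log (Real.pi / ε))
          + C * (c ^ 2 * |fwdQuot f η s| + K * η + K * ε)
          + C * c ^ 2 * dissipation f ε η s) * η := by
  obtain ⟨C, hC, h⟩ := exists_integral_slopeKernel_sub_bound
  obtain ⟨L, hL, hquot⟩ := exists_slopeQuot_lipschitz
  refine ⟨C + 16 * L, by positivity, fun c K f hf hc ε η s hε hε' hη => ?_⟩
  have hK := hf.nonneg'
  have hc0 := hf.nonneg
  have hbd : ∀ σ ∈ Icc s (s + η), ∀ α, |α| = ε →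
      |slopeBoundary f σ α - frozenBoundary f s α * (deriv f (σ - α) - deriv f σ)|
        ≤ 8 * L * (1 + K) ^ 2 * η := by
    intro σ hσ α hα
    have ha : |α| ≤ Real.pi := hα.trans_le hε'
    have h0 : α ≠ 0 := abs_pos.1 (hα ▸ hε)
    have hSp := abs_pos.2 (chord_ne_zero ha h0)
    have e : slopeBoundary f σ α - frozenBoundary f s α * (deriv f (σ - α) - deriv f σ)
        = (deriv f (σ - α) - deriv f σ) / chord α
          * (slopeQuot (kerParam f σ α, deriv f (σ - α), deriv f σ)
            - slopeQuot (kerParam f s α, deriv f (s - α), deriv f s)) := by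
      rw [slopeBoundary, frozenBoundary]; ring
    have b1 : |slopeQuot (kerParam f σ α, deriv f (σ - α), deriv f σ)
        - slopeQuot (kerParam f s α, deriv f (s - α), deriv f s)| ≤ L * (4 * (1 + K) * η) :=
      (hquot _ _ _ _ _ _ _ _ _ (hf.mem_slopeBox hc ha σ (σ - α) σ)
        (hf.mem_slopeBox hc ha s (s - α) s)).trans
        (mul_le_mul_of_nonneg_left (hf.param_variation hc hσ ha h0) hL)
    have b2 : |(deriv f (σ - α) - deriv f σ) / chord α| ≤ 2 * K := by
      rw [abs_div, div_le_iff₀ hSp]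
      have := hf.abs_deriv_sub_le (σ - α) σ
      rw [sub_sub_cancel_left, abs_neg] at this
      have h2 := le_abs_chord ha
      nlinarith
    rw [e, abs_mul]
    refine (mul_le_mul b2 b1 (abs_nonneg _) (by positivity)).trans ?_
    have : 0 ≤ L * (1 + K) * η := by positivity
    nlinarith
  have hlog : 0 ≤ Real.log (Real.pi / ε) := Real.log_nonneg ((one_le_div hε).2 hε')
  have hdiss : 0 ≤ dissipation f ε η s :=
    setIntegral_nonneg (measurableSet_cutSet ε) fun α _ =>
      div_nonneg (quotGap_nonneg f η s α) (sq_nonneg _)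
  have hmain := Convex.norm_image_sub_le_of_norm_hasDerivWithin_le (f := corrected f ε s)
    (s := Icc s (s + η)) (x := s) (y := s + η)
    (C := (C + 16 * L) * (1 + K) ^ 2 * η * (1 + Real.log (Real.pi / ε))
          + (C + 16 * L) * (c ^ 2 * |fwdQuot f η s| + K * η + K * ε)
          + (C + 16 * L) * c ^ 2 * dissipation f ε η s)
    (fun σ _ => (hf.hasDerivAt_corrected hc hε hε' s σ).hasDerivWithinAt)
    (fun σ hσ => by
      have t1 := h c K f hf hc ε η s σ hε hε' hη hσ
      have t2 := hbd σ hσ ε (abs_of_pos hε)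
      have t3 := hbd σ hσ (-ε) (by rw [abs_neg, abs_of_pos hε])
      rw [Real.norm_eq_abs]
      refine (abs_sub _ _).trans ((add_le_add ((abs_add_le _ _).trans (add_le_add t1 t2))
        t3).trans ?_)
      have p1 : 0 ≤ L * ((1 + K) ^ 2 * η * Real.log (Real.pi / ε)) := by positivity
      have p2 : 0 ≤ L * (c ^ 2 * |fwdQuot f η s| + K * η + K * ε) := by positivity
      have p3 : 0 ≤ L * (c ^ 2 * dissipation f ε η s) := by positivity
      have p4 : 0 ≤ C * ((1 + K) ^ 2 * η) := by positivity
      nlinarith)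
    (convex_Icc _ _) ⟨le_rfl, by linarith⟩ ⟨by linarith, le_rfl⟩
  rwa [Real.norm_eq_abs, Real.norm_eq_abs, add_sub_cancel_left, abs_of_pos hη] at hmain

/-- Lower bound of the dissipation, which uses that the finite difference has mean zero. -/
theorem IsSmall.le_dissipation (hf : IsSmall c K f) {ε η s ς : ℝ} (hε : 0 < ε) (hε' : ε ≤ 1)
    (hη : 0 < η) (hς : ς = 1 ∨ ς = -1) (hmax : ∀ r, |fwdQuot f η r| ≤ ς * fwdQuot f η s) :
    3 / 2 * |fwdQuot f η s| - K * ε ≤ dissipation f ε η s := by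
  have hεπ : ε ≤ Real.pi := hε'.trans (by linarith [Real.pi_gt_three])
  have hd := hf.continuous_quotGap η s
  have hg := hf.continuous_fwdQuot η
  have hfc := hf.continuous
  have h1 : 1 / 4 * ∫ α in cutSet ε, quotGap f η s α ≤ dissipation f ε η s := by
    rw [dissipation, ← integral_const_mul]
    refine setIntegral_mono_on (hd.continuousOn.integrableOn_compact (isCompact_cutSet ε)
      |>.const_mul _) (hf.integrableOn_dissipation hε η s) (measurableSet_cutSet ε) fun α hα => ?_
    have hS := chord_ne_zero (abs_of_mem_cutSet hε hα).2 (ne_zero_of_mem_cutSet hε hα)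
    have hSp := abs_pos.2 hS
    have h2 := abs_chord_le_two α
    rw [← sq_abs (chord α), le_div_iff₀ (by positivity)]
    have : |chord α| ^ 2 ≤ 4 := by nlinarith
    nlinarith [quotGap_nonneg f η s α]
  have hsplit : ∫ α in cutSet ε, quotGap f η s α
      = (∫ α in (-Real.pi)..Real.pi, quotGap f η s α) - ∫ α in (-ε)..ε, quotGap f η s α := by
    rw [setIntegral_cutSet hε hεπ (hd.continuousOn.integrableOn_compact (isCompact_cutSet ε)),
      ← intervalIntegral.integral_add_adjacent_intervals (hd.intervalIntegrable (-Real.pi) (-ε))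
        (hd.intervalIntegrable (-ε) Real.pi),
      ← intervalIntegral.integral_add_adjacent_intervals (hd.intervalIntegrable (-ε) ε)
        (hd.intervalIntegrable ε Real.pi)]
    ring
  have hG : |fwdQuot f η s| = ς * fwdQuot f η s := by
    refine le_antisymm (hmax s) ?_
    exact abs_le_of_sign hς le_rfl
  have hfull : ∫ α in (-Real.pi)..Real.pi, quotGap f η s α = 2 * Real.pi * |fwdQuot f η s| := by
    have e1 : ∀ α, quotGap f η s α = ς * fwdQuot f η s - ς * fwdQuot f η (s - α) := by
      intro α
      have h2 : ς * fwdQuot f η (s - α) ≤ ς * fwdQuot f η s := abs_le_of_sign hς (hmax (s - α))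
      rw [quotGap]
      rcases hς with rfl | rfl
      · rw [abs_of_nonpos (by linarith)]; ring
      · rw [abs_of_nonneg (by linarith)]; ring
    have hper : Function.Periodic f (2 * Real.pi) := hf.periodic
    -- A difference quotient of a periodic function has mean zero, so the total gap is `2 * π` times
    -- the maximum. With `chord ^ 2 ≤ 4` and `π > 3` this yields the factor `3 / 2`.
    have e2 : ∫ α in (-Real.pi)..Real.pi, fwdQuot f η (s - α) = 0 := by
      have a1 : ∀ a, ∫ x in (a - Real.pi)..(a + Real.pi), f x
          = ∫ x in (-Real.pi)..Real.pi, f x := by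
        intro a
        have := hper.intervalIntegral_add_eq (a - Real.pi) (-Real.pi)
        rwa [show a - Real.pi + 2 * Real.pi = a + Real.pi by ring,
          show -Real.pi + 2 * Real.pi = Real.pi by ring] at this
      rw [intervalIntegral.integral_comp_sub_left (fwdQuot f η)]
      unfold fwdQuot
      rw [intervalIntegral.integral_div, intervalIntegral.integral_sub
        (Continuous.intervalIntegrable (by fun_prop) _ _) (hfc.intervalIntegrable _ _),
        intervalIntegral.integral_comp_add_right f, sub_neg_eq_add, a1,
        show s - Real.pi + η = (s + η) - Real.pi by ring,
        show s + Real.pi + η = (s + η) + Real.pi by ring, a1, sub_self, zero_div]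
    rw [intervalIntegral.integral_congr (fun α _ => e1 α), intervalIntegral.integral_sub
      intervalIntegrable_const (Continuous.intervalIntegrable (by fun_prop) _ _),
      intervalIntegral.integral_const_mul ς (fun α => fwdQuot f η (s - α)), e2, hG]
    simp
    ring
  have hin := hf.integral_quotGap_le hε hη s
  rw [hsplit, hfull] at h1
  have h3 := mul_le_mul_of_nonneg_right Real.pi_gt_three.le (abs_nonneg (fwdQuot f η s))
  have h4 : K * ε ^ 2 ≤ K * ε := by
    refine mul_le_mul_of_nonneg_left ?_ hf.nonneg'
    nlinarith
  nlinarith [mul_nonneg hf.nonneg' hε.le]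

/-- The derivative of the forward quotient vanishes at `s` and is Lipschitz with constant `2 * K /
η`. The gain of a second power of `ε` defeats the weight `C / ε` of the boundary terms. -/
theorem IsSmall.abs_fwdQuot_sub_le_of_max (hf : IsSmall c K f) {ε η s ς : ℝ}
    (hη : 0 < η) (hς : ς = 1 ∨ ς = -1) (hmax : ∀ r, |fwdQuot f η r| ≤ ς * fwdQuot f η s)
    {α : ℝ} (hα : |α| ≤ ε) :
    |fwdQuot f η (s - α) - fwdQuot f η s| ≤ 2 * K * ε ^ 2 / η := by
  have hK := hf.nonneg'
  have hε : 0 ≤ ε := (abs_nonneg _).trans hα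
  have hcrit : deriv f (s + η) - deriv f s = 0 := by
    have h1 : IsLocalMax (fun r => ς * fwdQuot f η r) s :=
      .of_forall fun r => abs_le_of_sign hς (hmax r)
    have h2 := h1.hasDerivAt_eq_zero ((hf.hasDerivAt_fwdQuot η s).const_mul ς)
    rcases hς with rfl | rfl
    · rw [one_mul, div_eq_zero_iff] at h2
      exact h2.resolve_right hη.ne'
    · rw [neg_one_mul, neg_eq_zero, div_eq_zero_iff] at h2
      exact h2.resolve_right hη.ne'
  have hsub : ∀ r ∈ uIcc s (s - α), |r - s| ≤ ε := fun r hr => by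
    have := abs_sub_left_of_mem_uIcc hr
    rw [sub_sub_cancel_left, abs_neg] at this
    exact this.trans hα
  have := Convex.norm_image_sub_le_of_norm_hasDerivWithin_le (f := fwdQuot f η)
    (s := uIcc s (s - α)) (C := 2 * K * ε / η) (x := s) (y := s - α)
    (fun r _ => (hf.hasDerivAt_fwdQuot η r).hasDerivWithinAt)
    (fun r hr => by
      rw [Real.norm_eq_abs, abs_div, abs_of_pos hη]
      refine div_le_div_of_nonneg_right ?_ hη.le
      have h1 := hf.abs_deriv_sub_le (r + η) (s + η)
      have h2 := hf.abs_deriv_sub_le r s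
      rw [add_sub_add_right_eq_sub] at h1
      have h3 := mul_le_mul_of_nonneg_left (hsub r hr) hK
      rw [abs_le] at h1 h2 ⊢
      constructor <;> linarith)
    (convex_uIcc _ _) left_mem_uIcc right_mem_uIcc
  rw [sub_sub_cancel_left, norm_neg, Real.norm_eq_abs, Real.norm_eq_abs] at this
  refine this.trans ?_
  rw [div_mul_eq_mul_div]
  refine div_le_div_of_nonneg_right ?_ hη.le
  have := mul_le_mul_of_nonneg_left hα (show 0 ≤ 2 * K * ε by positivity)
  linarith

end slope

/-! ### The frozen coefficients and the decay estimate. -/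

theorem exists_frozenBoundary_bound : ∃ C : ℝ, 0 ≤ C ∧ ∀ (c K : ℝ) (f : ℝ → ℝ),
    IsSmall c K f → c ≤ 1 / 8 → ∀ s α : ℝ, |α| ≤ Real.pi → α ≠ 0 →
      |frozenBoundary f s α| ≤ C / |α| := by
  obtain ⟨C, hC, h⟩ := exists_slopeQuot_bound
  refine ⟨2 * C, by positivity, fun c K f hf hc s α ha h0 => ?_⟩
  have hSp := abs_pos.2 (chord_ne_zero ha h0)
  have h1 := h _ (hf.mem_slopeBox hc ha s (s - α) s)
  have h2 := le_abs_chord ha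
  rw [frozenBoundary, abs_div, div_le_div_iff₀ hSp (abs_pos.2 h0)]
  nlinarith [abs_nonneg (slopeQuot (kerParam f s α, deriv f (s - α), deriv f s)), abs_nonneg α]

theorem exists_frozenKernel_lower : ∃ C : ℝ, 0 ≤ C ∧ ∀ (c K : ℝ) (f : ℝ → ℝ),
    IsSmall c K f → c ≤ 1 / 8 → ∀ s α : ℝ, |α| ≤ Real.pi →
      (1 - C * c) / chord α ^ 2 ≤ frozenKernel f s α := by
  obtain ⟨C, hC, h⟩ := exists_dissCoef_bound
  refine ⟨4 * C, by positivity, fun c K f hf hc s α ha => ?_⟩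
  have h1 := abs_le.1 (h α (diffQuot f s α) (1 + f s) _ _ (hf.mem_slopeBox hc ha s (s - α) s))
  have h2 := hf.abs_diffQuot_le ha s
  have h3 := hf.abs_deriv_le s
  have h4 := hf.abs_deriv_le (s - α)
  refine div_le_div_of_nonneg_right ?_ (sq_nonneg _)
  have h5 : C * (|diffQuot f s α| + |deriv f (s - α)| + |deriv f s|) ≤ C * (4 * c) :=
    mul_le_mul_of_nonneg_left (by linarith) hC
  have h6 := h1.1
  rw [kerParam]
  linarith

theorem log_pi_div_pow_le {τ : ℝ} (hτ : 0 < τ) :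
    1 + Real.log (Real.pi / τ ^ 8) ≤ 8 / τ := by
  have h1 := Real.log_le_sub_one_of_pos Real.pi_pos
  have h2 := Real.log_le_sub_one_of_pos (inv_pos.2 hτ)
  rw [Real.log_inv] at h2
  rw [Real.log_div Real.pi_pos.ne' (by positivity), Real.log_pow]
  push_cast
  have h3 : 8 / τ = 8 * τ⁻¹ := div_eq_mul_inv _ _
  linarith [Real.pi_le_four]

section slope

variable {c K : ℝ} {f : ℝ → ℝ}

/-- With coefficients frozen at `s`, the subtracted part of `corrected` is linear in `f`, so its
difference quotient acts on the forward quotient, where the maximum can be used. -/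
theorem IsSmall.integral_pvKernel_sub (hf : IsSmall c K f) (hc : c ≤ 1 / 8) {ε η : ℝ}
    (hε : 0 < ε) (hη : 0 < η) (s : ℝ) :
    ((∫ α in cutSet ε, pvKernel f (s + η) α) - ∫ α in cutSet ε, pvKernel f s α) / η
      = (corrected f ε s (s + η) - corrected f ε s s) / η
        + (∫ α in cutSet ε, frozenKernel f s α * (fwdQuot f η (s - α) - fwdQuot f η s))
        + (frozenBoundary f s ε * (fwdQuot f η (s - ε) - fwdQuot f η s)
          - frozenBoundary f s (-ε) * (fwdQuot f η (s - -ε) - fwdQuot f η s)) := by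
  have hfc := hf.continuous
  have hk : ContinuousOn (frozenKernel f s) (cutSet ε) := fun α hα =>
    (hf.continuousAt_frozenKernel hc s (abs_of_mem_cutSet hε hα).2
      (ne_zero_of_mem_cutSet hε hα)).continuousWithinAt
  have i (r : ℝ) : IntegrableOn (fun α => frozenKernel f s α * (f (r - α) - f r)) (cutSet ε) :=
    (hk.mul (by fun_prop)).integrableOn_compact (isCompact_cutSet ε)
  have e1 : ∀ α, fwdQuot f η (s - α) - fwdQuot f η s
      = ((f (s + η - α) - f (s + η)) - (f (s - α) - f s)) / η := by
    intro α
    rw [fwdQuot, fwdQuot, show s - α + η = s + η - α by ring]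
    ring
  have e2 : ∫ α in cutSet ε, frozenKernel f s α * (fwdQuot f η (s - α) - fwdQuot f η s)
      = ((∫ α in cutSet ε, frozenKernel f s α * (f (s + η - α) - f (s + η)))
        - ∫ α in cutSet ε, frozenKernel f s α * (f (s - α) - f s)) / η := by
    rw [← integral_sub (i (s + η)) (i s), ← integral_div]
    congr 1
    ext α
    rw [e1]
    ring
  rw [e2, e1, e1, corrected, corrected]
  field_simp
  ring

end slope

/-- The key estimate: at a maximum of the modulus of the finite difference of a small function,
the finite difference of the right hand side has a definite sign, up to a small error. -/
theorem exists_slope_decay : ∃ c₁ : ℝ, 0 < c₁ ∧ c₁ ≤ 1 / 8 ∧ ∀ K : ℝ, 0 ≤ K → ∃ C : ℝ, 0 ≤ C ∧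
    ∀ f : ℝ → ℝ, IsSmall c₁ K f → ∀ τ ς s : ℝ, 0 < τ → τ ≤ 1 → (ς = 1 ∨ ς = -1) →
      (∀ r, |fwdQuot f (τ ^ 2) r| ≤ ς * fwdQuot f (τ ^ 2) s) →
        ς * fwdQuot (rhs f) (τ ^ 2) s ≤ -(1 / 32) * (ς * fwdQuot f (τ ^ 2) s) + C * τ := by
  obtain ⟨C₁, hC₁, hrhs⟩ := exists_rhs_sub_pv_bound
  obtain ⟨C₂, hC₂, hcorr⟩ := exists_corrected_deriv_bound
  obtain ⟨C₃, hC₃, hlow⟩ := exists_frozenKernel_lower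
  obtain ⟨C₄, hC₄, hbd⟩ := exists_frozenBoundary_bound
  have hCb : 0 < 8 * (C₂ + C₃ + 1) := by positivity
  -- The threshold is fixed before `K`. It makes `C₃ * c₁ ≤ 1 / 8` and `C₂ * c₁ ^ 2 ≤ 1 / 64`, so
  -- that the perturbations consume only a small part of the dissipation.
  refine ⟨1 / (8 * (C₂ + C₃ + 1)), by positivity, ?_, fun K hK => ?_⟩
  · rw [div_le_div_iff_of_pos_left one_pos hCb (by norm_num)]
    linarith
  set c₁ := 1 / (8 * (C₂ + C₃ + 1)) with hc₁
  have hc₁0 : 0 < c₁ := by positivity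
  have hc₁8 : c₁ ≤ 1 / 8 := by
    rw [hc₁, div_le_div_iff_of_pos_left one_pos hCb (by norm_num)]
    linarith
  have hsum : 8 * (C₂ + C₃ + 1) * c₁ = 1 := by rw [hc₁]; field_simp
  have hk2 : C₂ * c₁ ^ 2 ≤ 1 / 64 := by nlinarith [mul_nonneg hC₂ hc₁0.le, mul_nonneg hC₃ hc₁0.le]
  have hk3 : C₃ * c₁ ≤ 1 / 8 := by nlinarith [mul_nonneg hC₂ hc₁0.le]
  refine ⟨10 * C₂ * (1 + K) ^ 2 + 4 * C₄ * K + K + 2 * C₁ * (1 + K), by positivity,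
    fun f hf τ ς s hτ hτ1 hς hmax => ?_⟩
  set η := τ ^ 2 with hη'
  -- With `η = τ ^ 2` and `ε = τ ^ 8`, each of `η * log (π / ε)`, `ε / η` and `√ε / η` is at most a
  -- constant times `τ`.
  set ε := τ ^ 8 with hε'
  have hη : 0 < η := by positivity
  have hε : 0 < ε := by positivity
  have hε1 : ε ≤ 1 := pow_le_one₀ hτ.le hτ1
  have hεπ : ε ≤ Real.pi := hε1.trans (by linarith [Real.pi_gt_three])
  have hητ : η ≤ τ := by rw [hη']; nlinarith
  have hετ : ε ≤ τ := by
    have := pow_le_pow_of_le_one hτ.le hτ1 (show 1 ≤ 8 by norm_num)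
    rwa [pow_one] at this
  set G := |fwdQuot f η s| with hG'
  have hG0 : 0 ≤ G := abs_nonneg _
  have hG : ς * fwdQuot f η s = G := le_antisymm (abs_le_of_sign hς le_rfl) (hmax s)
  set Dg := dissipation f ε η s with hDg
  have hDg0 : 0 ≤ Dg := setIntegral_nonneg (measurableSet_cutSet ε) fun α _ =>
      div_nonneg (quotGap_nonneg f η s α) (sq_nonneg _)
  have hDgG : 3 / 2 * G - K * ε ≤ Dg := hf.le_dissipation hε hε1 hη hς hmax
  -- the corrected part
  have b1 : ς * ((corrected f ε s (s + η) - corrected f ε s s) / η)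
      ≤ C₂ * (1 + K) ^ 2 * (8 * τ) + C₂ * (c₁ ^ 2 * G + 2 * K * τ) + C₂ * c₁ ^ 2 * Dg := by
    refine abs_le_of_sign hς ?_
    rw [abs_div, abs_of_pos hη, div_le_iff₀ hη]
    refine (hcorr c₁ K f hf hc₁8 ε η s hε hεπ hη).trans
      (mul_le_mul_of_nonneg_right ?_ hη.le)
    have h1 : η * (1 + Real.log (Real.pi / ε)) ≤ 8 * τ := by
      refine (mul_le_mul_of_nonneg_left (log_pi_div_pow_le hτ) hη.le).trans_eq ?_
      rw [hη']; field_simp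
    have h2 := mul_le_mul_of_nonneg_left h1 (show 0 ≤ C₂ * (1 + K) ^ 2 by positivity)
    have h3 := mul_le_mul_of_nonneg_left (mul_le_mul_of_nonneg_left hητ hK) hC₂
    have h4 := mul_le_mul_of_nonneg_left (mul_le_mul_of_nonneg_left hετ hK) hC₂
    linarith only [h2, h3, h4]
  -- the dissipative part
  have b2 : ς * (∫ α in cutSet ε, frozenKernel f s α * (fwdQuot f η (s - α) - fwdQuot f η s))
      ≤ -((1 - C₃ * c₁) * Dg) := by
    rw [← integral_const_mul, hDg, dissipation, ← integral_const_mul, ← integral_neg]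
    have hg := hf.continuous_fwdQuot η
    refine setIntegral_mono_on ?_ ((hf.integrableOn_dissipation hε η s).const_mul _).neg
      (measurableSet_cutSet ε) fun α hα => ?_
    · refine (integrableOn_cutSet_of_continuousAt hε fun α h h0 =>
        (hf.continuousAt_frozenKernel hc₁8 s h h0).mul ?_).const_mul ς
      exact Continuous.continuousAt (by fun_prop)
    · have h1 := hlow c₁ K f hf hc₁8 s α (abs_of_mem_cutSet hε hα).2
      have h2 : ς * fwdQuot f η (s - α) ≤ ς * fwdQuot f η s := abs_le_of_sign hς (hmax (s - α))
      have h3 : ς * (fwdQuot f η (s - α) - fwdQuot f η s) = -quotGap f η s α := by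
        rw [quotGap]
        rcases hς with rfl | rfl
        · rw [abs_of_nonpos (by linarith)]; ring
        · rw [abs_of_nonneg (by linarith)]; ring
      have h4 := mul_le_mul_of_nonneg_right h1 (quotGap_nonneg f η s α)
      calc ς * (frozenKernel f s α * (fwdQuot f η (s - α) - fwdQuot f η s))
          = frozenKernel f s α * (ς * (fwdQuot f η (s - α) - fwdQuot f η s)) := by ring
        _ = -(frozenKernel f s α * quotGap f η s α) := by rw [h3]; ring
        _ ≤ -((1 - C₃ * c₁) / chord α ^ 2 * quotGap f η s α) := neg_le_neg h4
        _ = _ := by ring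
  -- the boundary part
  have b3 : ∀ α, |α| = ε →
      |frozenBoundary f s α * (fwdQuot f η (s - α) - fwdQuot f η s)| ≤ 2 * C₄ * K * τ := by
    intro α hα
    have h1 := hbd c₁ K f hf hc₁8 s α (hα.trans_le hεπ) (abs_pos.1 (hα ▸ hε))
    have h2 := hf.abs_fwdQuot_sub_le_of_max hη hς hmax hα.le
    rw [abs_mul]
    rw [hα] at h1
    refine (mul_le_mul h1 h2 (abs_nonneg _) (by positivity)).trans ?_
    have h3 : C₄ / ε * (2 * K * ε ^ 2 / η) = 2 * C₄ * K * τ ^ 6 := by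
      rw [hε', hη']; field_simp
    rw [h3]
    refine mul_le_mul_of_nonneg_left ?_ (by positivity)
    have := pow_le_pow_of_le_one hτ.le hτ1 (show 1 ≤ 6 by norm_num)
    rwa [pow_one] at this
  have b3a := abs_le.1 (b3 ε (abs_of_pos hε))
  have b3b := abs_le.1 (b3 (-ε) (by rw [abs_neg, abs_of_pos hε]))
  -- the truncation
  have hsq : √ε = τ ^ 4 := by
    rw [hε', show τ ^ 8 = (τ ^ 4) ^ 2 by ring, Real.sqrt_sq (by positivity)]
  have b4 : ς * (4 * Real.pi * fwdQuot (rhs f) η s)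
      ≤ ς * (((∫ α in cutSet ε, pvKernel f (s + η) α) - ∫ α in cutSet ε, pvKernel f s α) / η)
        + 2 * C₁ * (1 + K) * τ := by
    have hf8 := hf.mono hc₁8
    have h1 := hrhs K f hf8 s ε hε hε1
    have h2 := hrhs K f hf8 (s + η) ε hε hε1
    have h3 : ς * ((4 * Real.pi * rhs f (s + η) - (∫ α in cutSet ε, pvKernel f (s + η) α))
        - (4 * Real.pi * rhs f s - ∫ α in cutSet ε, pvKernel f s α))
        ≤ 2 * (C₁ * (1 + K) * √ε) := by
      refine abs_le_of_sign hς ((abs_sub _ _).trans ?_)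
      linarith
    have h4 : 2 * (C₁ * (1 + K) * √ε) ≤ 2 * C₁ * (1 + K) * τ * η := by
      rw [hsq, hη']
      have : τ ^ 4 ≤ τ * τ ^ 2 := by
        have := pow_le_pow_of_le_one hτ.le hτ1 (show 3 ≤ 4 by norm_num)
        calc τ ^ 4 ≤ τ ^ 3 := this
          _ = _ := by ring
      have := mul_le_mul_of_nonneg_left this (show 0 ≤ 2 * C₁ * (1 + K) by positivity)
      linarith
    have h5 := h3.trans h4
    rw [← sub_le_iff_le_add', ← mul_sub, fwdQuot]
    rw [← div_le_iff₀ hη] at h5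
    refine le_of_eq_of_le ?_ h5
    field_simp
    ring
  rw [hf.integral_pvKernel_sub hc₁8 hε hη s] at b4
  have b5 : ς * (frozenBoundary f s ε * (fwdQuot f η (s - ε) - fwdQuot f η s)
      - frozenBoundary f s (-ε) * (fwdQuot f η (s - -ε) - fwdQuot f η s))
      ≤ 4 * C₄ * K * τ := by
    refine abs_le_of_sign hς ?_
    rw [abs_le]
    constructor <;> linarith
  rw [hG]
  have hKτ := mul_le_mul_of_nonneg_left hετ hK
  have hK2 : C₂ * (K * τ) ≤ C₂ * ((1 + K) ^ 2 * τ) := by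
    refine mul_le_mul_of_nonneg_left (mul_le_mul_of_nonneg_right ?_ hτ.le) hC₂
    nlinarith only [hK]
  have hx1 := mul_le_mul_of_nonneg_right hk2 hG0
  have hx2 := mul_le_mul_of_nonneg_right hk2 hDg0
  have hx3 := mul_le_mul_of_nonneg_right hk3 hDg0
  have hE : 0 ≤ (10 * C₂ * (1 + K) ^ 2 + 4 * C₄ * K + K + 2 * C₁ * (1 + K)) * τ := by positivity
  -- At least `1 - 1 / 8 - 1 / 64` of the dissipation survives, and it is at least `3 / 2 * G` up to
  -- an error, which leaves more than `G / 2`. Division by `4 * π ≤ 16` gives the rate `1 / 32`.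
  have b6 : 4 * Real.pi * (ς * fwdQuot (rhs f) η s)
      ≤ -(1 / 2) * G + (10 * C₂ * (1 + K) ^ 2 + 4 * C₄ * K + K + 2 * C₁ * (1 + K)) * τ := by
    rw [mul_add, mul_add] at b4
    have b7 := b4.trans (add_le_add_left (add_le_add (add_le_add b1 b2) b5) _)
    have hKτ0 : 0 ≤ K * τ := by positivity
    linarith only [b7, hDgG, hx1, hx2, hx3, hK2, hKτ, hG0, hKτ0]
  generalize (10 * C₂ * (1 + K) ^ 2 + 4 * C₄ * K + K + 2 * C₁ * (1 + K)) * τ = E at b6 hE ⊢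
  by_contra hcon
  push Not at hcon
  have h1 := mul_lt_mul_of_pos_left hcon (show 0 < 4 * Real.pi by positivity)
  nlinarith [mul_le_mul_of_nonneg_right Real.pi_gt_three.le hE,
    mul_le_mul_of_nonneg_right Real.pi_le_four hG0]

/-! ### The supremum norm of periodic functions -/

theorem bddAbove_range_abs {f : ℝ → ℝ} (hp : Function.Periodic f (2 * Real.pi))
    (hc : Continuous f) : BddAbove (range fun s => |f s|) := by
  have h : Function.Periodic (fun s => |f s|) (2 * Real.pi) := fun s => by simp only [hp s]
  exact (h.compact_of_continuous (by positivity) hc.abs).bddAbove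

theorem abs_le_supNorm {f : ℝ → ℝ} (hp : Function.Periodic f (2 * Real.pi))
    (hc : Continuous f) (s : ℝ) : |f s| ≤ supNorm f :=
  le_ciSup (bddAbove_range_abs hp hc) s

theorem supNorm_le {f : ℝ → ℝ} {B : ℝ} (h : ∀ s, |f s| ≤ B) : supNorm f ≤ B :=
  ciSup_le h

theorem supNorm_nonneg (f : ℝ → ℝ) : 0 ≤ supNorm f :=
  Real.iSup_nonneg fun _ => abs_nonneg _

theorem exists_sign_mul_eq_supNorm {f : ℝ → ℝ} (hp : Function.Periodic f (2 * Real.pi))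
    (hc : Continuous f) :
    ∃ ς s, (ς = 1 ∨ ς = -1) ∧ ς * f s = supNorm f ∧ ∀ r, |f r| ≤ ς * f s := by
  have h : Function.Periodic (fun s => |f s|) (2 * Real.pi) := fun s => by simp only [hp s]
  obtain ⟨s, hs⟩ := (h.compact_of_continuous (by positivity) hc.abs).sSup_mem (range_nonempty _)
  have hs' : |f s| = supNorm f := hs
  obtain ⟨ς, hς, he⟩ : ∃ ς : ℝ, (ς = 1 ∨ ς = -1) ∧ ς * f s = |f s| := by
    rcases le_total 0 (f s) with h0 | h0
    · exact ⟨1, Or.inl rfl, by rw [abs_of_nonneg h0, one_mul]⟩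
    · exact ⟨-1, Or.inr rfl, by rw [abs_of_nonpos h0, neg_one_mul]⟩
  exact ⟨ς, s, hς, he.trans hs', fun r => by rw [he, hs']; exact abs_le_supNorm hp hc r⟩

theorem tendsto_supNorm {F : ℝ → ℝ → ℝ} {S : Set ℝ} {t₀ : ℝ} (ht₀ : t₀ ∈ S)
    (hp : ∀ t ∈ S, Function.Periodic (F t) (2 * Real.pi)) (hc : ∀ t ∈ S, Continuous (F t))
    (h : TendstoUniformly F (F t₀) (𝓝[S] t₀)) :
    Tendsto (fun t => supNorm (F t)) (𝓝[S] t₀) (𝓝 (supNorm (F t₀))) := by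
  rw [Metric.tendsto_nhds]
  intro ε hε
  filter_upwards [Metric.tendstoUniformly_iff.1 h (ε / 2) (half_pos hε), self_mem_nhdsWithin]
    with t ht htS
  have h1 : supNorm (F t) ≤ supNorm (F t₀) + ε / 2 := supNorm_le fun s => by
    have h2 := abs_le_supNorm (hp t₀ ht₀) (hc t₀ ht₀) s
    have h3 := ht s
    rw [dist_comm, Real.dist_eq] at h3
    linarith [abs_sub_abs_le_abs_sub (F t s) (F t₀ s)]
  have h1' : supNorm (F t₀) ≤ supNorm (F t) + ε / 2 := supNorm_le fun s => by
    have h2 := abs_le_supNorm (hp t htS) (hc t htS) s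
    have h3 := ht s
    rw [Real.dist_eq] at h3
    linarith [abs_sub_abs_le_abs_sub (F t₀ s) (F t s)]
  rw [Real.dist_eq, abs_lt]
  constructor <;> linarith

/-! ### Barriers -/

theorem exists_first_zero {u : ℝ → ℝ} {a b : ℝ} (hu : ContinuousOn u (Icc a b)) (ha : u a < 0)
    (hb : ∃ t ∈ Icc a b, 0 ≤ u t) : ∃ t ∈ Ioc a b, u t = 0 ∧ ∀ r ∈ Ico a t, u r < 0 := by
  obtain ⟨t₁, ht₁, hut₁⟩ := hb
  have hS : IsCompact (Icc a b ∩ u ⁻¹' Ici 0) :=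
    isCompact_Icc.of_isClosed_subset (hu.preimage_isClosed_of_isClosed isClosed_Icc isClosed_Ici)
      inter_subset_left
  obtain ⟨t, ⟨ht, hut⟩, hleast⟩ := hS.exists_isLeast ⟨t₁, ht₁, hut₁⟩
  have hat : a < t := lt_of_le_of_ne ht.1 fun h => by
    subst h; exact absurd ha (not_lt.2 hut)
  obtain ⟨r, hr, hur⟩ := intermediate_value_Icc hat.le (hu.mono (Icc_subset_Icc_right ht.2))
    ⟨ha.le, hut⟩
  have hrt : r = t := le_antisymm hr.2
    (hleast ⟨⟨hr.1, hr.2.trans ht.2⟩, hur.ge⟩)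
  refine ⟨t, ⟨hat, ht.2⟩, hrt ▸ hur, fun r hr => ?_⟩
  by_contra h
  exact absurd (hleast ⟨⟨hr.1, hr.2.le.trans ht.2⟩, not_lt.1 h⟩) (not_le.2 hr.2)

theorem not_hasDerivAt_pos_of_nonneg_left {φ : ℝ → ℝ} {a t φ' : ℝ} (hat : a < t)
    (h0 : φ t = 0) (h : ∀ r ∈ Ico a t, 0 ≤ φ r) (hφ : HasDerivAt φ φ' t) : φ' ≤ 0 := by
  refine le_of_tendsto ((hasDerivAt_iff_tendsto_slope.1 hφ).mono_left
    (nhdsWithin_mono (s := Iio t) t fun r hr => ne_of_lt hr)) ?_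
  filter_upwards [Ico_mem_nhdsLT hat] with r hr
  rw [slope_def_field, h0, sub_zero]
  exact div_nonpos_of_nonneg_of_nonpos (h r hr) (sub_nonpos.2 hr.2.le)

/-- At the first contact of the supremum norm with `β`, `ς * g` at a maximum point `s` meets `β`
from below, so its time derivative is at least `β'`, against the hypothesis. The point `s` stays
fixed as time varies, so the supremum norm itself is never differentiated. -/
theorem supNorm_lt_barrier {g g' : ℝ → ℝ → ℝ} {β β' : ℝ → ℝ} {a b : ℝ}
    (hp : ∀ t ∈ Icc a b, Function.Periodic (g t) (2 * Real.pi))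
    (hc : ∀ t ∈ Icc a b, Continuous (g t))
    (hM : ContinuousOn (fun t => supNorm (g t)) (Icc a b))
    (hg : ∀ t ∈ Ioc a b, ∀ s, HasDerivAt (fun τ => g τ s) (g' t s) t)
    (hβ : ∀ t, HasDerivAt β (β' t) t) (ha : supNorm (g a) < β a)
    (hmax : ∀ t ∈ Ioc a b, ∀ ς s, (ς = 1 ∨ ς = -1) → (∀ r, |g t r| ≤ ς * g t s) →
      ς * g t s = β t → ς * g' t s < β' t) :
    ∀ t ∈ Icc a b, supNorm (g t) < β t := by
  intro t₁ ht₁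
  by_contra hcon
  have hβc : Continuous β := continuous_iff_continuousAt.2 fun t => (hβ t).continuousAt
  obtain ⟨t, ht, hut, hlt⟩ := exists_first_zero (u := fun t => supNorm (g t) - β t)
    (hM.sub hβc.continuousOn) (sub_neg.2 ha) ⟨t₁, ht₁, sub_nonneg.2 (not_lt.1 hcon)⟩
  have htI : t ∈ Icc a b := Ioc_subset_Icc_self ht
  obtain ⟨ς, s, hς, he, hr⟩ := exists_sign_mul_eq_supNorm (hp t htI) (hc t htI)
  have he' : ς * g t s = β t := he.trans (sub_eq_zero.1 hut)
  refine absurd (not_hasDerivAt_pos_of_nonneg_left (φ := fun r => β r - ς * g r s) ht.1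
    (sub_eq_zero.2 he'.symm) (fun r hr' => ?_) ((hβ t).sub ((hg t ht s).const_mul ς)))
    (not_le.2 (sub_pos.2 (hmax t ht ς s hς hr he')))
  have hrI : r ∈ Icc a b := ⟨hr'.1, hr'.2.le.trans ht.2⟩
  have h1 : supNorm (g r) - β r < 0 := hlt r hr'
  have h2 : ς * g r s ≤ supNorm (g r) := abs_le_of_sign hς (abs_le_supNorm (hp r hrI) (hc r hrI) s)
  show 0 ≤ β r - ς * g r s
  linarith

/-! ### Solutions -/

theorem Icc_subset_timeInterval {T : EReal} {a b : ℝ} (ha : 0 ≤ a) (hb : b ∈ timeInterval T) :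
    Icc a b ⊆ timeInterval T := fun _ ht =>
  ⟨ha.trans ht.1, lt_of_le_of_lt (EReal.coe_le_coe_iff.2 ht.2) hb.2⟩

theorem IsContinuousC2.continuousOn_supNorm {T : EReal} {h : ℝ → ℝ → ℝ} (hh : IsContinuousC2 T h)
    {k : ℕ} (hk : k ≤ 2) :
    ContinuousOn (fun t => supNorm (iteratedDeriv k (h t))) (timeInterval T) := fun t₀ ht₀ => by
  refine tendsto_supNorm (F := fun t => iteratedDeriv k (h t)) ht₀ (fun t ht => ?_)
    (fun t ht => (hh.contDiff t ht).continuous_iteratedDeriv k (by exact_mod_cast hk))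
    (hh.continuous k hk t₀ ht₀)
  intro s
  have h1 : (fun r => h t (r + 2 * Real.pi)) = h t := funext (hh.periodic t ht)
  have h2 := congrFun (iteratedDeriv_comp_add_const k (h t) (2 * Real.pi)) s
  rw [h1] at h2
  exact h2.symm

theorem IsContinuousC2.continuousOn_supNorm_deriv {T : EReal} {h : ℝ → ℝ → ℝ} (hh : IsContinuousC2 T h)
    :
    ContinuousOn (fun t => supNorm (deriv (h t))) (timeInterval T) := by
  simpa only [iteratedDeriv_one] using hh.continuousOn_supNorm (k := 1) (by norm_num)

theorem IsContinuousC2.continuousOn_w1infNorm {T : EReal} {h : ℝ → ℝ → ℝ} (hh : IsContinuousC2 T h)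
    :
    ContinuousOn (fun t => w1infNorm (h t)) (timeInterval T) := by
  have := hh.continuousOn_supNorm (k := 0) (by norm_num)
  simp only [iteratedDeriv_zero] at this
  exact this.add hh.continuousOn_supNorm_deriv

/-- The bound `K` of the second derivative comes from compactness of the time interval and depends
on the solution; it disappears in the limit of vanishing step. -/
theorem IsContinuousC2.exists_isSmall {T : EReal} {h : ℝ → ℝ → ℝ} (hh : IsContinuousC2 T h)
    {a b c : ℝ} (hab : Icc a b ⊆ timeInterval T)
    (hc : ∀ t ∈ Icc a b, w1infNorm (h t) ≤ c) :
    ∃ K, 0 ≤ K ∧ ∀ t ∈ Icc a b, IsSmall c K (h t) := by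
  obtain ⟨K, hK⟩ := (isCompact_Icc.image_of_continuousOn
    ((hh.continuousOn_supNorm (k := 2) le_rfl).mono hab)).bddAbove
  refine ⟨max K 0, le_max_right _ _, fun t ht => ?_⟩
  have hp := hh.periodic t (hab ht)
  have hcd := hh.contDiff t (hab ht)
  have hc1 : ContDiff ℝ 1 (deriv (h t)) := by
    have : ContDiff ℝ (1 + 1) (h t) := hcd.of_le (by norm_num)
    exact (contDiff_succ_iff_deriv.1 this).2.2
  have hp1 : Function.Periodic (deriv (h t)) (2 * Real.pi) := fun s => by
    rw [← deriv_comp_add_const, show (fun r => h t (r + 2 * Real.pi)) = h t from funext hp]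
  have hp2 : Function.Periodic (deriv (deriv (h t))) (2 * Real.pi) := fun s => by
    rw [← deriv_comp_add_const,
      show (fun r => deriv (h t) (r + 2 * Real.pi)) = deriv (h t) from funext hp1]
  have hw := hc t ht
  rw [w1infNorm] at hw
  refine ⟨hp, hcd, fun s => ?_, fun s => ?_, fun s => ?_⟩
  · linarith [abs_le_supNorm hp hcd.continuous s, supNorm_nonneg (deriv (h t))]
  · linarith [abs_le_supNorm hp1 hc1.continuous s, supNorm_nonneg (h t)]
  · refine (abs_le_supNorm hp2 (hc1.continuous_deriv le_rfl) s).trans ((hK ⟨t, ht, ?_⟩).trans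
      (le_max_left _ _))
    simp only
    congr 1
    exact funext (iteratedDeriv_two_eq (h t))

theorem IsContinuousC2.continuousOn_supNorm_fwdQuot {T : EReal} {h : ℝ → ℝ → ℝ} (hh : IsContinuousC2 T h)
    {η : ℝ} (hη : 0 < η) :
    ContinuousOn (fun t => supNorm (fwdQuot (h t) η)) (timeInterval T) := fun t₀ ht₀ => by
  have hc : ∀ t ∈ timeInterval T, Continuous (fwdQuot (h t) η) := fun t ht => by
    have := (hh.contDiff t ht).continuous
    unfold fwdQuot
    fun_prop
  refine tendsto_supNorm (F := fun t => fwdQuot (h t) η) ht₀ (fun t ht s => ?_) hc ?_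
  · rw [fwdQuot, fwdQuot, add_right_comm, hh.periodic t ht, hh.periodic t ht]
  have h0 := hh.continuous 0 (by norm_num) t₀ ht₀
  simp only [iteratedDeriv_zero] at h0
  rw [Metric.tendstoUniformly_iff] at h0 ⊢
  intro ε hε
  filter_upwards [h0 (ε * η / 2) (by positivity)] with t ht s
  have h1 := ht s
  have h2 := ht (s + η)
  rw [Real.dist_eq] at h1 h2 ⊢
  rw [fwdQuot, fwdQuot, ← sub_div, abs_div, abs_of_pos hη, div_lt_iff₀ hη]
  rw [abs_lt] at *
  constructor <;> linarith

theorem IsSmall.abs_deriv_le_supNorm {c K : ℝ} {f : ℝ → ℝ} (hf : IsSmall c K f) (s : ℝ) :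
    |deriv f s| ≤ supNorm (deriv f) :=
  abs_le_supNorm hf.periodic_deriv hf.continuous_deriv s

theorem IsSmall.supNorm_fwdQuot_le {c K η : ℝ} {f : ℝ → ℝ} (hf : IsSmall c K f) (hη : 0 < η) :
    supNorm (fwdQuot f η) ≤ supNorm (deriv f) := supNorm_le fun r => by
  have h := convex_univ.norm_image_sub_le_of_norm_deriv_le (f := f)
    (fun x _ => (hf.hasDerivAt x).differentiableAt) (fun x _ => hf.abs_deriv_le_supNorm x)
    (mem_univ r) (mem_univ (r + η))
  rw [Real.norm_eq_abs, Real.norm_eq_abs, add_sub_cancel_left, abs_of_pos hη] at h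
  rwa [fwdQuot, abs_div, abs_of_pos hη, div_le_iff₀ hη]

/-! ### Decay of the slope and monotonicity of the norm. -/

theorem hasDerivAt_exp_decay (δ a t : ℝ) :
    HasDerivAt (fun r => Real.exp (-δ * (r - a))) (-δ * Real.exp (-δ * (t - a))) t := by
  have := (((hasDerivAt_id t).sub_const a).const_mul (-δ)).exp
  simpa [mul_comm] using this

/-- A barrier argument for the forward quotient of step `τ ^ 2`, followed by a passage to the slope
at a cost `K * τ ^ 2`. Half of the rate `1 / 32` is given up to absorb the error `C * τ`. -/
theorem exists_deriv_decay : ∃ c₁ : ℝ, 0 < c₁ ∧ c₁ ≤ 1 / 8 ∧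
    ∀ (T : EReal) (h : ℝ → ℝ → ℝ), IsSolution T h → ∀ a b, 0 ≤ a → a ≤ b → b ∈ timeInterval T →
      (∀ t ∈ Icc a b, w1infNorm (h t) ≤ c₁) →
        supNorm (deriv (h b)) ≤ supNorm (deriv (h a)) * Real.exp (-(1 / 64) * (b - a)) := by
  obtain ⟨c₁, hc₁, hc₁8, hdec⟩ := exists_slope_decay
  refine ⟨c₁, hc₁, hc₁8, fun T h hh a b ha hab hb hw => ?_⟩
  have hI := Icc_subset_timeInterval ha hb
  obtain ⟨K, hK, hs⟩ := hh.regular.exists_isSmall hI hw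
  obtain ⟨C, hC, hdec⟩ := hdec K hK
  have hE1 : Real.exp (-(1 / 64) * (b - a)) ≤ 1 := Real.exp_le_one_iff.2 (by linarith)
  have hE0 := Real.exp_pos (-(1 / 64) * (b - a))
  set E := Real.exp (-(1 / 64) * (b - a)) with hE
  set A := supNorm (deriv (h a)) with hA
  have hA0 : 0 ≤ A := supNorm_nonneg _
  refine le_of_forall_pos_le_add fun ε hε => ?_
  set ν := ε / 2 with hν'
  have hν : 0 < ν := half_pos hε
  -- The barrier is at least `ν * E` on the whole interval, `E` being the exponential at the final
  -- time, so this smallness covers the error at any time of contact.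
  obtain ⟨τ, hτ, hτ1, hτC, hτK⟩ : ∃ τ : ℝ, 0 < τ ∧ τ ≤ 1 ∧ C * τ < 1 / 64 * (ν * E) ∧
      K * τ ^ 2 ≤ ν := by
    have hq : 0 < 1 / 64 * (ν * E) := by positivity
    refine ⟨min 1 (1 / 64 * (ν * E) / (C + K + 1)), lt_min one_pos (by positivity),
      min_le_left _ _, ?_, ?_⟩
    · refine (mul_le_mul_of_nonneg_left (min_le_right _ _) hC).trans_lt ?_
      rw [← mul_div_assoc, div_lt_iff₀ (by positivity), mul_comm]
      exact mul_lt_mul_of_pos_left (by linarith) hq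
    · have h0 : 0 < min 1 (1 / 64 * (ν * E) / (C + K + 1)) := lt_min one_pos (by positivity)
      have h1 : (min 1 (1 / 64 * (ν * E) / (C + K + 1))) ^ 2 ≤ 1 / 64 * (ν * E) / (C + K + 1) :=
        calc _ ≤ min 1 (1 / 64 * (ν * E) / (C + K + 1)) :=
              pow_le_of_le_one h0.le (min_le_left _ _) two_ne_zero
          _ ≤ _ := min_le_right _ _
      refine (mul_le_mul_of_nonneg_left h1 hK).trans ?_
      rw [← mul_div_assoc, div_le_iff₀ (by positivity), mul_comm]
      have h2 : 1 / 64 * (ν * E) ≤ ν := by nlinarith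
      exact mul_le_mul h2 (by linarith) hK hν.le
  have hη : 0 < τ ^ 2 := by positivity
  have hbar := supNorm_lt_barrier (g := fun t => fwdQuot (h t) (τ ^ 2))
    (g' := fun t => fwdQuot (rhs (h t)) (τ ^ 2))
    (β := fun t => (A + ν) * Real.exp (-(1 / 64) * (t - a)))
    (β' := fun t => (A + ν) * (-(1 / 64) * Real.exp (-(1 / 64) * (t - a)))) (a := a) (b := b)
    (fun t ht s => by
      rw [fwdQuot, fwdQuot, add_right_comm, hh.regular.periodic t (hI ht),
        hh.regular.periodic t (hI ht)])
    (fun t ht => (hs t ht).continuous_fwdQuot _)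
    ((hh.regular.continuousOn_supNorm_fwdQuot hη).mono hI)
    (fun t ht s => by
      have ht' := hI (Ioc_subset_Icc_self ht)
      have h1 := hh.equation t (ha.trans_lt ht.1) ht'.2
      exact ((h1 (s + τ ^ 2)).sub (h1 s)).div_const _)
    (fun t => (hasDerivAt_exp_decay _ a t).const_mul _)
    (by
      have := (hs a (left_mem_Icc.2 hab)).supNorm_fwdQuot_le hη
      simp only [sub_self, mul_zero, Real.exp_zero, mul_one]
      linarith)
    (fun t ht ς s hς hmax he => by
      have h1 := hdec (h t) (hs t (Ioc_subset_Icc_self ht)) τ ς s hτ hτ1 hς hmax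
      rw [he] at h1
      have h2 : E ≤ Real.exp (-(1 / 64) * (t - a)) := Real.exp_le_exp.2 (by linarith [ht.2])
      have h3 := mul_le_mul_of_nonneg_left h2 hν.le
      have h4 := mul_nonneg hA0 (Real.exp_pos (-(1 / 64) * (t - a))).le
      linarith)
    b (right_mem_Icc.2 hab)
  have hsb := hs b (right_mem_Icc.2 hab)
  refine supNorm_le fun r => ?_
  have h1 := hsb.abs_deriv_sub_fwdQuot_le hη (left_mem_Icc.2 (by linarith : r ≤ r + τ ^ 2))
  have h2 : |fwdQuot (h b) (τ ^ 2) r| ≤ supNorm (fwdQuot (h b) (τ ^ 2)) :=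
    abs_le_supNorm (fun s => by
      rw [fwdQuot, fwdQuot, add_right_comm, hsb.periodic, hsb.periodic])
      (hsb.continuous_fwdQuot _) r
  have h3 := abs_sub_abs_le_abs_sub (deriv (h b) r) (fwdQuot (h b) (τ ^ 2) r)
  have h4 : ν * E ≤ ν := mul_le_of_le_one_right hν.le hE1
  have h5 : supNorm (fwdQuot (h b) (τ ^ 2)) < (A + ν) * E := hbar
  have h6 : ε = ν + ν := (add_halves ε).symm
  linarith

/-- While the norm is small, `|h|_∞` grows at most at the rate `(1 / 64) A exp (-(t - a) / 64)`,
where `A` is the initial bound of the slope. In total it gains at most `A (1 - exp (-(b - a) /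
64))`, which is at most what `|h'|_∞` has lost. -/
theorem exists_w1infNorm_le : ∃ c₀ : ℝ, 0 < c₀ ∧
    ∀ (T : EReal) (h : ℝ → ℝ → ℝ), IsSolution T h → ∀ a b, 0 ≤ a → a ≤ b → b ∈ timeInterval T →
      (∀ t ∈ Icc a b, w1infNorm (h t) ≤ c₀) →
        w1infNorm (h b) ≤ w1infNorm (h a) ∧
        supNorm (deriv (h b)) ≤ supNorm (deriv (h a)) * Real.exp (-(1 / 64) * (b - a)) := by
  obtain ⟨c₁, hc₁, hc₁8, hdec⟩ := exists_deriv_decay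
  obtain ⟨C, hC, hrhs⟩ := exists_rhs_bound_at_max
  have hc₀ : 0 < min c₁ (1 / (64 * (C + 1))) := lt_min hc₁ (by positivity)
  refine ⟨min c₁ (1 / (64 * (C + 1))), hc₀, fun T h hh a b ha hab hb hw => ?_⟩
  set c := min c₁ (1 / (64 * (C + 1)))
  have hcc₁ : c ≤ c₁ := min_le_left _ _
  have hCc : C * c ≤ 1 / 64 := by
    refine (mul_le_mul_of_nonneg_left (min_le_right _ _) hC).trans ?_
    rw [mul_one_div, div_le_div_iff₀ (by positivity) (by norm_num)]
    linarith
  have hI := Icc_subset_timeInterval ha hb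
  have hdec' : ∀ t ∈ Icc a b, supNorm (deriv (h t))
      ≤ supNorm (deriv (h a)) * Real.exp (-(1 / 64) * (t - a)) := fun t ht =>
    hdec T h hh a t ha ht.1 (hI ht) fun r hr => (hw r ⟨hr.1, hr.2.trans ht.2⟩).trans hcc₁
  have hd := hdec' b (right_mem_Icc.2 hab)
  refine ⟨?_, hd⟩
  obtain ⟨K, hK, hs⟩ := hh.regular.exists_isSmall hI hw
  set A := supNorm (deriv (h a)) with hA
  have hA0 : 0 ≤ A := supNorm_nonneg _
  have hAc : A ≤ c := by
    have h1 := hw a (left_mem_Icc.2 hab)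
    rw [w1infNorm] at h1
    linarith [supNorm_nonneg (h a)]
  suffices hsup : supNorm (h b) ≤ supNorm (h a)
      + A * (1 - Real.exp (-(1 / 64) * (b - a))) by
    rw [w1infNorm, w1infNorm]
    linarith
  refine le_of_forall_pos_le_add fun ε hε => ?_
  have hν : 0 < ε / (1 + (b - a)) := div_pos hε (by linarith)
  set ν := ε / (1 + (b - a)) with hν'
  have hνε : ν * (1 + (b - a)) = ε := div_mul_cancel₀ _ (by linarith)
  have hM := hh.regular.continuousOn_supNorm (k := 0) (by norm_num)
  simp only [iteratedDeriv_zero] at hM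
  have hbar := supNorm_lt_barrier (g := h) (g' := fun t => rhs (h t))
    -- The last summand makes both the initial inequality and the comparison of derivatives strict;
    -- at time `b` it equals `ε`.
    (β := fun t => supNorm (h a) + A * (1 - Real.exp (-(1 / 64) * (t - a))) + ν * (1 + (t - a)))
    (β' := fun t => A * (1 / 64 * Real.exp (-(1 / 64) * (t - a))) + ν) (a := a) (b := b)
    (fun t ht => (hs t ht).periodic) (fun t ht => (hs t ht).continuous) (hM.mono hI)
    (fun t ht s => hh.equation t (ha.trans_lt ht.1) (hI (Ioc_subset_Icc_self ht)).2 s)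
    (fun t => by
      have h1 := (((hasDerivAt_exp_decay (1 / 64) a t).const_sub 1).const_mul A).const_add
        (supNorm (h a))
      have h2 := ((((hasDerivAt_id t).sub_const a).const_add 1).const_mul ν)
      exact (h1.add h2).congr_deriv (by simp))
    (by
      simp only [sub_self, mul_zero, Real.exp_zero, add_zero, mul_one]
      linarith)
    (fun t ht ς s hς hmax _ => by
      have htI := Ioc_subset_Icc_self ht
      have hE0 := Real.exp_pos (-(1 / 64) * (t - a))
      have hE1 : Real.exp (-(1 / 64) * (t - a)) ≤ 1 :=
        Real.exp_le_one_iff.2 (by linarith [ht.1])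
      have h1 := hrhs c K (A * Real.exp (-(1 / 64) * (t - a))) (h t) (hs t htI)
        (hcc₁.trans hc₁8) (hCc.trans (by norm_num))
        ((mul_le_of_le_one_right hA0 hE1).trans hAc)
        (fun σ => ((hs t htI).abs_deriv_le_supNorm σ).trans (hdec' t htI)) ς s hς hmax
      have h2 := mul_le_mul_of_nonneg_right hCc (mul_nonneg hA0 hE0.le)
      linarith)
    b (right_mem_Icc.2 hab)
  rw [hνε] at hbar
  exact hbar.le

end NPeskin

end

/-! ### The continuity argument. -/

theorem mainTheorem2 :
    ∃ c₀ : ℝ, 0 < c₀ ∧ ∃ δ : ℝ, 0 < δ ∧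
      ∀ (T : EReal) (h₀ : ℝ → ℝ) (h : ℝ → ℝ → ℝ), 0 < T →
        NPeskin.IsSolution T h → h 0 = h₀ → NPeskin.w1infNorm h₀ < c₀ →
          AntitoneOn (fun t : ℝ => NPeskin.w1infNorm (h t)) (NPeskin.timeInterval T) ∧
          (∀ t : ℝ, 0 ≤ t → (t : EReal) < T →
            NPeskin.w1infNorm (h t) ≤ NPeskin.w1infNorm h₀) ∧
          (∀ t : ℝ, 0 ≤ t → (t : EReal) < T →
            NPeskin.supNorm (deriv (h t)) ≤
              NPeskin.supNorm (deriv h₀) * Real.exp (-δ * t)) := by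
  obtain ⟨c₀, hc₀, hmain⟩ := NPeskin.exists_w1infNorm_le
  refine ⟨c₀, hc₀, 1 / 64, by norm_num, ?_⟩
  rintro T _ h - hh rfl hsmall
  -- At a first time with norm `c₀` the bound `≤ c₀` holds up to that time, so monotonicity applies
  -- and gives `c₀ ≤ w1infNorm (h 0) < c₀`.
  have hlt : ∀ t ∈ NPeskin.timeInterval T, NPeskin.w1infNorm (h t) < c₀ := by
    intro b hb
    have hI := NPeskin.Icc_subset_timeInterval le_rfl hb
    by_contra hcon
    obtain ⟨t, ht, hut, hr⟩ := NPeskin.exists_first_zero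
      (u := fun t => NPeskin.w1infNorm (h t) - c₀)
      ((hh.regular.continuousOn_w1infNorm.mono hI).sub continuousOn_const) (sub_neg.2 hsmall)
      ⟨b, right_mem_Icc.2 hb.1, sub_nonneg.2 (not_lt.1 hcon)⟩
    have hle : ∀ r ∈ Icc 0 t, NPeskin.w1infNorm (h r) ≤ c₀ := fun r hr' => by
      rcases hr'.2.eq_or_lt with rfl | hlt
      · exact (sub_eq_zero.1 hut).le
      · exact (sub_neg.1 (hr r ⟨hr'.1, hlt⟩)).le
    have h1 := (hmain T h hh 0 t le_rfl ht.1.le (hI (Ioc_subset_Icc_self ht)) hle).1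
    have h2 : NPeskin.w1infNorm (h t) = c₀ := sub_eq_zero.1 hut
    linarith
  have hstep : ∀ a b, 0 ≤ a → a ≤ b → b ∈ NPeskin.timeInterval T → _ := fun a b ha hab hb =>
    hmain T h hh a b ha hab hb fun t ht =>
      (hlt t (NPeskin.Icc_subset_timeInterval ha hb ht)).le
  refine ⟨fun a ha b hb hab => (hstep a b ha.1 hab hb).1,
    fun t ht htT => (hstep 0 t le_rfl ht ⟨ht, htT⟩).1, fun t ht htT => ?_⟩
  have h1 := (hstep 0 t le_rfl ht ⟨ht, htT⟩).2
  rwa [sub_zero] at h1
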